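/- Let $R$ be a commutative ring with unity, and let $\Gamma$ be a (discrete) group. Let $\mathcal{F}$ be the poset of finite subgroups of $\Gamma$, ordered by inclusion. A Bredon contramodule is a contravariant functor to the category of $R$-modules from the category of transitive $\Gamma$-sets $\Gamma/H$, $H\in\mathcal{F}$, with $\Gamma$-maps as morphisms. Let $\underline{\operatorname{cd}}\,\Gamma$ be the projective dimension (the minimal length of a projective resolution) of the constant Bredon contramodule with value $R$. For $H\in\mathcal{F}$ put $WH=N_\Gamma(H)/H$, let $\mathcal{F}_H=\{K\in\mathcal{F} : H<K\}$ (strict inclusion), and let $|\mathcal{F}_H|$ be the geometric realization of this poset. For a group $W$ let $B(W)$ be the $RW$-module of all functions $W\to R$ that take only finitely many distinct values, where $W$ acts by translation. Projective dimensions $\operatorname{pd}_{W}$ are taken over the group ring $RW$, and the zero object has projective dimension $-\infty$. **Theorem.** Suppose that there is a bound on the orders of the finite subgroups of $\Gamma$ and that $\underline{\operatorname{cd}}\,\Gamma<\infty$. Suppose also that there is an order-reversing function $l:\mathcal{F}\to\mathbb{Z}$ (that is, $H\le K$ implies $l(K)\le l(H)$) such that for each finite subgroup $H\le\Gamma$ we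 have $\operatorname{pd}_{WH}B(WH)\le l(H)$ and - (i) either $l(K)<l(H)$ for every finite subgroup $K$ with $H<K$, - (ii) or $|\mathcal{F}_H|$ is contractible. Then $\underline{\operatorname{cd}}\,\Gamma\le l(1)$, where $1$ is the trivial subgroup. -/

import Mathlib

open CategoryTheory

universe u v

noncomputable section

/-- The finite subgroups of a group, partially ordered by inclusion. -/
abbrev FiniteSubgroup (Γ : Type v) [Group Γ] : Type v :=
  {H : Subgroup Γ // Finite H}

/-- The trivial subgroup as a finite subgroup. -/
def FiniteSubgroup.one (Γ : Type v) [Group Γ] : FiniteSubgroup Γ :=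
  ⟨⊥, inferInstance⟩

/-- There is a common bound on the orders of the finite subgroups of `Γ`. -/
def HasBoundedFiniteSubgroups (Γ : Type v) [Group Γ] : Prop :=
  ∃ n : ℕ, ∀ H : Subgroup Γ, Finite H → Nat.card H ≤ n

/-- The geometric realization of (the nerve of, equivalently the order complex of) the poset of
all finite subgroups of `Γ` that strictly contain `H`. -/
abbrev finiteSubgroupsAboveRealization {Γ : Type v} [Group Γ] (H : FiniteSubgroup Γ) :
    TopCat.{v} :=
  SSet.toTop.obj (nerve (Set.Ioi H))

/-- The Weyl group `WH = N_Γ(H) / H`. -/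
abbrev WeylGroup {Γ : Type v} [Group Γ] (H : Subgroup Γ) : Type v :=
  Subgroup.normalizer (H : Set Γ) ⧸ H.subgroupOf (Subgroup.normalizer (H : Set Γ))

/-! ### The module of bounded functions -/

/-- The `R`-module of all functions `W → R` that take only finitely many distinct values. -/
def boundedFunctions (R : Type u) [CommRing R] (W : Type v) : Submodule R (W → R) where
  carrier := {f | (Set.range f).Finite}
  zero_mem' := Set.Finite.subset (Set.finite_singleton (0 : R)) (by rintro _ ⟨x, rfl⟩; simp)
  add_mem' := by
    intro f g hf hg
    refine (Set.Finite.image2 (· + ·) hf hg).subset ?_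
    rintro _ ⟨x, rfl⟩
    exact ⟨f x, ⟨x, rfl⟩, g x, ⟨x, rfl⟩, rfl⟩
  smul_mem' := by
    intro c f hf
    refine (hf.image (c * ·)).subset ?_
    rintro _ ⟨x, rfl⟩
    exact ⟨f x, ⟨x, rfl⟩, rfl⟩

/-- The action of `W` on the bounded functions by translation: `(g • f) x = f (g⁻¹ * x)`. -/
def boundedFunctionsRep (R : Type u) [CommRing R] (W : Type v) [Group W] :
    Representation R W (boundedFunctions R W) where
  toFun g :=
    { toFun := fun f => ⟨fun x => f.1 (g⁻¹ * x),
        f.2.subset (by rintro _ ⟨x, rfl⟩; exact ⟨g⁻¹ * x, rfl⟩)⟩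
      map_add' := fun _ _ => rfl
      map_smul' := fun _ _ => rfl }
  map_one' := by
    ext f x
    simp
  map_mul' g h := by
    ext f x
    simp [mul_assoc]

/-- The module of bounded functions `B(W)` as a module over the group ring of `W`. -/
def boundedModule (R : Type u) [CommRing R] (W : Type v) [Group W] :
    ModuleCat.{max u v} (MonoidAlgebra R W) :=
  ModuleCat.of (MonoidAlgebra R W) (boundedFunctionsRep R W).asModule

/-! ### Bredon contramodules and the Bredon cohomological dimension -/

/-- An object of the orbit category of `Γ` for the family of finite subgroups. It stands for the
transitive `Γ`-set `Γ / stab`. -/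
structure FiniteOrbit (Γ : Type v) [Group Γ] : Type v where
  /-- the finite subgroup `H` of the orbit `Γ / H` -/
  stab : Subgroup Γ
  finite : Finite stab

/-- The orbit category: the morphisms from `Γ / H` to `Γ / K` are the `Γ`-equivariant maps. -/
instance (Γ : Type v) [Group Γ] : Category.{v} (FiniteOrbit Γ) where
  Hom X Y := (Γ ⧸ X.stab) →[Γ] (Γ ⧸ Y.stab)
  id X := MulActionHom.id Γ
  comp f g := g.comp f

/-- Bredon contramodules over `R` for the family of finite subgroups of `Γ`: the contravariant
functors from the orbit category to the category of `R`-modules. -/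
abbrev BredonContramodule (R : Type u) [CommRing R] (Γ : Type v) [Group Γ] :=
  (FiniteOrbit Γ)ᵒᵖ ⥤ ModuleCat.{max u v} R

/-- The trivial Bredon contramodule: the constant functor with value `R`. -/
def trivialContramodule (R : Type u) [CommRing R] (Γ : Type v) [Group Γ] :
    BredonContramodule R Γ :=
  (Functor.const _).obj (ModuleCat.of R (ULift.{v} R))

/-- The Bredon cohomological dimension of `Γ` over `R` for the family of finite subgroups:
the projective dimension of the trivial contramodule. -/
def bredonCd (R : Type u) [CommRing R] (Γ : Type v) [Group Γ] : WithBot ℕ∞ :=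
  projectiveDimension (trivialContramodule R Γ)

/-- The inclusion of the values of a projective dimension, `-∞`, a natural number or `∞`, into
the integers extended by `-∞` and `∞`, where they can be compared with an integer. -/
def toExtendedInt (d : WithBot ℕ∞) : WithBot (WithTop ℤ) :=
  d.map (WithTop.map (fun n : ℕ => (n : ℤ)))

end

/-! Write `Ext^n(R, M)` for the extensions of the constant contramodule by a contramodule `M`. The
claim is that these groups vanish for all `M` and all `n > l(1)`. Since the orders of the
stabilizers are bounded, `M` has a finite filtration by the order of the stabilizer. In the orbit
category a morphism between orbits whose stabilizers have equal order is an isomorphism, so each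
layer is a product of contramodules concentrated at a single orbit `Γ/H`
(`extZero_of_concentrated`). As `l(H) ≤ l(1)`, it suffices that `Ext^n(R, M) = 0` for `M`
concentrated at `Γ/H` and `n > l(H)`. This is `extZero_concentrated`, by induction from large
subgroups to small ones.

Case (i). Let `W = WH` and `B = B(W)`. The functor `M ↦ M(Γ/H) ⊗ B` to `RW`-modules has a right
adjoint, coinduction. `B` is free over `R` (Nöbeling), and the identity of `B` is a sum of
translates `g τ g⁻¹` over any finite subgroup of `W`. As `W` acts with finite stabilizers on the
morphisms out of `Γ/H`, coinduction preserves epimorphisms, so the left adjoint preserves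
projectives. Hence `Ext^n(R, coind N)` vanishes when `Ext^n_{RW}(B, N)` does, in particular for `n >
l(H)`. The part of `coind` concentrated at `Γ/H` differs from it by a contramodule living strictly
above `H`, where `l` is smaller, so the degree lost in the long exact sequence does no harm.
Evaluation at the constant function `1` maps this part onto `M`, with kernel again concentrated at
`Γ/H`; replacing `M` by the kernel raises the degree, and finiteness of the dimension ends the
process (`extZero_of_coind`).

Case (ii). All `Ext^n(R, M)` vanish (`extZero_of_contractible`). `M` embeds into functions on the
points with stabilizer exactly `H`. These functions are resolved by functions on flags of finite
subgroups above `H`, which are products of coinduced functors without higher extensions. Maps from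
`R` into the resolution form the cochain complex of the poset above `H`, which is exact by
contractibility.

The passage from a contractible realization to an acyclic complex of decreasing lists
(`acyclic_of_contractible`) compares, by acyclic carriers, lists in the poset with small lists of
points of the realization, and cuts the contracting homotopy into small prisms. -/

noncomputable section

/-! ### The augmented complex of lists -/

/-- The free abelian group on the lists with entries in `T`. -/
abbrev ListChain (T : Type*) := List T →₀ ℤ

namespace ListChain

variable {T T' : Type*}

/-- Putting `a` in front of every list. -/
def cons (a : T) : ListChain T →ₗ[ℤ] ListChain T := Finsupp.lmapDomain ℤ ℤ (List.cons a)

@[simp] lemma cons_single (a : T) (l : List T) (n : ℤ) :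
    cons a (Finsupp.single l n) = Finsupp.single (a :: l) n := by simp [cons]

/-- The boundary of a list. -/
def bdList : List T → ListChain T
  | [] => 0
  | a :: l => Finsupp.single l 1 - cons a (bdList l)

/-- The alternating sum of the deletions of an entry; the empty list has degree `-1`. -/
def bd : ListChain T →ₗ[ℤ] ListChain T := Finsupp.linearCombination ℤ bdList

lemma bd_single (l : List T) : bd (Finsupp.single l 1) = bdList l := by simp [bd]

lemma bd_nil : bd (Finsupp.single ([] : List T) 1) = 0 := by simp [bd_single, bdList]

lemma hom_ext {M : Type*} [AddCommGroup M] {f g : ListChain T →ₗ[ℤ] M}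
    (h : ∀ l, f (Finsupp.single l 1) = g (Finsupp.single l 1)) (z : ListChain T) : f z = g z := by
  have : f = g := by
    ext l
    exact h l
  rw [this]

/-- The empty list in degree `-1` makes `cons a` a contracting homotopy without an exception in the
lowest degree. The acyclic carriers below are cones of this kind, or reduce to them. -/
lemma bd_cons (a : T) (z : ListChain T) : bd (cons a z) = z - cons a (bd z) := by
  have := hom_ext (f := bd ∘ₗ cons a) (g := LinearMap.id - cons a ∘ₗ bd)
    (fun l => by simp [bd_single, bdList]) z
  simpa using this

lemma bd_bd (z : ListChain T) : bd (bd z) = 0 := by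
  have := hom_ext (f := bd ∘ₗ bd) (g := 0) (fun l => by
    induction l with
    | nil => simp [bd_nil]
    | cons a l ih =>
      simp only [LinearMap.comp_apply, LinearMap.zero_apply] at ih ⊢
      rw [← cons_single, bd_cons, map_sub, bd_cons, ih]
      simp) z
  simpa using this

/-- The map induced by a map of entries. -/
def map (f : T → T') : ListChain T →ₗ[ℤ] ListChain T' := Finsupp.lmapDomain ℤ ℤ (List.map f)

@[simp] lemma map_single (f : T → T') (l : List T) (n : ℤ) :
    map f (Finsupp.single l n) = Finsupp.single (l.map f) n := by simp [map]

lemma map_cons (f : T → T') (a : T) (z : ListChain T) :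
    map f (cons a z) = cons (f a) (map f z) :=
  hom_ext (f := map f ∘ₗ cons a) (g := cons (f a) ∘ₗ map f) (fun l => by simp) z

lemma bd_map (f : T → T') (z : ListChain T) : bd (map f z) = map f (bd z) := by
  refine hom_ext (f := bd ∘ₗ map f) (g := map f ∘ₗ bd) (fun l => ?_) z
  induction l with
  | nil => simp [bd_nil]
  | cons a l ih =>
    simp only [LinearMap.comp_apply] at ih ⊢
    rw [← cons_single, map_cons, bd_cons, ih, bd_cons, map_sub, map_cons]

/-- The chains supported on a set of lists. -/
abbrev on (s : Set (List T)) : Submodule ℤ (ListChain T) := Finsupp.supported ℤ ℤ s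

lemma single_mem_on {s : Set (List T)} {l : List T} (h : l ∈ s) (n : ℤ) :
    Finsupp.single l n ∈ on s := Finsupp.single_mem_supported ℤ n h

/-- A linear map sends the chains on `s` to `E` once it does so for the lists in `s`. -/
lemma map_mem_of_on {M : Type*} [AddCommGroup M] {s : Set (List T)} (f : ListChain T →ₗ[ℤ] M)
    (E : Submodule ℤ M) (h : ∀ l ∈ s, f (Finsupp.single l 1) ∈ E) {z : ListChain T}
    (hz : z ∈ on s) : f z ∈ E := by
  have : on s ≤ E.comap f := by
    rw [on, Finsupp.supported_eq_span_single, Submodule.span_le]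
    rintro _ ⟨l, hl, rfl⟩
    exact h l hl
  exact this hz

/-- Two linear maps that agree on the lists in `s` agree on the chains on `s`. -/
lemma eq_of_on {M : Type*} [AddCommGroup M] {s : Set (List T)} {f g : ListChain T →ₗ[ℤ] M}
    (h : ∀ l ∈ s, f (Finsupp.single l 1) = g (Finsupp.single l 1)) {z : ListChain T}
    (hz : z ∈ on s) : f z = g z := by
  have := map_mem_of_on (f - g) ⊥ (fun l hl => by simp [h l hl]) hz
  simpa [sub_eq_zero] using this

/-- Both halves matter for carriers: sublists make monotone carriers compatible with the boundary,
and the drop in length drives the recursion. -/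
lemma bdList_mem (l : List T) : bdList l ∈ on {l' | l'.Sublist l ∧ l'.length < l.length} := by
  induction l with
  | nil => simp [bdList]
  | cons a l ih =>
    refine Submodule.sub_mem _ (single_mem_on (by simp) 1) ?_
    refine map_mem_of_on (cons a) _ (fun l' hl' => ?_) ih
    rw [cons_single]
    exact single_mem_on (by simpa using hl') 1

/-- A submodule of chains is acyclic if its cycles are boundaries in it. -/
def Acyclic (E : Submodule ℤ (ListChain T)) : Prop := ∀ z ∈ E, bd z = 0 → ∃ d ∈ E, bd d = z

/-- A submodule with a cone operator is acyclic. -/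
lemma acyclic_of_cons {E : Submodule ℤ (ListChain T)} (a : T) (h : ∀ z ∈ E, cons a z ∈ E) :
    Acyclic E := fun z hz h0 => ⟨cons a z, h z hz, by simp [bd_cons, h0]⟩

lemma acyclic_top [Nonempty T] : Acyclic (⊤ : Submodule ℤ (ListChain T)) :=
  acyclic_of_cons (Classical.arbitrary T) (fun _ _ => trivial)

/-! ### Acyclic carriers. -/

section carrier

variable (E : List T → Submodule ℤ (ListChain T')) (D : ListChain T →ₗ[ℤ] ListChain T') (c : ℤ)
  (e₀ : ListChain T')

open Classical in
/-- A recursively chosen solution of `bd (F l) = D l + c • F (bd l)` with values in the carrier. -/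
def carried (l : List T) : ListChain T' :=
  if l = [] then e₀ else
    let b : ListChain T' := D (Finsupp.single l 1) + c • (bdList l).sum
      -- The length test only ensures termination: by `bdList_mem` every list in the boundary passes
      -- it.
      (fun l' n => n • if _h : l'.length < l.length then carried l' else 0)
    if h : ∃ d ∈ E l, bd d = b then h.choose else 0
termination_by l.length
decreasing_by assumption

/-- The method of acyclic carriers. -/
theorem exists_carried
    (mono : ∀ l l' : List T, l'.Sublist l → E l' ≤ E l)
    (ac : ∀ l, l ≠ [] → Acyclic (E l))
    (hD : ∀ l, D (Finsupp.single l 1) ∈ E l)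
    (hbD : ∀ z, bd (D z) + c • D (bd z) = 0)
    (he : e₀ ∈ E []) (hbe : bd e₀ = D (Finsupp.single [] 1)) :
    ∃ F : ListChain T →ₗ[ℤ] ListChain T', F (Finsupp.single [] 1) = e₀ ∧
      (∀ l, F (Finsupp.single l 1) ∈ E l) ∧ ∀ z, bd (F z) = D z + c • F (bd z) := by
  classical
  let F : ListChain T →ₗ[ℤ] ListChain T' := Finsupp.linearCombination ℤ (carried E D c e₀)
  have hF : ∀ l, F (Finsupp.single l 1) = carried E D c e₀ l := fun l => by simp [F]
  have hnil : carried E D c e₀ [] = e₀ := by rw [carried]; simp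
  have hsum : ∀ l : List T, (bdList l).sum
      (fun l' n => n • if _h : l'.length < l.length then carried E D c e₀ l' else 0)
      = F (bdList l) := by
    intro l
    rw [Finsupp.linearCombination_apply]
    refine Finsupp.sum_congr fun l' hl' => ?_
    have := bdList_mem l hl'
    rw [dif_pos this.2]
  have key : ∀ n (l : List T), l.length = n → carried E D c e₀ l ∈ E l ∧
      bd (carried E D c e₀ l) = D (Finsupp.single l 1) + c • F (bdList l) := by
    intro n
    induction n using Nat.strong_induction_on with
    | _ n ih =>
      intro l hl
      by_cases h0 : l = []
      · subst h0
        rw [hnil]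
        exact ⟨he, by simpa [bdList] using hbe⟩
      have hE : F (bdList l) ∈ E l := by
        refine map_mem_of_on F _ (fun l' hl' => ?_) (bdList_mem l)
        rw [hF]
        exact mono l l' hl'.1 (ih _ (hl ▸ hl'.2) l' rfl).1
      have hbF : bd (F (bdList l)) = D (bdList l) := by
        have := eq_of_on (f := bd ∘ₗ F) (g := D + c • F ∘ₗ bd) (fun l' hl' => by
          have := (ih _ (hl ▸ hl'.2) l' rfl).2
          simp [hF, this, bd_single]) (bdList_mem l)
        simpa [← bd_single, bd_bd] using this
      -- The right-hand side is a cycle exactly because of `hbD`. With `D = 0`, `c = 1` the solution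
      -- is a chain map; with `D` a chain map and `c = -1` it is a homotopy from `0` to `D`.
      have hex : ∃ d ∈ E l, bd d = D (Finsupp.single l 1) + c • F (bdList l) := by
        refine ac l h0 _ (Submodule.add_mem _ (hD l) (Submodule.smul_mem _ _ hE)) ?_
        rw [map_add, map_smul, hbF, ← bd_single, hbD]
      rw [carried, if_neg h0]
      simp only [hsum]
      rw [dif_pos hex]
      exact hex.choose_spec
  refine ⟨F, by rw [hF, hnil], fun l => by rw [hF]; exact (key _ l rfl).1, fun z => ?_⟩
  have := hom_ext (f := bd ∘ₗ F) (g := D + c • F ∘ₗ bd) (fun l => by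
    simp [hF, (key _ l rfl).2, bd_single]) z
  simpa using this

end carrier

section prism

variable (f g : T → T')

/-- The prism on a list. -/
def prismList : List T → ListChain T'
  | [] => 0
  | a :: l => Finsupp.single (f a :: g a :: l.map g) 1 - cons (f a) (prismList l)

/-- The prism operator between the maps induced by `f` and `g`. -/
def prism : ListChain T →ₗ[ℤ] ListChain T' := Finsupp.linearCombination ℤ (prismList f g)

lemma prism_single (l : List T) : prism f g (Finsupp.single l 1) = prismList f g l := by
  simp [prism]

lemma prism_cons (a : T) (z : ListChain T) :
    prism f g (cons a z) = cons (f a) (cons (g a) (map g z)) - cons (f a) (prism f g z) :=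
  hom_ext (f := prism f g ∘ₗ cons a)
    (g := cons (f a) ∘ₗ cons (g a) ∘ₗ map g - cons (f a) ∘ₗ prism f g)
    (fun l => by simp [prism_single, prismList]) z

lemma bd_prism (z : ListChain T) :
    bd (prism f g z) + prism f g (bd z) = map g z - map f z := by
  refine hom_ext (f := bd ∘ₗ prism f g + prism f g ∘ₗ bd) (g := map g - map f) (fun l => ?_) z
  induction l with
  | nil => simp [prism_single, prismList, bd_nil]
  | cons a l ih =>
    simp only [LinearMap.add_apply, LinearMap.comp_apply, LinearMap.sub_apply] at ih ⊢
    rw [← cons_single]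
    simp only [prism_cons, bd_cons, map_sub, map_cons, bd_map, eq_sub_of_add_eq ih]
    abel

lemma prismList_mem (l : List T) :
    prismList f g l ∈ on {x | ∀ y ∈ x, ∃ a ∈ l, y = f a ∨ y = g a} := by
  induction l with
  | nil => simp [prismList]
  | cons a l ih =>
    refine Submodule.sub_mem _ (single_mem_on ?_ 1) ?_
    · intro y hy
      simp only [List.mem_cons, List.mem_map] at hy
      rcases hy with rfl | rfl | ⟨b, hb, rfl⟩
      · exact ⟨a, by simp, Or.inl rfl⟩
      · exact ⟨a, by simp, Or.inr rfl⟩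
      · exact ⟨b, by simp [hb], Or.inr rfl⟩
    · refine map_mem_of_on (cons (f a)) _ (fun l' hl' => ?_) ih
      rw [cons_single]
      refine single_mem_on ?_ 1
      intro y hy
      rcases List.mem_cons.1 hy with rfl | hy
      · exact ⟨a, by simp, Or.inl rfl⟩
      · obtain ⟨b, hb, h⟩ := hl' y hy
        exact ⟨b, by simp [hb], h⟩

/-- If all prisms on lists in `s` lie in `E`, then the two images of a cycle on `s` are homologous
in `E`. -/
lemma exists_bd_eq_map_sub_map {s : Set (List T)} {E : Set (List T')}
    (h : ∀ l ∈ s, ∀ x : List T', (∀ y ∈ x, ∃ a ∈ l, y = f a ∨ y = g a) → x ∈ E)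
    {z : ListChain T} (hz : z ∈ on s) (hbz : bd z = 0) :
    ∃ d ∈ on E, bd d = map g z - map f z := by
  refine ⟨prism f g z, map_mem_of_on _ _ (fun l hl => ?_) hz, ?_⟩
  · rw [prism_single]
    exact Finsupp.supported_mono (fun x hx => h l hl x hx) (prismList_mem f g l)
  · rw [← bd_prism, hbz, map_zero, add_zero]

end prism

end ListChain

/-! ### The geometric realization of the nerve of a poset -/

namespace NerveRealization

open Opposite SimplexCategory

variable {P : Type v} [PartialOrder P]

/-- The simplex of the nerve given by a monotone map. -/
def simplex {n : ℕ} (s : Fin (n + 1) →o P) : (nerve P).obj (op (SimplexCategory.mk n)) :=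
  s.monotone.functor

/-- The characteristic map of the simplex given by a monotone map. -/
def char {n : ℕ} (s : Fin (n + 1) →o P) :
    C(stdSimplex ℝ (Fin (n + 1)), SSet.toTop.obj (nerve P)) :=
  TopCat.toSSetObjEquiv _ (op (SimplexCategory.mk n))
    ((sSetTopAdj.unit.app (nerve P)).app (op (SimplexCategory.mk n)) (simplex s))

lemma toSSetObjEquiv_naturality (X : TopCat.{v}) {m n : SimplexCategory} (θ : m ⟶ n)
    (x : (TopCat.toSSet.obj X).obj (op n)) (b : stdSimplex ℝ (Fin (m.len + 1))) :
    TopCat.toSSetObjEquiv X (op m) ((TopCat.toSSet.obj X).map θ.op x) b =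
      TopCat.toSSetObjEquiv X (op n) x (stdSimplex.map θ b) := rfl

lemma char_comp {m n : ℕ} (s : Fin (n + 1) →o P) (θ : Fin (m + 1) →o Fin (n + 1))
    (b : stdSimplex ℝ (Fin (m + 1))) :
    char (s.comp θ) b = char s (stdSimplex.map θ b) := by
  have h := NatTrans.naturality_apply (sSetTopAdj.unit.app (nerve P)) (SimplexCategory.mkHom θ).op
    (simplex s)
  have h3 := toSSetObjEquiv_naturality (SSet.toTop.obj (nerve P)) (SimplexCategory.mkHom θ)
    ((sSetTopAdj.unit.app (nerve P)).app (op (SimplexCategory.mk n)) (simplex s)) b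
  refine Eq.trans ?_ h3
  exact congrArg (fun y => TopCat.toSSetObjEquiv (SSet.toTop.obj (nerve P)) _ y b) h

/-- Compatible maps on all simplices are a simplicial map from the nerve to the singular set of `T`;
the realization is left adjoint to the singular set. -/
lemma exists_desc {T : Type v} [TopologicalSpace T]
    (Φ : ∀ n, (Fin (n + 1) →o P) → C(stdSimplex ℝ (Fin (n + 1)), T))
    (nat : ∀ m n (s : Fin (n + 1) →o P) (θ : Fin (m + 1) →o Fin (n + 1)) b,
      Φ m (s.comp θ) b = Φ n s (stdSimplex.map θ b)) :
    ∃ F : C(SSet.toTop.obj (nerve P), T), ∀ n (s : Fin (n + 1) →o P) b,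
      F (char s b) = Φ n s b := by
  let α : nerve P ⟶ TopCat.toSSet.obj (TopCat.of T) :=
    { app := fun n => TypeCat.ofHom fun x : ComposableArrows P n.unop.len => (TopCat.toSSetObjEquiv (TopCat.of T) n).symm
        (Φ n.unop.len ⟨x.obj, x.monotone⟩)
      naturality := fun m n θ => by
        ext x
        apply (TopCat.toSSetObjEquiv (TopCat.of T) n).injective
        ext b
        refine Eq.trans ?_ (toSSetObjEquiv_naturality _ θ.unop _ b).symm
        refine (congrArg (fun y : C(_, _) => y b) (Equiv.apply_symm_apply _ _)).trans ?_
        refine Eq.trans ?_ (congrArg (fun y : C(_, _) => y _) (Equiv.apply_symm_apply _ _)).symm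
        exact nat _ _ ⟨x.obj, x.monotone⟩ (SimplexCategory.Hom.toOrderHom θ.unop) b }
  let F := (sSetTopAdj.homEquiv _ _).symm α
  refine ⟨F.hom, fun n s b => ?_⟩
  have h : sSetTopAdj.homEquiv _ _ F = α := Equiv.apply_symm_apply _ _
  rw [Adjunction.homEquiv_unit] at h
  have h2 := congrArg (fun β : nerve P ⟶ TopCat.toSSet.obj (TopCat.of T) =>
    TopCat.toSSetObjEquiv (TopCat.of T) (op (SimplexCategory.mk n))
      (β.app (op (SimplexCategory.mk n)) (simplex s)) b) h
  refine Eq.trans ?_ (h2.trans ?_)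
  · rfl
  · exact congrArg (fun y : C(_, _) => y b) (Equiv.apply_symm_apply _ _)

lemma hom_unique {T : Type v} [TopologicalSpace T] {F G : C(SSet.toTop.obj (nerve P), T)}
    (h : ∀ n (s : Fin (n + 1) →o P) b, F (char s b) = G (char s b)) : F = G := by
  have : TopCat.ofHom F = (TopCat.ofHom G : SSet.toTop.obj (nerve P) ⟶ TopCat.of T) := by
    apply (sSetTopAdj.homEquiv _ _).injective
    rw [Adjunction.homEquiv_unit, Adjunction.homEquiv_unit]
    ext n x
    apply (TopCat.toSSetObjEquiv (TopCat.of T) n).injective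
    ext b
    exact h n.unop.len ⟨x.obj, x.monotone⟩ b
  exact congrArg TopCat.Hom.hom this

end NerveRealization

/-! ### Small lists in a bounded convex set. -/

namespace ListChain

variable {T T' : Type*}

/-- Joining finitely many prisms. -/
lemma exists_bd_eq_map_sub_map_of_steps (f : ℕ → T → T') (N : ℕ) {s : Set (List T)}
    {E : Set (List T')}
    (h : ∀ j < N, ∀ l ∈ s, ∀ x : List T', (∀ y ∈ x, ∃ a ∈ l, y = f j a ∨ y = f (j + 1) a) → x ∈ E)
    {z : ListChain T} (hz : z ∈ on s) (hbz : bd z = 0) :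
    ∃ d ∈ on E, bd d = map (f N) z - map (f 0) z := by
  induction N with
  | zero => exact ⟨0, zero_mem _, by simp⟩
  | succ N ih =>
    obtain ⟨d, hd, hbd⟩ := ih (fun j hj => h j (hj.trans (Nat.lt_succ_self N)))
    obtain ⟨d', hd', hbd'⟩ := exists_bd_eq_map_sub_map (f N) (f (N + 1))
      (h N (Nat.lt_succ_self N)) hz hbz
    exact ⟨d' + d, add_mem hd' hd, by rw [map_add, hbd, hbd']; abel⟩

lemma map_id (z : ListChain T) : map id z = z := by
  simp [map]

section convex

variable {V : Type*} [NormedAddCommGroup V] [NormedSpace ℝ V] {C : Set V}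

/-- The homothety of a convex set with centre `p` and ratio `1 - t`. -/
def homothety (hC : Convex ℝ C) (p : C) (t : unitInterval) (x : C) : C :=
  ⟨(1 - (t : ℝ)) • (x : V) + (t : ℝ) • (p : V),
    hC x.2 p.2 (by linarith [t.2.2]) t.2.1 (by ring)⟩

lemma dist_homothety_le (hC : Convex ℝ C) (p : C) (s t : unitInterval) (x y : C) :
    dist (homothety hC p s x) (homothety hC p t y) ≤
      dist x y + |(s : ℝ) - t| * dist y p := by
  simp only [homothety, Subtype.dist_eq, dist_eq_norm]
  have : (1 - (s : ℝ)) • (x : V) + (s : ℝ) • (p : V) - ((1 - (t : ℝ)) • (y : V) + (t : ℝ) • (p : V))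
      = (1 - (s : ℝ)) • ((x : V) - y) + ((t : ℝ) - s) • ((y : V) - p) := by module
  rw [this]
  refine (norm_add_le _ _).trans ?_
  rw [norm_smul, norm_smul, Real.norm_eq_abs, Real.norm_eq_abs, abs_sub_comm (t : ℝ)]
  have h1 : |1 - (s : ℝ)| ≤ 1 := by
    rw [abs_le]; constructor <;> linarith [s.2.1, s.2.2]
  gcongr
  exact mul_le_of_le_one_left (norm_nonneg _) h1

/-- The point `j / N` of the unit interval. -/
def step (N : ℕ) (j : ℕ) : unitInterval :=
  Set.projIcc 0 1 zero_le_one ((j : ℝ) / N)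

lemma step_zero (N : ℕ) : step N 0 = 0 := by
  simp only [step, Nat.cast_zero, zero_div]
  exact Set.projIcc_left (zero_le_one' ℝ)

lemma step_self {N : ℕ} (hN : N ≠ 0) : step N N = 1 := by
  have : (N : ℝ) ≠ 0 := by exact_mod_cast hN
  simp only [step, div_self this]
  exact Set.projIcc_right (zero_le_one' ℝ)

lemma abs_step_sub_le (N j k : ℕ) : |(step N j : ℝ) - step N k| ≤ |(j : ℝ) / N - (k : ℝ) / N| := by
  have := (LipschitzWith.projIcc (zero_le_one' ℝ)).dist_le_mul ((j : ℝ) / N) ((k : ℝ) / N)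
  simpa [step, Subtype.dist_eq, Real.dist_eq] using this

lemma abs_step_sub_le_inv {N j k : ℕ} (h : k = j ∨ k = j + 1 ∨ j = k + 1) :
    |(step N j : ℝ) - step N k| ≤ 1 / N := by
  refine (abs_step_sub_le N j k).trans ?_
  rcases h with rfl | rfl | rfl
  · simp
  · push_cast
    rw [← sub_div, abs_div]
    simp
  · push_cast
    rw [← sub_div, abs_div]
    simp

/-- The chains on the lists of diameter less than `ε` in a bounded convex set are acyclic. -/
theorem acyclic_of_convex (hC : Convex ℝ C) (p : C) {D : ℝ} (hD : ∀ x : C, dist x p ≤ D) {ε : ℝ}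
    (hε : 0 < ε) : Acyclic (on {l : List C | ∀ x ∈ l, ∀ y ∈ l, dist x y < ε}) := by
  classical
  intro z hz hbz
  -- A chain involves finitely many lists, so their diameters stay below some `δ < ε`; the gap `ε -
  -- δ` leaves room for one step of the homothety.
  obtain ⟨δ, hδ, hzδ⟩ : ∃ δ < ε, ∀ l ∈ z.support, ∀ x ∈ l, ∀ y ∈ l, dist x y ≤ δ := by
    have : ∀ᶠ δ in nhdsWithin ε (Set.Iio ε), ∀ l ∈ z.support, ∀ x ∈ l.toFinset, ∀ y ∈ l.toFinset,
        dist x y ≤ δ := by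
      rw [Filter.eventually_all_finset]
      intro l hl
      rw [Filter.eventually_all_finset]
      intro x hx
      rw [Filter.eventually_all_finset]
      intro y hy
      have := hz hl x (by simpa using hx) y (by simpa using hy)
      exact mem_nhdsWithin_of_mem_nhds (Ici_mem_nhds this)
    obtain ⟨δ, h1, h2⟩ := (this.and self_mem_nhdsWithin).exists
    exact ⟨δ, h2, by simpa using h1⟩
  have hz' : z ∈ on {l : List C | ∀ x ∈ l, ∀ y ∈ l, dist x y ≤ δ} := fun l hl => hzδ l hl
  have hD0 : 0 ≤ D := dist_nonneg.trans (hD p)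
  -- One step of length `1 / N` towards `p` adds at most `D / N < ε - δ` to a distance, so the
  -- prisms consist of lists of diameter less than `ε`.
  obtain ⟨N, hN⟩ := exists_nat_gt (D / (ε - δ))
  have hN0 : (0 : ℝ) < N := lt_of_le_of_lt (div_nonneg hD0 (by linarith)) hN
  obtain ⟨d, hd, hbd⟩ := exists_bd_eq_map_sub_map_of_steps
    (fun j => homothety hC p (step N j)) N (E := {l : List C | ∀ x ∈ l, ∀ y ∈ l, dist x y < ε})
    (fun j _ l hl x hx a ha b hb => by
      have key : ∀ i k, (k = i ∨ k = i + 1 ∨ i = k + 1) → ∀ a' ∈ l, ∀ b' ∈ l,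
          dist (homothety hC p (step N i) a') (homothety hC p (step N k) b') < ε := by
        intro i k hik a' ha' b' hb'
        have h1 := dist_homothety_le hC p (step N i) (step N k) a' b'
        have h2 := abs_step_sub_le_inv (N := N) hik
        have h3 : |(step N i : ℝ) - step N k| * dist b' p ≤ 1 / N * D :=
          mul_le_mul h2 (hD b') dist_nonneg (by positivity)
        have h4 : 1 / (N : ℝ) * D < ε - δ := by
          rw [div_lt_iff₀ (by linarith)] at hN
          rw [one_div, inv_mul_lt_iff₀ hN0]
          linarith
        have h5 : dist a' b' ≤ δ := hl a' ha' b' hb'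
        linarith
      obtain ⟨a', ha', rfl | rfl⟩ := hx a ha <;> obtain ⟨b', hb', rfl | rfl⟩ := hx b hb
      · exact key _ _ (by simp) _ ha' _ hb'
      · exact key _ _ (by simp) _ ha' _ hb'
      · exact key _ _ (by simp) _ ha' _ hb'
      · exact key _ _ (by simp) _ ha' _ hb') hz' hbz
  have h0 : (homothety hC p (step N 0)) = id := by
    funext x; ext; simp [homothety, step_zero]
  have h1 : (homothety hC p (step N N)) = fun _ => p := by
    funext x; ext; simp [homothety, step_self (N := N) (by exact_mod_cast hN0.ne')]
  simp only [h0, h1, map_id] at hbd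
  -- The prisms join `z` to its image under the constant map at `p`, and that image bounds its cone,
  -- whose lists have diameter `0`.
  refine ⟨cons p (map (fun _ => p) z) - d, Submodule.sub_mem _ ?_ hd, ?_⟩
  · refine map_mem_of_on (cons p ∘ₗ map fun _ => p) _ (fun l _ => ?_) hz
    simp only [LinearMap.comp_apply, map_single, cons_single]
    refine single_mem_on ?_ 1
    have : ∀ x ∈ p :: l.map (fun _ => p), x = p := by simp
    intro x hx y hy
    rw [this x hx, this y hy, dist_self]
    exact hε
  · rw [map_sub, bd_cons, bd_map, hbz, hbd]
    simp

end convex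

end ListChain

/-! ### Barycentric coordinates and open stars. -/

namespace NerveRealization

variable {P : Type v} [PartialOrder P]

lemma map_apply' {X Y : Type*} [Fintype X] [Fintype Y] [DecidableEq Y] (f : X → Y)
    (b : stdSimplex ℝ X) (y : Y) : stdSimplex.map f b y = ∑ x with f x = y, b x := by
  rw [stdSimplex.map_coe, FunOnFinite.linearMap_apply_apply]

/-- The barycentric coordinate functions of the realization. -/
lemma exists_coord (w : P) : ∃ F : C(SSet.toTop.obj (nerve P), ℝ), ∀ n (s : Fin (n + 1) →o P) b,
    F (char s b) = open Classical in ∑ i with s i = w, b i := by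
  classical
  obtain ⟨F, hF⟩ := exists_desc (P := P) (T := ULift.{v} ℝ)
    (fun n s => ⟨fun b => ULift.up (∑ i with s i = w, b i), by
      refine continuous_uliftUp.comp (continuous_finsetSum _ fun i _ => ?_)
      exact (continuous_apply i).comp continuous_subtype_val⟩)
    (fun m n s θ b => by
      simp only [ContinuousMap.coe_mk, map_apply']
      congr 1
      rw [Finset.sum_comm' (t' := {i | s (θ i) = w}) (s' := fun i => {θ i})]
      · simp
      · intro x y
        simp only [Finset.mem_filter, Finset.mem_univ, true_and, Finset.mem_singleton]
        constructor
        · rintro ⟨h1, rfl⟩; exact ⟨rfl, h1⟩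
        · rintro ⟨rfl, h1⟩; exact ⟨h1, rfl⟩)
  refine ⟨⟨fun y => (F y).down, continuous_uliftDown.comp F.continuous⟩, fun n s b => ?_⟩
  simp [hF]

/-- The barycentric coordinate of a point of the realization at an element of the poset. -/
def coord (w : P) : C(SSet.toTop.obj (nerve P), ℝ) := (exists_coord w).choose

open Classical in
lemma coord_char (w : P) {n : ℕ} (s : Fin (n + 1) →o P) (b : stdSimplex ℝ (Fin (n + 1))) :
    coord w (char s b) = ∑ i with s i = w, b i := by
  rw [coord, (exists_coord w).choose_spec]

lemma exists_eq_char (y : SSet.toTop.obj (nerve P)) :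
    ∃ n, ∃ (s : Fin (n + 1) →o P) (b : _), y = char s b := by
  -- In the indiscrete topology every predicate is continuous. The predicate of lying in some
  -- simplex agrees with `True` on all simplices, so uniqueness of maps out of the realization makes
  -- it true everywhere.
  let T : TopologicalSpace (ULift.{v} Prop) := ⊤
  let F : C(SSet.toTop.obj (nerve P), ULift.{v} Prop) :=
    ⟨fun y => ULift.up (∃ n, ∃ (s : Fin (n + 1) →o P) (b : _), y = char s b), continuous_top⟩
  let G : C(SSet.toTop.obj (nerve P), ULift.{v} Prop) := ⟨fun _ => ULift.up True, continuous_top⟩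
  have h : F = G := hom_unique fun n s b => by
    refine ULift.ext _ _ (propext ⟨fun _ => trivial, fun _ => ⟨n, s, b, rfl⟩⟩)
  have h2 := congrArg (fun K : C(SSet.toTop.obj (nerve P), ULift.{v} Prop) => (K y).down) h
  exact of_eq_true h2

lemma exists_eq_of_coord_char_pos {w : P} {n : ℕ} {s : Fin (n + 1) →o P}
    {b : stdSimplex ℝ (Fin (n + 1))} (h : 0 < coord w (char s b)) : ∃ i, s i = w := by
  classical
  by_contra hne
  push Not at hne
  rw [coord_char, Finset.filter_false_of_mem (by simpa using hne)] at h
  simp at h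

lemma exists_coord_pos (y : SSet.toTop.obj (nerve P)) : ∃ w, 0 < coord w y := by
  classical
  obtain ⟨n, s, b, rfl⟩ := exists_eq_char y
  obtain ⟨i, hi⟩ : ∃ i, 0 < b i := by
    by_contra hne
    push Not at hne
    have h1 := b.2.2
    have h2 : ∑ i, b.1 i ≤ 0 := Finset.sum_nonpos fun i _ => hne i
    linarith
  refine ⟨s i, ?_⟩
  rw [coord_char]
  exact Finset.sum_pos' (fun j _ => b.2.1 j) ⟨i, by simp, hi⟩

/-- For distinct vertices, the coordinate at `s i` returns the `i`-th barycentric coordinate. -/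
lemma char_injective {n : ℕ} {s : Fin (n + 1) →o P} (hs : StrictMono s) :
    Function.Injective (char s) := by
  classical
  intro b b' h
  ext i
  have h1 := congrArg (coord (s i)) h
  rw [coord_char, coord_char] at h1
  simpa [hs.injective.eq_iff, Finset.filter_eq'] using h1

/-- The elements with positive coordinate at all points of a nonempty list. -/
def common (τ : List (SSet.toTop.obj (nerve P))) : Set P := {w | ∀ y ∈ τ, 0 < coord w y}

/-- Common elements are vertices of any simplex through a chosen point of the list; so they form a
finite chain, and have a least element if there are any. -/
lemma common_finite {τ : List (SSet.toTop.obj (nerve P))} (h : τ ≠ []) : (common τ).Finite := by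
  obtain ⟨y, hy⟩ := List.exists_mem_of_ne_nil τ h
  obtain ⟨n, s, b, rfl⟩ := exists_eq_char y
  exact (Set.finite_range s).subset fun w hw => exists_eq_of_coord_char_pos (hw _ hy)

lemma common_total {τ : List (SSet.toTop.obj (nerve P))} (h : τ ≠ []) {v w : P}
    (hv : v ∈ common τ) (hw : w ∈ common τ) : v ≤ w ∨ w ≤ v := by
  obtain ⟨y, hy⟩ := List.exists_mem_of_ne_nil τ h
  obtain ⟨n, s, b, rfl⟩ := exists_eq_char y
  obtain ⟨i, rfl⟩ := exists_eq_of_coord_char_pos (hv _ hy)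
  obtain ⟨j, rfl⟩ := exists_eq_of_coord_char_pos (hw _ hy)
  exact (le_total i j).imp (fun h => s.monotone h) (fun h => s.monotone h)

/-- A nonempty list of points with a common element has a least common element. -/
lemma exists_least_common {τ : List (SSet.toTop.obj (nerve P))} (h : τ ≠ [])
    (hne : (common τ).Nonempty) : ∃ w ∈ common τ, ∀ v ∈ common τ, w ≤ v := by
  obtain ⟨w, hw⟩ := (common_finite h).exists_minimal hne
  refine ⟨w, hw.1, fun v hv => ?_⟩
  rcases common_total h hw.1 hv with h | h
  · exact h
  · exact hw.2 hv h

end NerveRealization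

/-! ### Small lists of points in a simplex. -/

namespace NerveRealization

open ListChain

variable {P : Type v} [PartialOrder P]

/-- The lists of points of one closed simplex with vertices in `A` and of diameter less than `ε`. -/
def smallLists (ε : ℝ) (A : Set P) : Set (List (SSet.toTop.obj (nerve P))) :=
  {τ | ∃ n, ∃ s : Fin (n + 1) →o P, StrictMono s ∧ Set.range s ⊆ A ∧
    ∃ β : List (stdSimplex ℝ (Fin (n + 1))), (∀ x ∈ β, ∀ y ∈ β, dist x y < ε) ∧
      τ = β.map (char s)}

lemma smallLists_mono {ε ε' : ℝ} (h : ε ≤ ε') {A A' : Set P} (hA : A ⊆ A') :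
    smallLists ε A ⊆ smallLists ε' A' := by
  rintro τ ⟨n, s, hs, hr, β, hβ, rfl⟩
  exact ⟨n, s, hs, hr.trans hA, β, fun x hx y hy => (hβ x hx y hy).trans_le h, rfl⟩

/-- In the sup metric a face inclusion only inserts zero coordinates. Hence smallness measured in a
face implies smallness in the whole simplex. -/
lemma dist_map_le {m n : ℕ} {θ : Fin (m + 1) → Fin (n + 1)} (hθ : Function.Injective θ)
    (b b' : stdSimplex ℝ (Fin (m + 1))) :
    dist (stdSimplex.map θ b) (stdSimplex.map θ b') ≤ dist b b' := by
  rw [Subtype.dist_eq, dist_pi_le_iff dist_nonneg]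
  intro j
  change dist (stdSimplex.map θ b j) (stdSimplex.map θ b' j) ≤ _
  rw [map_apply', map_apply']
  by_cases h : ∃ i, θ i = j
  · obtain ⟨i, rfl⟩ := h
    simp only [hθ.eq_iff, Finset.filter_eq', Finset.mem_univ, if_true, Finset.sum_singleton]
    exact dist_le_pi_dist b.1 b'.1 i
  · push Not at h
    simp [h]

lemma smallLists_range (ε : ℝ) {n : ℕ} {s : Fin (n + 1) →o P} (hs : StrictMono s) :
    smallLists ε (Set.range s) = List.map (char s) ''
      {β : List (stdSimplex ℝ (Fin (n + 1))) | ∀ x ∈ β, ∀ y ∈ β, dist x y < ε} := by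
  ext τ
  constructor
  · rintro ⟨m, s', hs', hr, β, hβ, rfl⟩
    choose θ hθ using fun i => hr (Set.mem_range_self i)
    have hmono : Monotone θ := fun i j hij => by
      rw [← hs.le_iff_le, hθ, hθ]
      exact s'.monotone hij
    have hinj : Function.Injective θ := fun i j hij => hs'.injective (by rw [← hθ, ← hθ, hij])
    obtain rfl : s' = s.comp ⟨θ, hmono⟩ := OrderHom.ext _ _ (funext fun i => (hθ i).symm)
    refine ⟨β.map (stdSimplex.map θ), ?_, ?_⟩
    · simp only [List.mem_map, Set.mem_ofPred_eq]
      rintro _ ⟨x, hx, rfl⟩ _ ⟨y, hy, rfl⟩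
      exact (dist_map_le hinj x y).trans_lt (hβ x hx y hy)
    · rw [List.map_map]
      exact List.map_congr_left fun b _ => (char_comp s ⟨θ, hmono⟩ b).symm
  · rintro ⟨β, hβ, rfl⟩
    exact ⟨n, s, hs, subset_rfl, β, hβ, rfl⟩

/-- The entries of a nonempty decreasing list are the vertices of a simplex. -/
lemma exists_strictMono_range {l : List P} (hl : l.Pairwise (· ≥ ·)) (h0 : l ≠ []) :
    ∃ n, ∃ s : Fin (n + 1) →o P, StrictMono s ∧ Set.range s = {x | x ∈ l} := by
  classical
  have h1 : l.dedup.reverse.Pairwise (· < ·) := by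
    rw [List.pairwise_reverse]
    have h2 := hl.sublist (List.dedup_sublist l)
    refine (h2.and (List.nodup_dedup l)).imp ?_
    rintro a b ⟨h3, h4⟩
    exact lt_of_le_of_ne h3 (Ne.symm h4)
  obtain ⟨n, hn⟩ : ∃ n, l.dedup.reverse.length = n + 1 :=
    Nat.exists_eq_succ_of_ne_zero (by simpa using h0)
  have hs : StrictMono (fun i : Fin (n + 1) => l.dedup.reverse.get (i.cast hn.symm)) := by
    intro i j hij
    exact List.pairwise_iff_get.1 h1 _ _ hij
  refine ⟨n, ⟨_, hs.monotone⟩, hs, ?_⟩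
  ext x
  simp only [OrderHom.coe_mk, Set.mem_range, Set.mem_ofPred_eq]
  rw [← List.mem_dedup, ← List.mem_reverse, List.mem_iff_get]
  constructor
  · rintro ⟨i, hi⟩; exact ⟨_, hi⟩
  · rintro ⟨i, hi⟩; exact ⟨i.cast hn, hi⟩

lemma acyclic_smallLists {ε : ℝ} (hε : 0 < ε) {l : List P} (hl : l.Pairwise (· ≥ ·)) (h0 : l ≠ []) :
    Acyclic (on (smallLists ε {x | x ∈ l})) := by
  obtain ⟨n, s, hs, hr⟩ := exists_strictMono_range hl h0
  rw [← hr, smallLists_range ε hs]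
  intro z hz hbz
  rw [on, ← Finsupp.lmapDomain_supported] at hz ⊢
  obtain ⟨z, hz, rfl⟩ := hz
  change bd (map (char s) z) = 0 at hbz
  rw [bd_map] at hbz
  have hinj : Function.Injective (map (char s)) :=
    Finsupp.mapDomain_injective (List.map_injective_iff.2 (char_injective hs))
  obtain ⟨D, hD⟩ := Metric.isBounded_iff.1 (isCompact_stdSimplex ℝ (Fin (n + 1))).isBounded
  obtain ⟨d, hd, hbd⟩ := acyclic_of_convex (convex_stdSimplex ℝ (Fin (n + 1)))
    (Classical.arbitrary _) (fun x => hD x.2 (Subtype.property _)) hε z hz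
    (hinj (by rw [hbz, map_zero]))
  refine ⟨map (char s) d, ⟨d, hd, rfl⟩, ?_⟩
  rw [bd_map, hbd]
  rfl

/-- Small lists stay in an open star under small time steps of a homotopy. -/
lemma eventually_common (H : C(unitInterval × SSet.toTop.obj (nerve P), SSet.toTop.obj (nerve P)))
    {n : ℕ} {s : Fin (n + 1) →o P} (hs : StrictMono s) :
    ∀ᶠ ε in nhdsWithin (0 : ℝ) (Set.Ioi 0), ∀ τ ∈ smallLists ε (Set.range s), ∀ t,
      ∃ w, ∀ y ∈ τ, ∀ t', dist t' t < ε → 0 < coord w (H (t', y)) := by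
  -- The open stars cover the realization. Their preimages under the homotopy cover the compact
  -- product of a simplex and the interval, and a Lebesgue number bounds both the lists and the time
  -- steps.
  obtain ⟨δ, hδ, h⟩ := lebesgue_number_lemma_of_metric
    (s := (Set.univ : Set (stdSimplex ℝ (Fin (n + 1)) × unitInterval)))
    (c := fun w : P => {x | 0 < coord w (H (x.2, char s x.1))}) isCompact_univ
    (fun w => isOpen_lt continuous_const (by fun_prop))
    (fun x _ => by
      obtain ⟨w, hw⟩ := exists_coord_pos (H (x.2, char s x.1))
      exact Set.mem_iUnion.2 ⟨w, hw⟩)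
  filter_upwards [Ioo_mem_nhdsGT hδ] with ε hε τ hτ t
  rw [smallLists_range ε hs] at hτ
  obtain ⟨β, hβ, rfl⟩ := hτ
  rcases β with _ | ⟨b, β⟩
  · exact ⟨s 0, by simp⟩
  · obtain ⟨w, hw⟩ := h (b, t) trivial
    refine ⟨w, fun y hy t' ht' => ?_⟩
    obtain ⟨b', hb', rfl⟩ := List.mem_map.1 hy
    refine hw (a := (b', t')) ?_
    rw [Metric.mem_ball, Prod.dist_eq, max_lt_iff]
    exact ⟨(hβ _ hb' _ (by simp)).trans hε.2, ht'.trans hε.2⟩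

/-! ### Comparison of lists in the poset with lists of points. -/

section contractible

variable (ε : ℝ) (K : Set P)

open Classical in
/-- The carrier of the comparison from lists in the poset to lists of points. -/
def pointCarrier (l : List P) : Submodule ℤ (ListChain (SSet.toTop.obj (nerve P))) :=
  if l = [] then on {[]} else
    if l.Pairwise (· ≥ ·) ∧ ∀ x ∈ l, x ∈ K then on (smallLists ε {x | x ∈ l}) else ⊤

open Classical in
/-- The carrier of the comparison from lists of points to lists in the poset. -/
def posetCarrier (τ : List (SSet.toTop.obj (nerve P))) : Submodule ℤ (ListChain P) :=
  if τ = [] then on {[]} else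
    if (common τ).Nonempty then on {l | l.Pairwise (· ≥ ·) ∧ ∀ x ∈ l, ∀ w ∈ common τ, x ≤ w} else ⊤

open Classical in
/-- The carrier of the homotopy on lists in the poset. -/
def homotopyCarrier (l : List P) : Submodule ℤ (ListChain P) :=
  if l = [] then ⊥ else
    if l.Pairwise (· ≥ ·) ∧ ∀ x ∈ l, x ∈ K then
      on {l' | l'.Pairwise (· ≥ ·) ∧ ∀ x ∈ l', ∃ w ∈ l, x ≤ w} else ⊤

lemma nil_mem_smallLists {l : List P} (hl : l.Pairwise (· ≥ ·)) (h0 : l ≠ []) :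
    [] ∈ smallLists ε {x | x ∈ l} := by
  obtain ⟨n, s, hs, hr⟩ := exists_strictMono_range hl h0
  exact ⟨n, s, hs, hr.le, [], by simp, rfl⟩

/-- The chain map `ψ` from the poset to the realization. A decreasing list is carried by the small
lists of the simplex it spans, acyclic by convexity. Other lists get the whole complex as carrier,
and the empty list, whose carrier is not acyclic, is sent to itself. -/
lemma exists_toPoints [Nonempty (SSet.toTop.obj (nerve P))] (hε : 0 < ε) :
    ∃ F : ListChain P →ₗ[ℤ] ListChain (SSet.toTop.obj (nerve P)),
      F (Finsupp.single [] 1) = Finsupp.single [] 1 ∧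
      (∀ l, F (Finsupp.single l 1) ∈ pointCarrier ε K l) ∧ ∀ z, bd (F z) = F (bd z) := by
  obtain ⟨F, h1, h2, h3⟩ := exists_carried (pointCarrier ε K) 0 1 (Finsupp.single [] 1)
    (fun l l' h => by
      unfold pointCarrier
      by_cases h0' : l' = []
      · subst h0'
        rw [if_pos rfl]
        split_ifs with h0 hl
        · exact le_rfl
        · exact Finsupp.supported_mono (by simpa using nil_mem_smallLists ε hl.1 h0)
        · exact le_top
      · have h0 : l ≠ [] := by rintro rfl; exact h0' (List.sublist_nil.1 h)
        rw [if_neg h0', if_neg h0]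
        by_cases hl : l.Pairwise (· ≥ ·) ∧ ∀ x ∈ l, x ∈ K
        · rw [if_pos hl, if_pos ⟨hl.1.sublist h, fun x hx => hl.2 x (h.subset hx)⟩]
          exact Finsupp.supported_mono (smallLists_mono le_rfl h.subset)
        · rw [if_neg hl]
          exact le_top)
    (fun l h0 => by
      rw [pointCarrier, if_neg h0]
      split_ifs with hl
      · exact acyclic_smallLists hε hl.1 h0
      · exact acyclic_top)
    (fun l => zero_mem _) (fun z => by simp)
    (by rw [pointCarrier, if_pos rfl]; exact single_mem_on (Set.mem_singleton _) 1) (by simp [bd_nil])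
  exact ⟨F, h1, h2, fun z => by simp [h3]⟩

/-- The chain map `φ` back to the poset. Points with common vertices are carried by the decreasing
lists below all of these, a cone with the least common vertex as apex. Shorter lists have more
common vertices, hence smaller carriers. -/
lemma exists_toPoset [Nonempty P] :
    ∃ F : ListChain (SSet.toTop.obj (nerve P)) →ₗ[ℤ] ListChain P,
      F (Finsupp.single [] 1) = Finsupp.single [] 1 ∧
      (∀ l, F (Finsupp.single l 1) ∈ posetCarrier l) ∧ ∀ z, bd (F z) = F (bd z) := by
  obtain ⟨F, h1, h2, h3⟩ := exists_carried (posetCarrier (P := P)) 0 1 (Finsupp.single [] 1)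
    (fun l l' h => by
      unfold posetCarrier
      by_cases h0' : l' = []
      · subst h0'
        rw [if_pos rfl]
        split_ifs with h0 hl
        · exact le_rfl
        · exact Finsupp.supported_mono (by simp)
        · exact le_top
      · have h0 : l ≠ [] := by rintro rfl; exact h0' (List.sublist_nil.1 h)
        rw [if_neg h0', if_neg h0]
        have hsub : common l ⊆ common l' := fun w hw y hy => hw y (h.subset hy)
        by_cases hl : (common l).Nonempty
        · rw [if_pos hl, if_pos (hl.mono hsub)]
          refine Finsupp.supported_mono ?_
          intro x hx
          exact ⟨hx.1, fun y hy w hw => hx.2 y hy w (hsub hw)⟩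
        · rw [if_neg hl]
          exact le_top)
    (fun l h0 => by
      rw [posetCarrier, if_neg h0]
      split_ifs with hl
      · obtain ⟨w, hw, hmin⟩ := exists_least_common h0 hl
        refine acyclic_of_cons w fun z hz => map_mem_of_on (cons w) _ (fun l' hl' => ?_) hz
        rw [cons_single]
        refine single_mem_on ?_ 1
        refine ⟨List.pairwise_cons.2 ⟨fun x hx => hl'.2 x hx w hw, hl'.1⟩, ?_⟩
        intro x hx v hv
        rcases List.mem_cons.1 hx with rfl | hx
        · exact hmin v hv
        · exact hl'.2 x hx v hv
      · exact acyclic_top)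
    (fun l => zero_mem _) (fun z => by simp)
    (by rw [posetCarrier, if_pos rfl]; exact single_mem_on (Set.mem_singleton _) 1) (by simp [bd_nil])
  exact ⟨F, h1, h2, fun z => by simp [h3]⟩

/-- The head of a decreasing list is its largest entry and the apex of a cone on the carrier. This
will be applied to `D = φ ∘ ψ - id`. -/
lemma exists_homotopy [Nonempty P] (D : ListChain P →ₗ[ℤ] ListChain P)
    (hD0 : D (Finsupp.single [] 1) = 0)
    (hD : ∀ l, D (Finsupp.single l 1) ∈ homotopyCarrier K l) (hbD : ∀ z, bd (D z) = D (bd z)) :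
    ∃ F : ListChain P →ₗ[ℤ] ListChain P,
      (∀ l, F (Finsupp.single l 1) ∈ homotopyCarrier K l) ∧ ∀ z, bd (F z) = D z - F (bd z) := by
  obtain ⟨F, h1, h2, h3⟩ := exists_carried (homotopyCarrier K) D (-1) 0
    (fun l l' h => by
      unfold homotopyCarrier
      by_cases h0' : l' = []
      · rw [if_pos h0']
        exact bot_le
      · have h0 : l ≠ [] := by rintro rfl; exact h0' (List.sublist_nil.1 h)
        rw [if_neg h0', if_neg h0]
        by_cases hl : l.Pairwise (· ≥ ·) ∧ ∀ x ∈ l, x ∈ K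
        · rw [if_pos hl, if_pos ⟨hl.1.sublist h, fun x hx => hl.2 x (h.subset hx)⟩]
          refine Finsupp.supported_mono ?_
          intro x hx
          refine ⟨hx.1, fun y hy => ?_⟩
          obtain ⟨w, hw, hle⟩ := hx.2 y hy
          exact ⟨w, h.subset hw, hle⟩
        · rw [if_neg hl]
          exact le_top)
    (fun l h0 => by
      rw [homotopyCarrier, if_neg h0]
      split_ifs with hl
      · obtain ⟨w, l, rfl⟩ := List.exists_cons_of_ne_nil h0
        have hw : ∀ v ∈ w :: l, v ≤ w := by
          intro v hv
          rcases List.mem_cons.1 hv with rfl | hv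
          · exact le_rfl
          · exact (List.pairwise_cons.1 hl.1).1 v hv
        refine acyclic_of_cons w fun z hz => map_mem_of_on (cons w) _ (fun l' hl' => ?_) hz
        rw [cons_single]
        refine single_mem_on ?_ 1
        refine ⟨List.pairwise_cons.2 ⟨fun x hx => ?_, hl'.1⟩, ?_⟩
        · obtain ⟨v, hv, hle⟩ := hl'.2 x hx
          exact hle.trans (hw v hv)
        · intro x hx
          rcases List.mem_cons.1 hx with rfl | hx
          · exact ⟨x, by simp, le_rfl⟩
          · exact hl'.2 x hx
      · exact acyclic_top)
    hD (fun z => by simp [hbD]) (zero_mem _) (by simp [hD0])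
  exact ⟨F, h2, fun z => by rw [h3]; module⟩

end contractible

/-- If the geometric realization of a poset is contractible, then the complex of its decreasing
lists is acyclic. -/
theorem acyclic_of_contractible [ContractibleSpace (SSet.toTop.obj (nerve P))] :
    Acyclic (on {l : List P | l.Pairwise (· ≥ ·)}) := by
  classical
  intro z hz hbz
  obtain ⟨y₀, ⟨H⟩⟩ := id_nullhomotopic (SSet.toTop.obj (nerve P))
  have : Nonempty P := let ⟨w, _⟩ := exists_coord_pos y₀; ⟨w⟩
  -- The cycle meets only finitely many simplices, so a single `ε` serves for all of them.
  let K : Finset P := z.support.biUnion fun l => l.toFinset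
  have hzK : z ∈ on {l : List P | l.Pairwise (· ≥ ·) ∧ ∀ x ∈ l, x ∈ (K : Set P)} :=
    fun l hl => ⟨hz hl, fun x hx => Finset.mem_biUnion.2 ⟨l, hl, by simpa using hx⟩⟩
  obtain ⟨ε, hε, hstar⟩ : ∃ ε > 0, ∀ A ∈ K.powerset, ∀ n, ∀ s : Fin (n + 1) →o P, StrictMono s →
      Set.range s = A → ∀ τ ∈ smallLists ε (A : Set P), ∀ t,
      ∃ w, ∀ y ∈ τ, ∀ t', dist t' t < ε → 0 < coord w (H (t', y)) := by
    have : ∀ᶠ ε in nhdsWithin (0 : ℝ) (Set.Ioi 0), ∀ A ∈ K.powerset, ∀ n,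
        ∀ s : Fin (n + 1) →o P, StrictMono s →
        Set.range s = A → ∀ τ ∈ smallLists ε (A : Set P), ∀ t,
        ∃ w, ∀ y ∈ τ, ∀ t', dist t' t < ε → 0 < coord w (H (t', y)) := by
      rw [Filter.eventually_all_finset]
      intro A _
      by_cases hA : ∃ n, ∃ s : Fin (n + 1) →o P, StrictMono s ∧ Set.range s = A
      · obtain ⟨n, s, hs, hr⟩ := hA
        filter_upwards [eventually_common H.toContinuousMap hs] with ε hε n' s' _ _
        rw [← hr]
        exact hε
      · push Not at hA
        exact Filter.Eventually.of_forall fun ε n s hs hr => absurd hr (hA n s hs)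
    obtain ⟨ε, h1, h2⟩ := (this.and self_mem_nhdsWithin).exists
    exact ⟨ε, h2, h1⟩
  have hcom : ∀ l : List P, l.Pairwise (· ≥ ·) → l ≠ [] → (∀ x ∈ l, x ∈ (K : Set P)) →
      ∀ τ ∈ smallLists ε {x | x ∈ l}, ∀ t,
      ∃ w, ∀ y ∈ τ, ∀ t', dist t' t < ε → 0 < coord w (H (t', y)) := by
    intro l hl h0 hlK
    obtain ⟨n, s, hs, hr⟩ := exists_strictMono_range hl h0
    have h1 : ((l.toFinset : Finset P) : Set P) = {x | x ∈ l} := by ext; simp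
    have h2 := hstar l.toFinset (by
      rw [Finset.mem_powerset]; intro x hx; exact hlK x (by simpa using hx)) n s hs
      (by rw [hr, h1])
    rwa [h1] at h2
  obtain ⟨ψ, hψ0, hψ, hbψ⟩ := exists_toPoints ε (K : Set P) hε
  obtain ⟨φ, hφ0, hφ, hbφ⟩ := exists_toPoset (P := P)
  have hψz : ψ z ∈ on {τ | ∀ t, ∃ w, ∀ y ∈ τ, ∀ t', dist t' t < ε → 0 < coord w (H (t', y))} := by
    refine map_mem_of_on ψ _ (fun l hl => ?_) hzK
    by_cases h0 : l = []
    · subst h0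
      rw [hψ0]
      exact single_mem_on (by simp) 1
    · have := hψ l
      rw [pointCarrier, if_neg h0, if_pos (And.intro hl.1 hl.2)] at this
      exact Finsupp.supported_mono (hcom l hl.1 h0 hl.2) this
  have hbψz : bd (ψ z) = 0 := by rw [hbψ, hbz, map_zero]
  obtain ⟨N, hN⟩ := exists_nat_gt (1 / ε)
  have hN0 : (0 : ℝ) < N := lt_of_le_of_lt (by positivity) hN
  have hNε : 1 / (N : ℝ) < ε := by
    rw [div_lt_iff₀ hN0]; rwa [div_lt_iff₀ hε, mul_comm] at hN
  obtain ⟨d, hd, hbd⟩ := exists_bd_eq_map_sub_map_of_steps (fun j y => H (step N j, y)) N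
    (E := {τ | (common τ).Nonempty}) (fun j _ τ hτ x hx => by
      obtain ⟨w, hw⟩ := hτ (step N j)
      refine ⟨w, fun y hy => ?_⟩
      obtain ⟨a, ha, rfl | rfl⟩ := hx y hy
      · exact hw a ha _ (by simpa using hε)
      · refine hw a ha _ (lt_of_le_of_lt ?_ hNε)
        exact abs_step_sub_le_inv (by simp)) hψz hbψz
  have hf0 : (fun y => H (step N 0, y)) = id := by funext y; simp [step_zero]
  have hf1 : (fun y => H (step N N, y)) = fun _ => y₀ := by
    funext y; simp [step_self (N := N) (by exact_mod_cast hN0.ne')]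
  simp only [hf0, hf1, map_id] at hbd
  -- The homotopy carries `ψ z` to constant lists through lists contained in open stars, so `ψ z`
  -- bounds a chain of such lists; `φ` sends these to decreasing lists.
  let e := cons y₀ (map (fun _ => y₀) (ψ z)) - d
  have he : e ∈ on {τ | (common τ).Nonempty} := by
    refine Submodule.sub_mem _ ?_ hd
    refine map_mem_of_on (cons y₀ ∘ₗ map fun _ => y₀) _ (fun l _ => ?_) hψz
    simp only [LinearMap.comp_apply, map_single, cons_single]
    refine single_mem_on ?_ 1
    obtain ⟨w, hw⟩ := exists_coord_pos y₀
    exact ⟨w, by intro y hy; have : y = y₀ := by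
                   rcases List.mem_cons.1 hy with h | h
                   · exact h
                   · exact (List.mem_map.1 h).choose_spec.2.symm
                 rwa [this]⟩
  have hbe : bd e = ψ z := by
    simp only [e]
    rw [map_sub, bd_cons, bd_map, hbψz, hbd]
    simp
  have hφe : φ e ∈ on {l : List P | l.Pairwise (· ≥ ·)} := by
    refine map_mem_of_on φ _ (fun τ hτ => ?_) he
    have := hφ τ
    rw [posetCarrier] at this
    split_ifs at this with h0
    · exact Finsupp.supported_mono (by simp) this
    · exact Finsupp.supported_mono (fun l hl => And.left hl) this
    · exact absurd hτ (by assumption)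
  obtain ⟨h, hh, hbh⟩ := exists_homotopy (K : Set P) (φ ∘ₗ ψ - LinearMap.id)
    (by simp [hψ0, hφ0])
    (fun l => by
      unfold homotopyCarrier
      by_cases h0 : l = []
      · subst h0
        simp [hψ0, hφ0]
      rw [if_neg h0]
      split_ifs with hl
      · refine Submodule.sub_mem _ ?_ (single_mem_on ?_ 1)
        swap
        · exact ⟨hl.1, fun x hx => ⟨x, hx, le_rfl⟩⟩
        have h1 := hψ l
        rw [pointCarrier, if_neg h0, if_pos hl] at h1
        refine map_mem_of_on φ _ (fun τ hτ => ?_) h1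
        have h2 := hφ τ
        rw [posetCarrier] at h2
        split_ifs at h2 with h3 h4
        · exact Finsupp.supported_mono (by simp) h2
        · obtain ⟨w, hw⟩ := h4
          refine Finsupp.supported_mono ?_ h2
          intro l' hl'
          refine ⟨hl'.1, fun x hx => ⟨w, ?_, ?_⟩⟩
          · obtain ⟨n, s, -, hr, β, -, rfl⟩ := hτ
            obtain ⟨y, hy⟩ := List.exists_mem_of_ne_nil _ h3
            obtain ⟨b, hb, rfl⟩ := List.mem_map.1 hy
            obtain ⟨i, rfl⟩ := exists_eq_of_coord_char_pos (hw _ hy)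
            exact hr ⟨i, rfl⟩
          · exact hl'.2 x hx w hw
        · exfalso
          obtain ⟨w, hw⟩ := hcom l hl.1 h0 hl.2 τ hτ 0
          exact h4 ⟨w, fun y hy => by simpa using hw y hy 0 (by simpa using hε)⟩
      · trivial)
    (fun z => by simp [hbφ, hbψ])
  -- Here `bd (φ e) = φ (ψ z)`, and `bd (h z) = φ (ψ z) - z` because `z` is a cycle.
  refine ⟨φ e - h z, Submodule.sub_mem _ hφe ?_, ?_⟩
  · refine map_mem_of_on h _ (fun l hl => ?_) hzK
    have := hh l
    rw [homotopyCarrier] at this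
    split_ifs at this with h0
    · rw [(Submodule.mem_bot ℤ).1 this]
      exact zero_mem _
    swap
    · exact absurd (And.intro hl.1 hl.2) (by assumption)
    · exact Finsupp.supported_mono (fun l hl => And.left hl) this
  · rw [map_sub, hbφ, hbe, hbh, hbz, map_zero]
    simp

/-- If the geometric realization of a poset is contractible, then the complex of its decreasing
lists has a contraction. -/
theorem exists_contraction [ContractibleSpace (SSet.toTop.obj (nerve P))] :
    ∃ s : ListChain P →ₗ[ℤ] ListChain P,
      (∀ l : List P, l.Pairwise (· ≥ ·) →
        s (Finsupp.single l 1) ∈ on {l : List P | l.Pairwise (· ≥ ·)}) ∧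
      ∀ z, bd (s z) = z - s (bd z) := by
  classical
  have hne : Nonempty P := by
    obtain ⟨w, -⟩ := exists_coord_pos (Classical.arbitrary (SSet.toTop.obj (nerve P)))
    exact ⟨w⟩
  let E : List P → Submodule ℤ (ListChain P) := fun l =>
    if l.Pairwise (· ≥ ·) then on {l : List P | l.Pairwise (· ≥ ·)} else ⊤
  have hE : E [] = on {l : List P | l.Pairwise (· ≥ ·)} := by simp [E]
  obtain ⟨w⟩ := hne
  -- With `D = id` and `c = -1` the carried map is a homotopy from `0` to the identity; it starts
  -- with `[] ↦ [w]`, whose boundary is the empty list.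
  obtain ⟨F, h1, h2, h3⟩ := exists_carried E LinearMap.id (-1) (Finsupp.single [w] 1)
    (fun l l' h => by
      simp only [E]
      by_cases hl : l.Pairwise (· ≥ ·)
      · rw [if_pos hl, if_pos (hl.sublist h)]
      · rw [if_neg hl]
        exact le_top)
    (fun l _ => by
      simp only [E]
      split_ifs
      · exact acyclic_of_contractible
      · have : Nonempty P := ⟨w⟩
        exact acyclic_top)
    (fun l => by
      simp only [E]
      split_ifs with hl
      · exact single_mem_on hl 1
      · trivial)
    (fun z => by simp) (by rw [hE]; exact single_mem_on (by simp) 1)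
    (by simp [bd_single, bdList])
  refine ⟨F, fun l hl => ?_, fun z => by rw [h3, LinearMap.id_apply]; module⟩
  have := h2 l
  simpa only [E, if_pos hl] using this

end NerveRealization

/-! ### Vanishing of extension groups -/

namespace ExtVanishing

open Abelian Limits

universe w w' w₁ w₂

variable {A : Type w₁} [Category.{w₂} A] [Abelian A]

/-- The kernel sequence of an epimorphism. -/
abbrev kernelSequence {P X : A} (g : P ⟶ X) : ShortComplex A :=
  ShortComplex.mk (kernel.ι g) g (kernel.condition g)

lemma kernelSequence_shortExact {P X : A} (g : P ⟶ X) [Epi g] : (kernelSequence g).ShortExact where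
  exact := ShortComplex.exact_kernel g
  mono_f := inferInstanceAs (Mono (kernel.ι g))
  epi_g := inferInstanceAs (Epi g)

/-- The cokernel sequence of a monomorphism. -/
abbrev cokernelSequence {X Q : A} (f : X ⟶ Q) : ShortComplex A :=
  ShortComplex.mk f (cokernel.π f) (cokernel.condition f)

lemma cokernelSequence_shortExact {X Q : A} (f : X ⟶ Q) [Mono f] :
    (cokernelSequence f).ShortExact where
  exact := ShortComplex.exact_cokernel f
  mono_f := inferInstanceAs (Mono f)
  epi_g := inferInstanceAs (Epi (cokernel.π f))

variable [HasExt.{w} A]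

/-- The extension group of degree `n` vanishes. -/
def ExtZero (X M : A) (n : ℕ) : Prop := ∀ e : Ext X M n, e = 0

lemma extZero_zero {X M : A} : ExtZero X M 0 ↔ ∀ f : X ⟶ M, f = 0 := by
  constructor
  · intro h f
    exact (Ext.mk₀_eq_zero_iff f).1 (h _)
  · intro h e
    obtain ⟨f, rfl⟩ := Ext.homEquiv₀.symm.surjective e
    rw [Ext.homEquiv₀_symm_apply, h f, Ext.mk₀_zero]

lemma extZero_of_isZero {X M : A} (h : IsZero M) (n : ℕ) : ExtZero X M n := fun e => by
  rw [← e.comp_mk₀_id, h.eq_of_src (𝟙 M) 0, Ext.mk₀_zero, Ext.comp_zero]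

lemma ExtZero.of_retract {X M N : A} {n : ℕ} (i : M ⟶ N) (r : N ⟶ M) (h : i ≫ r = 𝟙 M)
    (hN : ExtZero X N n) : ExtZero X M n := fun e => by
  rw [← e.comp_mk₀_id, ← h, ← Ext.mk₀_comp_mk₀, ← Ext.comp_assoc_of_third_deg_zero,
    hN (e.comp (Ext.mk₀ i) (add_zero n)), Ext.zero_comp]

section covariant

variable {S : ShortComplex A} (hS : S.ShortExact) {X : A} {n : ℕ}
include hS

lemma ExtZero.middle (h₁ : ExtZero X S.X₁ n) (h₃ : ExtZero X S.X₃ n) : ExtZero X S.X₂ n := by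
  intro e
  obtain ⟨x, rfl⟩ := Ext.covariant_sequence_exact₂ X hS e (h₃ _)
  rw [h₁ x, Ext.zero_comp]

lemma ExtZero.left (h₃ : ExtZero X S.X₃ n) (h₂ : ExtZero X S.X₂ (n + 1)) :
    ExtZero X S.X₁ (n + 1) := by
  intro e
  obtain ⟨x, rfl⟩ := Ext.covariant_sequence_exact₁ X hS e (h₂ _) rfl
  rw [h₃ x, Ext.zero_comp]

lemma ExtZero.right (h₂ : ExtZero X S.X₂ n) (h₁ : ExtZero X S.X₁ (n + 1)) :
    ExtZero X S.X₃ n := by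
  intro e
  obtain ⟨x, rfl⟩ := Ext.covariant_sequence_exact₃ X hS e rfl (h₁ _)
  rw [h₂ x, Ext.zero_comp]

/-- If all maps to the quotient lift, the connecting map into `Ext¹` is zero. -/
lemma extZero_left_one (h : ∀ f : X ⟶ S.X₃, ∃ g : X ⟶ S.X₂, g ≫ S.g = f)
    (h₂ : ExtZero X S.X₂ 1) : ExtZero X S.X₁ 1 := by
  intro e
  obtain ⟨x, rfl⟩ := Ext.covariant_sequence_exact₁ X hS e (h₂ _) (zero_add 1)
  obtain ⟨f, rfl⟩ := Ext.homEquiv₀.symm.surjective x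
  obtain ⟨g, rfl⟩ := h f
  rw [Ext.homEquiv₀_symm_apply, ← Ext.mk₀_comp_mk₀, Ext.comp_assoc_of_second_deg_zero]
  have : (Ext.mk₀ S.g).comp hS.extClass (zero_add 1) = 0 := hS.comp_extClass
  rw [this, Ext.comp_zero]

end covariant

section contravariant

variable {S : ShortComplex A} (hS : S.ShortExact) [Projective S.X₂] {M : A} {n : ℕ}
include hS

lemma extZero_succ_of_projective (h : ExtZero S.X₁ M n) : ExtZero S.X₃ M (n + 1) := by
  intro e
  obtain ⟨x, rfl⟩ := Ext.contravariant_sequence_exact₃ hS M e (Ext.eq_zero_of_projective _)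
    (add_comm 1 n)
  rw [h x, Ext.comp_zero]

lemma ExtZero.syzygy (h : ExtZero S.X₃ M (n + 2)) : ExtZero S.X₁ M (n + 1) := by
  intro e
  obtain ⟨x, rfl⟩ := Ext.contravariant_sequence_exact₁ hS M e (add_comm 1 (n + 1)) (h _)
  rw [Ext.eq_zero_of_projective x, Ext.comp_zero]

/-- As the middle term is projective, `Ext¹` is the cokernel of restriction to the syzygy. This
turns questions on extensions into questions on morphisms. -/
lemma extZero_one_iff :
    ExtZero S.X₃ M 1 ↔ ∀ f : S.X₁ ⟶ M, ∃ g : S.X₂ ⟶ M, S.f ≫ g = f := by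
  constructor
  · intro h f
    obtain ⟨x, hx⟩ := Ext.contravariant_sequence_exact₁ hS M (Ext.mk₀ f) (add_zero 1) (h _)
    obtain ⟨g, rfl⟩ := Ext.homEquiv₀.symm.surjective x
    rw [Ext.homEquiv₀_symm_apply, Ext.mk₀_comp_mk₀] at hx
    exact ⟨g, (Ext.mk₀_bijective _ _).1 hx⟩
  · intro h e
    obtain ⟨x, rfl⟩ := Ext.contravariant_sequence_exact₃ hS M e (Ext.eq_zero_of_projective _)
      (add_zero 1)
    obtain ⟨f, rfl⟩ := Ext.homEquiv₀.symm.surjective x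
    obtain ⟨g, rfl⟩ := h f
    rw [Ext.homEquiv₀_symm_apply, ← Ext.mk₀_comp_mk₀]
    have : hS.extClass.comp (Ext.mk₀ S.f) (add_zero 1) = 0 := hS.extClass_comp
    rw [← Ext.comp_assoc_of_second_deg_zero, this, Ext.zero_comp]

end contravariant

/-- Vanishing of extensions can be checked on the factors of a product. -/
theorem extZero_of_factors [EnoughProjectives A] {ι : Type*} {M : A} {N : ι → A}
    (π : ∀ i, M ⟶ N i) (lift : ∀ {X : A} (f : ∀ i, X ⟶ N i), ∃ g : X ⟶ M, ∀ i, g ≫ π i = f i)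
    (uniq : ∀ {X : A} (g g' : X ⟶ M), (∀ i, g ≫ π i = g' ≫ π i) → g = g') (n : ℕ) :
    ∀ X : A, (∀ i, ExtZero X (N i) n) → ExtZero X M n := by
  induction n with
  | zero =>
    intro X h
    simp only [extZero_zero] at h ⊢
    exact fun f => uniq _ _ fun i => by rw [h i (f ≫ π i), zero_comp]
  | succ n ih =>
    intro X h
    -- Dimension shifting in the first variable ends at degrees `0` and `1`, where the universal
    -- property of the product is enough.
    have hS := kernelSequence_shortExact (Projective.π X)
    have : Projective (kernelSequence (Projective.π X)).X₂ :=
      inferInstanceAs (Projective (Projective.over X))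
    rcases n with _ | n
    · have h' := fun i => (extZero_one_iff hS (M := N i)).1 (h i)
      refine (extZero_one_iff hS).2 fun f => ?_
      choose g hg using fun i => h' i (f ≫ π i)
      obtain ⟨g', hg'⟩ := lift g
      exact ⟨g', uniq _ _ fun i => by rw [Category.assoc, hg', hg]⟩
    · exact extZero_succ_of_projective hS (ih _ fun i => ExtZero.syzygy hS (h i))

/-- A functor `F` with partial right adjoint value `G` at `N`, which preserves projectives and short
exact sequences, allows to compare extensions. -/
theorem extZero_of_adjoint {B : Type*} [Category* B] [Abelian B] [HasExt.{w'} B]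
    [EnoughProjectives A] (F : A ⥤ B) (hFp : ∀ P : A, Projective P → Projective (F.obj P))
    (hF : ∀ S : ShortComplex A, S.ShortExact →
      ∃ h : F.map S.f ≫ F.map S.g = 0, (ShortComplex.mk _ _ h).ShortExact)
    {N : B} {G : A} (e : ∀ X : A, (F.obj X ⟶ N) ≃ (X ⟶ G))
    (he : ∀ {X Y : A} (f : X ⟶ Y) (g : F.obj Y ⟶ N), e X (F.map f ≫ g) = f ≫ e Y g)
    (he0 : ∀ X, e X 0 = 0) (n : ℕ) :
    ∀ X : A, ExtZero (F.obj X) N n → ExtZero X G n := by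
  induction n with
  | zero =>
    intro X h
    rw [extZero_zero] at h ⊢
    intro f
    obtain ⟨g, rfl⟩ := (e X).surjective f
    rw [h g, he0]
  | succ n ih =>
    intro X h
    have hS := kernelSequence_shortExact (Projective.π X)
    have hP : Projective (kernelSequence (Projective.π X)).X₂ :=
      inferInstanceAs (Projective (Projective.over X))
    -- `F` turns a projective presentation of `X` into one of `F.obj X`, so both sides shift
    -- simultaneously.
    obtain ⟨h0, hFS⟩ := hF _ hS
    have hFP := hFp _ hP
    rcases n with _ | n
    · have h' := (extZero_one_iff hFS (M := N)).1 h
      refine (extZero_one_iff hS).2 fun f => ?_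
      obtain ⟨f, rfl⟩ := (e _).surjective f
      obtain ⟨g, hg⟩ := h' f
      exact ⟨e _ g, by rw [← he]; exact congrArg _ hg⟩
    · exact extZero_succ_of_projective hS (ih _ (ExtZero.syzygy hFS h))

end ExtVanishing

/-! ### Functors with values in modules -/

namespace ModuleFunctor

variable {J : Type*} [Category* J] {R : Type*} [Ring R]

lemma shortExact_iff {S : ShortComplex (J ⥤ ModuleCat R)} :
    S.ShortExact ↔ ∀ j, Function.Injective (S.f.app j) ∧ Function.Surjective (S.g.app j) ∧
      ∀ x, S.g.app j x = 0 → ∃ y, S.f.app j y = x := by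
  constructor
  · intro hS j
    have h := hS.map_of_exact ((evaluation J (ModuleCat R)).obj j)
    exact ⟨h.moduleCat_injective_f, h.moduleCat_surjective_g,
      fun x hx => (ShortComplex.moduleCat_exact_iff _).1 h.exact x hx⟩
  · intro h
    have h1 : ∀ j, (S.map ((evaluation J (ModuleCat R)).obj j)).Exact := fun j =>
      (ShortComplex.moduleCat_exact_iff _).2 (h j).2.2
    have : Mono S.f := (NatTrans.mono_iff_mono_app _).2 fun j =>
      (ModuleCat.mono_iff_injective _).2 (h j).1
    have : Epi S.g := (NatTrans.epi_iff_epi_app _).2 fun j =>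
      (ModuleCat.epi_iff_surjective _).2 (h j).2.1
    refine ⟨?_⟩
    rw [ShortComplex.exact_iff_isZero_homology]
    refine Functor.isZero _ fun j => ?_
    exact ((ShortComplex.exact_iff_isZero_homology _).1 (h1 j)).of_iso
      (S.mapHomologyIso ((evaluation J (ModuleCat R)).obj j)).symm

lemma mono_iff {M N : J ⥤ ModuleCat R} (f : M ⟶ N) :
    Mono f ↔ ∀ j, Function.Injective (f.app j) := by
  rw [NatTrans.mono_iff_mono_app]
  exact forall_congr' fun j => ModuleCat.mono_iff_injective _

lemma epi_iff {M N : J ⥤ ModuleCat R} (f : M ⟶ N) :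
    Epi f ↔ ∀ j, Function.Surjective (f.app j) := by
  rw [NatTrans.epi_iff_epi_app]
  exact forall_congr' fun j => ModuleCat.epi_iff_surjective _

end ModuleFunctor

/-! ### Contravariant functors to modules -/

namespace Contramodule

open Opposite Limits ExtVanishing

universe w

variable {R : Type u} [CommRing R] {C : Type v} [Category.{v} C]

lemma map_comp_apply (M : Cᵒᵖ ⥤ ModuleCat.{max u v} R) {X Y Z : C} (f : X ⟶ Y) (g : Y ⟶ Z)
    (m : M.obj (op Z)) : M.map (f ≫ g).op m = M.map f.op (M.map g.op m) := by
  simp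

lemma map_id_apply (M : Cᵒᵖ ⥤ ModuleCat.{max u v} R) {X : C} (m : M.obj (op X)) :
    M.map (𝟙 X).op m = m := by
  simp

lemma naturality_apply {M N : Cᵒᵖ ⥤ ModuleCat.{max u v} R} (f : M ⟶ N) {X Y : C} (g : X ⟶ Y)
    (m : M.obj (op Y)) : f.app (op X) (M.map g.op m) = N.map g.op (f.app (op Y) m) :=
  NatTrans.naturality_apply f g.op m

/-- The basis of the value of the free functor on `M`. -/
abbrev FreeIndex (M : Cᵒᵖ ⥤ ModuleCat.{max u v} R) (K : C) : Type max u v :=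
  Σ X : C, (K ⟶ X) × M.obj (op X)

/-- The free contravariant functor with one generator for each element of the values of `M`. -/
def freeCover (M : Cᵒᵖ ⥤ ModuleCat.{max u v} R) : Cᵒᵖ ⥤ ModuleCat.{max u v} R where
  obj K := ModuleCat.of R (FreeIndex M K.unop →₀ R)
  map {K L} f := ModuleCat.ofHom (Finsupp.lmapDomain R R
    fun x : FreeIndex M K.unop => (⟨x.1, f.unop ≫ x.2.1, x.2.2⟩ : FreeIndex M L.unop))
  map_id K := by
    ext x
    simp
  map_comp f g := by
    ext x
    simp

/-- The basis elements of the free functor. -/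
def freeGen (M : Cᵒᵖ ⥤ ModuleCat.{max u v} R) {K X : C} (f : K ⟶ X) (m : M.obj (op X)) :
    (freeCover M).obj (op K) := (Finsupp.single ⟨X, f, m⟩ 1 : FreeIndex M K →₀ R)

lemma map_freeGen (M : Cᵒᵖ ⥤ ModuleCat.{max u v} R) {L K X : C} (g : L ⟶ K) (f : K ⟶ X)
    (m : M.obj (op X)) : (freeCover M).map g.op (freeGen M f m) = freeGen M (g ≫ f) m :=
  Finsupp.mapDomain_single

lemma free_linear_ext {M : Cᵒᵖ ⥤ ModuleCat.{max u v} R} {K : C} {V : ModuleCat.{max u v} R}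
    {a b : (freeCover M).obj (op K) ⟶ V}
    (h : ∀ X (f : K ⟶ X) (m : M.obj (op X)), a (freeGen M f m) = b (freeGen M f m)) : a = b := by
  refine ModuleCat.hom_ext ?_
  refine Finsupp.lhom_ext' (M := R) (α := FreeIndex M K) fun x => LinearMap.ext_ring ?_
  obtain ⟨X, f, m⟩ := x
  exact h X f m

/-- Maps out of the free functor, at one object. -/
def freeLiftApp (M : Cᵒᵖ ⥤ ModuleCat.{max u v} R) {N : Cᵒᵖ ⥤ ModuleCat.{max u v} R}
    (n : ∀ X : C, M.obj (op X) → N.obj (op X)) (K : C) :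
    (freeCover M).obj (op K) ⟶ N.obj (op K) :=
  ModuleCat.ofHom (Finsupp.linearCombination R
    fun x : FreeIndex M K => N.map x.2.1.op (n x.1 x.2.2))

lemma freeLiftApp_gen (M : Cᵒᵖ ⥤ ModuleCat.{max u v} R) {N : Cᵒᵖ ⥤ ModuleCat.{max u v} R}
    (n : ∀ X : C, M.obj (op X) → N.obj (op X)) {K X : C} (f : K ⟶ X) (m : M.obj (op X)) :
    freeLiftApp M n K (freeGen M f m) = N.map f.op (n X m) :=
  (Finsupp.linearCombination_single _ _ _).trans (one_smul _ _)

/-- Maps out of the free functor. -/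
def freeLift (M : Cᵒᵖ ⥤ ModuleCat.{max u v} R) {N : Cᵒᵖ ⥤ ModuleCat.{max u v} R}
    (n : ∀ X : C, M.obj (op X) → N.obj (op X)) : freeCover M ⟶ N where
  app K := freeLiftApp M n K.unop
  naturality K L f := free_linear_ext fun X g m => by
    have h1 := freeLiftApp_gen M n (f.unop ≫ g) m
    rw [map_comp_apply, ← freeLiftApp_gen M n g m, ← map_freeGen] at h1
    exact h1

lemma freeLift_gen (M : Cᵒᵖ ⥤ ModuleCat.{max u v} R) {N : Cᵒᵖ ⥤ ModuleCat.{max u v} R}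
    (n : ∀ X : C, M.obj (op X) → N.obj (op X)) {K X : C} (f : K ⟶ X) (m : M.obj (op X)) :
    (freeLift M n).app (op K) (freeGen M f m) = N.map f.op (n X m) :=
  freeLiftApp_gen M n f m

lemma free_hom_ext {M N : Cᵒᵖ ⥤ ModuleCat.{max u v} R} {f g : freeCover M ⟶ N}
    (h : ∀ X (m : M.obj (op X)), f.app (op X) (freeGen M (𝟙 X) m) =
      g.app (op X) (freeGen M (𝟙 X) m)) : f = g := by
  refine NatTrans.ext (funext fun K => free_linear_ext fun X k m => ?_)
  have h1 : ∀ e : freeCover M ⟶ N, e.app (op K.unop) (freeGen M k m) =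
      N.map k.op (e.app (op X) (freeGen M (𝟙 X) m)) := fun e => by
    rw [← naturality_apply, map_freeGen, Category.comp_id]
  exact (h1 f).trans ((congrArg _ (h X m)).trans (h1 g).symm)

instance (M : Cᵒᵖ ⥤ ModuleCat.{max u v} R) : Projective (freeCover M) where
  factors {E X} f e he := by
    have h := fun X => (ModuleFunctor.epi_iff e).1 he (op X)
    choose n hn using fun X (m : M.obj (op X)) => h X (f.app (op X) (freeGen M (𝟙 X) m))
    refine ⟨freeLift M n, free_hom_ext fun X m => ?_⟩
    have h1 := freeLift_gen M n (𝟙 X) m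
    rw [map_id_apply] at h1
    exact (congrArg _ h1).trans (hn X m)

lemma freeCover_projective (M : Cᵒᵖ ⥤ ModuleCat.{max u v} R) (K : C) :
    Module.Projective R ((freeCover M).obj (op K)) :=
  inferInstanceAs (Module.Projective R (FreeIndex M K →₀ R))

/-- The canonical epimorphism from the free functor. -/
def freeπ (M : Cᵒᵖ ⥤ ModuleCat.{max u v} R) : freeCover M ⟶ M := freeLift M fun _ m => m

instance (M : Cᵒᵖ ⥤ ModuleCat.{max u v} R) : Epi (freeπ M) :=
  (ModuleFunctor.epi_iff (freeπ M)).2 fun K m =>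
    ⟨freeGen M (𝟙 K.unop) m, (freeLift_gen M _ (𝟙 K.unop) m).trans (map_id_apply M m)⟩

instance : EnoughProjectives (Cᵒᵖ ⥤ ModuleCat.{max u v} R) where
  presentation M := ⟨{ p := freeCover M, f := freeπ M }⟩

/-- The subfunctor given by submodules of the values. -/
def sub (M : Cᵒᵖ ⥤ ModuleCat.{max u v} R) (N : ∀ X : C, Submodule R (M.obj (op X)))
    (h : ∀ {X Y : C} (f : X ⟶ Y), ∀ m ∈ N Y, M.map f.op m ∈ N X) :
    Cᵒᵖ ⥤ ModuleCat.{max u v} R where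
  obj X := ModuleCat.of R (N X.unop)
  map {X Y} f := ModuleCat.ofHom ((M.map f).hom.restrict (p := N X.unop) (q := N Y.unop) (h f.unop))
  map_id X := by
    ext x
    exact map_id_apply M x.1
  map_comp f g := by
    ext x
    exact map_comp_apply M g.unop f.unop x.1

section sub

variable (M : Cᵒᵖ ⥤ ModuleCat.{max u v} R) (N : ∀ X : C, Submodule R (M.obj (op X)))
    (h : ∀ {X Y : C} (f : X ⟶ Y), ∀ m ∈ N Y, M.map f.op m ∈ N X)

/-- The inclusion of a subfunctor. -/
def subι : sub M N h ⟶ M where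
  app X := ModuleCat.ofHom (N X.unop).subtype
  naturality X Y f := by
    ext x
    rfl

instance : Mono (subι M N h) := (ModuleFunctor.mono_iff _).2 fun _ => Subtype.val_injective

/-- A transformation with values in a subfunctor. -/
def subLift {L : Cᵒᵖ ⥤ ModuleCat.{max u v} R} (f : L ⟶ M)
    (hf : ∀ X (x : L.obj (op X)), f.app (op X) x ∈ N X) : L ⟶ sub M N h where
  app X := ModuleCat.ofHom ((f.app X).hom.codRestrict (N X.unop) (hf X.unop))
  naturality X Y g := by
    ext x
    exact Subtype.ext (naturality_apply f g.unop x)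

end sub

lemma isZero_of_subsingleton {M : Cᵒᵖ ⥤ ModuleCat.{max u v} R}
    (h : ∀ X, Subsingleton (M.obj (op X))) : IsZero M :=
  Functor.isZero _ fun X => by
    have := h X.unop
    exact ModuleCat.isZero_of_subsingleton (M.obj X)

lemma subsingleton_X₃_of_surjective {S : ShortComplex (Cᵒᵖ ⥤ ModuleCat.{max u v} R)}
    (hS : S.ShortExact) {X : C} (h : Function.Surjective (S.f.app (op X))) :
    Subsingleton (S.X₃.obj (op X)) := by
  have : ∀ z : S.X₃.obj (op X), z = 0 := fun z => by
    obtain ⟨y, rfl⟩ := (ModuleFunctor.shortExact_iff.1 hS (op X)).2.1 z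
    obtain ⟨x, rfl⟩ := h y
    exact congrArg (fun a : S.X₁ ⟶ S.X₃ => a.app (op X) x) S.zero
  exact ⟨fun a b => by rw [this a, this b]⟩

lemma subsingleton_X₃_of_subsingleton {S : ShortComplex (Cᵒᵖ ⥤ ModuleCat.{max u v} R)}
    (hS : S.ShortExact) {X : C} (h : Subsingleton (S.X₂.obj (op X))) :
    Subsingleton (S.X₃.obj (op X)) :=
  (ModuleFunctor.shortExact_iff.1 hS (op X)).2.1.subsingleton

lemma subsingleton_X₁_of_subsingleton {S : ShortComplex (Cᵒᵖ ⥤ ModuleCat.{max u v} R)}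
    (hS : S.ShortExact) {X : C} (h : Subsingleton (S.X₂.obj (op X))) :
    Subsingleton (S.X₁.obj (op X)) :=
  (ModuleFunctor.shortExact_iff.1 hS (op X)).1.subsingleton

/-- A contravariant functor is concentrated at an object if it vanishes at all objects that are not
isomorphic to it. -/
def Concentrated (M : Cᵒᵖ ⥤ ModuleCat.{max u v} R) (X₀ : C) : Prop :=
  ∀ X, Nontrivial (M.obj (op X)) → Nonempty (X ≅ X₀)

/-- The elements of `V` if `p` holds, and `0` otherwise. -/
def restrictTo (R : Type*) [Semiring R] (p : Prop) (V : Type*) [AddCommMonoid V] [Module R V] :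
    Submodule R V where
  carrier := {m | p ∨ m = 0}
  zero_mem' := Or.inr rfl
  add_mem' := by
    rintro a b (h | rfl) (h' | rfl)
    · exact Or.inl h
    · exact Or.inl h
    · exact Or.inl h'
    · exact Or.inr (add_zero 0)
  smul_mem' := by
    rintro c a (h | rfl)
    · exact Or.inl h
    · exact Or.inr (smul_zero c)

lemma of_nontrivial_restrictTo {R : Type*} [Semiring R] {p : Prop} {V : Type*} [AddCommMonoid V]
    [Module R V] (h : Nontrivial (restrictTo R p V)) : p ∧ Nontrivial V := by
  obtain ⟨⟨x, hx⟩, h⟩ := exists_ne (0 : restrictTo R p V)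
  have hx0 : x ≠ 0 := fun h' => h (Subtype.ext h')
  exact ⟨hx.resolve_right hx0, ⟨x, 0, hx0⟩⟩

section filtration

variable (d : C → ℕ) (hd : ∀ {X Y : C}, (X ⟶ Y) → d X ≤ d Y)
  (hiso : ∀ {X Y : C} (f : X ⟶ Y), d X = d Y → IsIso f)
  [HasExt.{w} (Cᵒᵖ ⥤ ModuleCat.{max u v} R)] {T : Cᵒᵖ ⥤ ModuleCat.{max u v} R} {n : ℕ}

-- Inside one level a morphism that acts nontrivially is an isomorphism, so `M` splits according to
-- isomorphism classes. At each object at most one summand is nonzero; therefore the sum is also the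
-- product of its summands.
include hiso in
lemma extZero_of_level {k : ℕ} {M : Cᵒᵖ ⥤ ModuleCat.{max u v} R}
    (hk : ∀ X, Nontrivial (M.obj (op X)) → d X = k)
    (h : ∀ X, Nontrivial (M.obj (op X)) → ∀ M' : Cᵒᵖ ⥤ ModuleCat.{max u v} R,
      Concentrated M' X → ExtZero T M' n) : ExtZero T M n := by
  classical
  let cls : C → Quotient (isIsomorphicSetoid C) := fun X => Quotient.mk _ X
  have hcls : ∀ {X Y : C} (f : X ⟶ Y) (m : M.obj (op Y)), cls X = cls Y ∨ M.map f.op m = 0 := by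
    intro X Y f m
    by_cases hm : M.map f.op m = 0
    · exact Or.inr hm
    · have hY : Nontrivial (M.obj (op Y)) := ⟨m, 0, by rintro rfl; simp at hm⟩
      have hX : Nontrivial (M.obj (op X)) := ⟨_, 0, hm⟩
      have := hiso f ((hk X hX).trans (hk Y hY).symm)
      exact Or.inl (Quotient.sound ⟨asIso f⟩)
  have hst : ∀ c, ∀ {X Y : C} (f : X ⟶ Y), ∀ m ∈ restrictTo R (cls Y = c) (M.obj (op Y)),
      M.map f.op m ∈ restrictTo R (cls X = c) (M.obj (op X)) := by
    rintro c X Y f m (rfl | rfl)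
    · exact hcls f m
    · exact Or.inr (map_zero _)
  let N : Quotient (isIsomorphicSetoid C) → Cᵒᵖ ⥤ ModuleCat.{max u v} R := fun c =>
    sub M (fun X => restrictTo R (cls X = c) (M.obj (op X))) (hst c)
  let p : ∀ c, M ⟶ M := fun c =>
    { app := fun X => if cls X.unop = c then 𝟙 _ else 0
      naturality := fun X Y f => by
        ext m
        have := hcls f.unop m
        by_cases hY : cls Y.unop = c <;> by_cases hX : cls X.unop = c <;> simp [hX, hY]
        · exact this.resolve_left (by rw [hY]; exact fun h => hX h.symm)
        · exact (this.resolve_left (by rw [hX]; exact hY)).symm }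
  have hp : ∀ c X (m : M.obj (op X)), (p c).app (op X) m = if cls X = c then m else 0 := by
    intro c X m
    simp only [p]
    split_ifs <;> simp
  let π : ∀ c, M ⟶ N c := fun c => subLift M _ (hst c) (p c) fun X m => by
    rw [hp]
    split_ifs with hX
    · exact Or.inl hX
    · exact Or.inr rfl
  have hπ : ∀ c X (m : M.obj (op X)), ((π c).app (op X) m).1 = if cls X = c then m else 0 := hp
  refine extZero_of_factors π (fun {L} f => ?_) (fun {L} g g' hg => ?_) n T fun c => ?_
  · refine ⟨{ app := fun X => (f (cls X.unop) ≫ subι M _ (hst _)).app X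
              naturality := fun X Y a => ?_ }, fun c => ?_⟩
    · ext x
      have h1 := naturality_apply (f (cls X.unop) ≫ subι M _ (hst _)) a.unop x
      refine Eq.trans ?_ h1
      change (f (cls Y.unop) ≫ subι M _ (hst _)).app Y (L.map a x) =
        (f (cls X.unop) ≫ subι M _ (hst _)).app Y (L.map a x)
      by_cases hXY : cls Y.unop = cls X.unop
      · rw [hXY]
      · have h2 := hcls a.unop ((f (cls X.unop) ≫ subι M _ (hst _)).app X x)
        have h3 := naturality_apply (f (cls Y.unop) ≫ subι M _ (hst _)) a.unop x
        refine h3.trans (Eq.trans ?_ (h1.trans (h2.resolve_left hXY)).symm)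
        have h4 : (f (cls Y.unop) ≫ subι M _ (hst _)).app X x = 0 :=
          ((f (cls Y.unop)).app X x).2.resolve_left (Ne.symm hXY)
        exact (congrArg _ h4).trans (map_zero _)
    · ext X x
      refine Subtype.ext ((hπ c X.unop _).trans ?_)
      by_cases hX : cls X.unop = c
      · rw [if_pos hX]
        subst hX
        rfl
      · rw [if_neg hX]
        exact (((f c).app X x).2.resolve_left hX).symm
  · ext X x
    have h1 := congrArg (fun e => (e.app X x).1) (hg (cls X.unop))
    have h2 : ∀ e : L ⟶ M, ((e ≫ π (cls X.unop)).app X x).1 = e.app X x := fun e =>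
      (hπ _ X.unop (e.app X x)).trans (if_pos rfl)
    exact (h2 g).symm.trans (h1.trans (h2 g'))
  · by_cases hc : ∃ X, cls X = c ∧ Nontrivial (M.obj (op X))
    · obtain ⟨X, rfl, hX⟩ := hc
      refine h X hX _ fun Y hY => ?_
      exact Quotient.exact (of_nontrivial_restrictTo hY).1
    · refine extZero_of_isZero (isZero_of_subsingleton fun X => ?_) n
      by_contra hX
      rw [not_subsingleton_iff_nontrivial] at hX
      exact hc ⟨X, of_nontrivial_restrictTo hX⟩

include hd hiso in
/-- Vanishing of extensions can be checked on the functors concentrated at objects of the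
support. -/
theorem extZero_of_concentrated {k : ℕ} {M : Cᵒᵖ ⥤ ModuleCat.{max u v} R}
    (hk : ∀ X, Nontrivial (M.obj (op X)) → d X < k)
    (h : ∀ X, Nontrivial (M.obj (op X)) → ∀ M' : Cᵒᵖ ⥤ ModuleCat.{max u v} R,
      Concentrated M' X → ExtZero T M' n) : ExtZero T M n := by
  induction k generalizing M with
  | zero =>
    refine extZero_of_isZero (isZero_of_subsingleton fun X => ?_) n
    by_contra hX
    rw [not_subsingleton_iff_nontrivial] at hX
    exact absurd (hk X hX) (Nat.not_lt_zero _)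
  | succ k ih =>
    -- By contravariance elements move from `Y` to `X` with `d X ≤ d Y`, so the values below level
    -- `k` form a subfunctor, and the quotient lives on level `k`.
    have hst : ∀ {X Y : C} (f : X ⟶ Y), ∀ m ∈ restrictTo R (d Y < k) (M.obj (op Y)),
        M.map f.op m ∈ restrictTo R (d X < k) (M.obj (op X)) := by
      rintro X Y f m (h | rfl)
      · exact Or.inl ((hd f).trans_lt h)
      · exact Or.inr (map_zero _)
    have hS := cokernelSequence_shortExact (subι M _ hst)
    have hQ : ∀ X, Nontrivial ((cokernelSequence (subι M _ hst)).X₃.obj (op X)) →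
        d X = k ∧ Nontrivial (M.obj (op X)) := by
      intro X hX
      have hM : Nontrivial (M.obj (op X)) := by
        by_contra hM
        rw [not_nontrivial_iff_subsingleton] at hM
        have := subsingleton_X₃_of_subsingleton hS hM
        exact not_subsingleton _ this
      refine ⟨le_antisymm (Nat.lt_succ_iff.1 (hk X hM)) ?_, hM⟩
      by_contra hlt
      have := subsingleton_X₃_of_surjective hS (X := X)
        fun m => ⟨⟨m, Or.inl (not_le.1 hlt)⟩, rfl⟩
      exact not_subsingleton _ this
    refine ExtZero.middle hS ?_ ?_
    · refine ih (fun X hX => (of_nontrivial_restrictTo hX).1) fun X hX => ?_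
      exact h X (of_nontrivial_restrictTo hX).2
    · exact extZero_of_level d hiso (fun X hX => (hQ X hX).1) fun X hX => h X (hQ X hX).2

end filtration

end Contramodule

/-! ### The orbit category -/

namespace FiniteOrbit

variable {Γ : Type v} [Group Γ]

/-- The points of an orbit. -/
abbrev Pt (X : FiniteOrbit Γ) : Type v := Γ ⧸ X.stab

/-- The base point of an orbit. -/
def pt (X : FiniteOrbit Γ) : X.Pt := ((1 : Γ) : Γ ⧸ X.stab)

/-- The map of points underlying a morphism of orbits. -/
def app {X Y : FiniteOrbit Γ} (f : X ⟶ Y) (x : X.Pt) : Y.Pt :=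
  DFunLike.coe (F := X.Pt →[Γ] Y.Pt) f x

variable {X Y Z : FiniteOrbit Γ}

@[simp] lemma app_comp (f : X ⟶ Y) (g : Y ⟶ Z) (x : X.Pt) : app (f ≫ g) x = app g (app f x) := rfl

lemma app_smul (f : X ⟶ Y) (g : Γ) (x : X.Pt) : app f (g • x) = g • app f x :=
  MulActionHom.map_smul' (φ := id) (X := X.Pt) (Y := Y.Pt) f g x

lemma exists_smul_eq (x y : X.Pt) : ∃ g : Γ, g • x = y := MulAction.exists_smul_eq Γ x y

lemma hom_ext {f g : X ⟶ Y} (x : X.Pt) (h : app f x = app g x) : f = g := by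
  refine MulActionHom.ext (X := X.Pt) (Y := Y.Pt) fun y => ?_
  obtain ⟨a, rfl⟩ := exists_smul_eq x y
  change app f (a • x) = app g (a • x)
  rw [app_smul, app_smul, h]

lemma stabilizer_le (f : X ⟶ Y) (x : X.Pt) :
    MulAction.stabilizer Γ x ≤ MulAction.stabilizer Γ (app f x) := by
  intro g hg
  rw [MulAction.mem_stabilizer_iff] at hg ⊢
  rw [← app_smul, hg]

lemma stabilizer_pt (X : FiniteOrbit Γ) : MulAction.stabilizer Γ X.pt = X.stab :=
  MulAction.stabilizer_quotient X.stab

lemma card_stabilizer (x : X.Pt) : Nat.card (MulAction.stabilizer Γ x) = Nat.card X.stab := by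
  obtain ⟨g, rfl⟩ := exists_smul_eq X.pt x
  rw [MulAction.stabilizer_smul_eq_stabilizer_map_conj, stabilizer_pt]
  exact (Nat.card_congr (Subgroup.equivMapOfInjective X.stab (MulAut.conj g).toMonoidHom
    (MulAut.conj g).injective).toEquiv).symm

lemma finite_stabilizer (x : X.Pt) : Finite (MulAction.stabilizer Γ x) := by
  have := X.finite
  have h : Nat.card (MulAction.stabilizer Γ x) ≠ 0 := by
    rw [card_stabilizer]
    exact Nat.card_pos.ne'
  exact (Nat.card_ne_zero.1 h).2

/-- The morphism with a prescribed value at the base point. -/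
def homOfPt (y : Y.Pt) (h : X.stab ≤ MulAction.stabilizer Γ y) : X ⟶ Y :=
  ({ toFun := fun x => Quotient.liftOn' x (fun g : Γ => g • y) fun a b hab => by
      have h1 := h (QuotientGroup.leftRel_apply.1 hab)
      rw [MulAction.mem_stabilizer_iff, mul_smul, inv_smul_eq_iff] at h1
      exact h1.symm
     map_smul' := fun g x => by
      induction x using Quotient.inductionOn' with
      | h a => exact mul_smul g a y } : X.Pt →[Γ] Y.Pt)

@[simp] lemma app_homOfPt (y : Y.Pt) (h : X.stab ≤ MulAction.stabilizer Γ y) :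
    app (homOfPt y h) X.pt = y := one_smul Γ y

lemma homOfPt_comp (y : Y.Pt) (h : X.stab ≤ MulAction.stabilizer Γ y) (f : Y ⟶ Z) :
    homOfPt y h ≫ f = homOfPt (app f y) (h.trans (stabilizer_le f y)) :=
  hom_ext X.pt (by simp)

lemma homOfPt_app (f : X ⟶ Y) (h : X.stab ≤ MulAction.stabilizer Γ (app f X.pt)) :
    homOfPt (app f X.pt) h = f := hom_ext X.pt (by simp)

lemma card_le_of_hom (f : X ⟶ Y) : Nat.card X.stab ≤ Nat.card Y.stab := by
  have := finite_stabilizer (app f X.pt)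
  rw [← card_stabilizer X.pt, ← card_stabilizer (app f X.pt)]
  exact Subgroup.card_le_of_le (stabilizer_le f X.pt)

lemma stabilizer_eq_of_card_le (f : X ⟶ Y) (h : Nat.card Y.stab ≤ Nat.card X.stab) (x : X.Pt) :
    MulAction.stabilizer Γ x = MulAction.stabilizer Γ (app f x) := by
  have := finite_stabilizer (app f x)
  refine Subgroup.eq_of_le_of_card_ge (stabilizer_le f x) ?_
  rwa [card_stabilizer, card_stabilizer]

/-- Stabilizers of a point and of its image agree, which gives injectivity; transitivity gives
surjectivity. Thus the order of the stabilizer is a rank function to which the filtration applies.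
-/
lemma isIso_of_card_le (f : X ⟶ Y) (h : Nat.card Y.stab ≤ Nat.card X.stab) : IsIso f := by
  have h1 : Function.Bijective (app f) := by
    constructor
    · intro x y hxy
      obtain ⟨g, rfl⟩ := exists_smul_eq x y
      have h2 : g ∈ MulAction.stabilizer Γ (app f x) := by
        rw [MulAction.mem_stabilizer_iff, ← app_smul, ← hxy]
      rw [← stabilizer_eq_of_card_le f h] at h2
      exact (MulAction.mem_stabilizer_iff.1 h2).symm
    · intro y
      obtain ⟨g, rfl⟩ := exists_smul_eq (app f X.pt) y
      exact ⟨g • X.pt, app_smul f g _⟩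
  let e := Equiv.ofBijective _ h1
  let k : Y ⟶ X := MulActionHom.inverse (X := X.Pt) (Y₁ := Y.Pt) f e.symm e.left_inv e.right_inv
  exact ⟨k, MulActionHom.ext (X := X.Pt) (Y := X.Pt) e.left_inv,
    MulActionHom.ext (X := Y.Pt) (Y := Y.Pt) e.right_inv⟩

lemma card_eq_of_iso (e : X ≅ Y) : Nat.card X.stab = Nat.card Y.stab :=
  le_antisymm (card_le_of_hom e.hom) (card_le_of_hom e.inv)

lemma stabilizer_iso (f : X ⟶ Y) [IsIso f] (x : X.Pt) :
    MulAction.stabilizer Γ (app f x) = MulAction.stabilizer Γ x :=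
  (stabilizer_eq_of_card_le f (card_le_of_hom (inv f)) x).symm

/-- The orbit of a finite subgroup. -/
def ofSubgroup (H : FiniteSubgroup Γ) : FiniteOrbit Γ := ⟨H.1, H.2⟩

@[simp] lemma ofSubgroup_stab (H : FiniteSubgroup Γ) : (ofSubgroup H).stab = H.1 := rfl

/-- The stabilizer of a point as a finite subgroup. -/
def stabilizerOf (x : X.Pt) : FiniteSubgroup Γ := ⟨MulAction.stabilizer Γ x, finite_stabilizer x⟩

lemma nonempty_iso_ofSubgroup (x : X.Pt) : Nonempty (ofSubgroup (stabilizerOf x) ≅ X) := by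
  have := isIso_of_card_le (X := ofSubgroup (stabilizerOf x)) (homOfPt x le_rfl)
    (card_stabilizer x).ge
  exact ⟨asIso (homOfPt (X := ofSubgroup (stabilizerOf x)) x le_rfl)⟩

end FiniteOrbit

/-! ### Functors concentrated at a subgroup with contractible poset above it -/

namespace FlagModule

open Opposite Limits ExtVanishing Contramodule ListChain FiniteOrbit

universe w

variable {R : Type u} [CommRing R] {Γ : Type v} [Group Γ] (H : FiniteSubgroup Γ)

section flags

variable {X Y : FiniteOrbit Γ}

/-- A decreasing list of finite subgroups strictly containing `H`, and a point of an orbit fixed by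
`H` and by the subgroups of the list. -/
def IsFlag (c : List (Set.Ioi H)) (x : X.Pt) : Prop :=
  c.Pairwise (· ≥ ·) ∧ H.1 ≤ MulAction.stabilizer Γ x ∧
    ∀ K ∈ c, K.1.1 ≤ MulAction.stabilizer Γ x

/-- The flags over an orbit. -/
abbrev Flag (X : FiniteOrbit Γ) : Type v := {p : List (Set.Ioi H) × X.Pt // IsFlag H p.1 p.2}

variable {H}

lemma IsFlag.map {c : List (Set.Ioi H)} {x : X.Pt} (h : IsFlag H c x) (f : X ⟶ Y) :
    IsFlag H c (app f x) :=
  ⟨h.1, h.2.1.trans (stabilizer_le f x), fun K hK => (h.2.2 K hK).trans (stabilizer_le f x)⟩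

lemma IsFlag.sublist {c c' : List (Set.Ioi H)} {x : X.Pt} (h : IsFlag H c x) (hc : c'.Sublist c) :
    IsFlag H c' x := ⟨h.1.sublist hc, h.2.1, fun K hK => h.2.2 K (hc.subset hK)⟩

/-- The map of flags induced by a morphism. -/
def Flag.map (f : X ⟶ Y) (p : Flag H X) : Flag H Y := ⟨(p.1.1, app f p.1.2), p.2.map f⟩

/-- The largest subgroup of a decreasing list. -/
def top : List (Set.Ioi H) → FiniteSubgroup Γ
  | [] => H
  | K :: _ => K.1

/-- The universal flag with list `c`: flags with this list over `X` correspond to morphisms from the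
orbit of `top c` to `X`. -/
lemma isFlag_top {c : List (Set.Ioi H)} (hc : c.Pairwise (· ≥ ·)) :
    IsFlag H c (ofSubgroup (top c)).pt := by
  rw [IsFlag, stabilizer_pt]
  cases c with
  | nil => exact ⟨hc, le_rfl, by simp⟩
  | cons K c =>
    refine ⟨hc, (le_of_lt K.2 : H ≤ K.1), fun L hL => ?_⟩
    rcases List.mem_cons.1 hL with rfl | hL
    · exact le_rfl
    · exact (List.pairwise_cons.1 hc).1 L hL

lemma IsFlag.top_le {c : List (Set.Ioi H)} {x : X.Pt} (h : IsFlag H c x) :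
    (ofSubgroup (top c)).stab ≤ MulAction.stabilizer Γ x := by
  cases c with
  | nil => exact h.2.1
  | cons K c => exact h.2.2 K (by simp)

/-- The morphism to the orbit of a flag. -/
def IsFlag.hom {c : List (Set.Ioi H)} {x : X.Pt} (h : IsFlag H c x) : ofSubgroup (top c) ⟶ X :=
  homOfPt x h.top_le

lemma IsFlag.hom_comp {c : List (Set.Ioi H)} {x : X.Pt} (h : IsFlag H c x) (f : X ⟶ Y) :
    h.hom ≫ f = (h.map f).hom := homOfPt_comp _ _ _

lemma IsFlag.app_hom {c : List (Set.Ioi H)} {x : X.Pt} (h : IsFlag H c x) :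
    app h.hom (ofSubgroup (top c)).pt = x := app_homOfPt _ _

end flags

variable (V : Type max u v) [AddCommGroup V] [Module R V]

/-- The functions on flags. -/
def flagFun : BredonContramodule R Γ where
  obj X := ModuleCat.of R (Flag H X.unop → V)
  map f := ModuleCat.ofHom (LinearMap.funLeft R V (Flag.map f.unop))
  map_id _ := rfl
  map_comp _ _ := rfl

section differential

variable {H V} {X Y : FiniteOrbit Γ}

open Classical in
/-- The linear extension of the function of lists given by a function on flags at a point. -/
def evalOn (u : Flag H X → V) (x : X.Pt) : ListChain (Set.Ioi H) →ₗ[ℤ] V :=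
  Finsupp.linearCombination ℤ fun c => if h : IsFlag H c x then u ⟨(c, x), h⟩ else 0

lemma evalOn_single (u : Flag H X → V) {x : X.Pt} {c : List (Set.Ioi H)} (h : IsFlag H c x) :
    evalOn u x (Finsupp.single c 1) = u ⟨(c, x), h⟩ := by
  simp [evalOn, h]

lemma evalOn_add (u u' : Flag H X → V) (x : X.Pt) (z : ListChain (Set.Ioi H)) :
    evalOn (u + u') x z = evalOn u x z + evalOn u' x z :=
  ListChain.hom_ext (f := evalOn (u + u') x) (g := evalOn u x + evalOn u' x) (fun c => by
    by_cases h : IsFlag H c x <;> simp [evalOn, h]) z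

lemma evalOn_smul (r : R) (u : Flag H X → V) (x : X.Pt) (z : ListChain (Set.Ioi H)) :
    evalOn (r • u) x z = r • evalOn u x z :=
  ListChain.hom_ext (f := evalOn (r • u) x) (g := r • evalOn u x) (fun c => by
    by_cases h : IsFlag H c x <;> simp [evalOn, h]) z

lemma evalOn_map (f : X ⟶ Y) (u : Flag H Y → V) {x : X.Pt} {c : List (Set.Ioi H)}
    (h : IsFlag H c x) :
    evalOn (fun p => u (Flag.map f p)) x (bdList c) = evalOn u (app f x) (bdList c) := by
  refine eq_of_on (fun c' hc' => ?_) (bdList_mem c)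
  have h' := h.sublist hc'.1
  rw [evalOn_single _ h', evalOn_single _ (h'.map f)]
  rfl

/-- The differential of functions on flags. -/
def diff (X : FiniteOrbit Γ) : (Flag H X → V) →ₗ[R] (Flag H X → V) where
  toFun u p := evalOn u p.1.2 (bdList p.1.1)
  map_add' u u' := funext fun _ => evalOn_add u u' _ _
  map_smul' r u := funext fun _ => evalOn_smul r u _ _

lemma diff_apply (u : Flag H X → V) (p : Flag H X) :
    diff (R := R) X u p = evalOn u p.1.2 (bdList p.1.1) := rfl

lemma diff_diff (u : Flag H X → V) : diff (R := R) X (diff (R := R) X u) = 0 := by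
  funext p
  rw [diff_apply]
  have : evalOn (diff (R := R) X u) p.1.2 (bdList p.1.1) = (evalOn u p.1.2 ∘ₗ bd) (bdList p.1.1) :=
    eq_of_on (fun c hc => by
      rw [evalOn_single _ (p.2.sublist hc.1), diff_apply, LinearMap.comp_apply, bd_single])
      (bdList_mem p.1.1)
  rw [this, LinearMap.comp_apply, ← bd_single, bd_bd, map_zero]
  rfl

lemma diff_nil (u : Flag H X → V) {x : X.Pt} (h : IsFlag H [] x) :
    diff (R := R) X u ⟨([], x), h⟩ = 0 := by
  simp [diff_apply, bdList]

lemma isFlag_nil_of (p : Flag H X) : IsFlag H [] p.1.2 := p.2.sublist (List.nil_sublist _)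

/-- The stabilizer of a point, when it strictly contains `H`. -/
def above {x : X.Pt} (h : IsFlag H [] x) (hx : MulAction.stabilizer Γ x ≠ H.1) : Set.Ioi H :=
  ⟨stabilizerOf x, lt_of_le_of_ne (a := H) (b := stabilizerOf x) h.2.1 fun h' =>
    hx (congrArg (fun K : FiniteSubgroup Γ => K.1) h').symm⟩

lemma isFlag_cons_above {c : List (Set.Ioi H)} {x : X.Pt} (h : IsFlag H c x) (h0 : IsFlag H [] x)
    (hx : MulAction.stabilizer Γ x ≠ H.1) : IsFlag H (above h0 hx :: c) x := by
  refine ⟨List.pairwise_cons.2 ⟨fun K hK => h.2.2 K hK, h.1⟩, h.2.1, fun K hK => ?_⟩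
  rcases List.mem_cons.1 hK with rfl | hK
  · exact le_rfl
  · exact h.2.2 K hK

lemma eq_nil_of_stabilizer_eq {c : List (Set.Ioi H)} {x : X.Pt} (h : IsFlag H c x)
    (hx : MulAction.stabilizer Γ x = H.1) : c = [] := by
  cases c with
  | nil => rfl
  | cons K c => exact absurd ((h.2.2 K (by simp)).trans hx.le : K.1 ≤ H) (not_le_of_gt K.2)

end differential

section subfunctors

variable {H V} in
lemma diff_map {X Y : FiniteOrbit Γ} (f : X ⟶ Y) (u : Flag H Y → V) :
    diff (R := R) X (fun p => u (Flag.map f p)) = fun p => diff (R := R) Y u (Flag.map f p) :=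
  funext fun p => evalOn_map f u p.2

/-- The cocycles among the functions on flags, at an orbit. -/
def cocycleSub (X : FiniteOrbit Γ) : Submodule R (Flag H X → V) := LinearMap.ker (diff X)

/-- The cocycles that vanish on flags with empty list, at an orbit. -/
def reducedSub (X : FiniteOrbit Γ) : Submodule R (Flag H X → V) where
  carrier := {u | diff (R := R) X u = 0 ∧ ∀ x h, u ⟨([], x), h⟩ = 0}
  zero_mem' := ⟨map_zero _, fun _ _ => rfl⟩
  add_mem' := fun {a b} ha hb => ⟨by rw [map_add, ha.1, hb.1, add_zero],
    fun x h => by rw [Pi.add_apply, ha.2, hb.2, add_zero]⟩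
  smul_mem' := fun r a ha => ⟨by rw [map_smul, ha.1, smul_zero],
    fun x h => by rw [Pi.smul_apply, ha.2, smul_zero]⟩

/-- The functions supported on the flags with empty list over points with stabilizer `H`, at an
orbit. -/
def exactSub (X : FiniteOrbit Γ) : Submodule R (Flag H X → V) where
  carrier := {u | ∀ p, u p ≠ 0 → p.1.1 = [] ∧ MulAction.stabilizer Γ p.1.2 = H.1}
  zero_mem' := fun p h => absurd rfl h
  add_mem' := fun {a b} ha hb p h => by
    by_cases h1 : a p = 0
    · exact hb p (by rwa [Pi.add_apply, h1, zero_add] at h)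
    · exact ha p h1
  smul_mem' := fun r a ha p h => ha p fun h0 => h (by rw [Pi.smul_apply, h0, smul_zero])

variable {H V} in
lemma diff_map_eq_zero {X Y : FiniteOrbit Γ} (f : X ⟶ Y) {u : Flag H Y → V}
    (hu : diff (R := R) Y u = 0) : diff (R := R) X (fun p => u (Flag.map f p)) = 0 := by
  rw [diff_map, hu]
  rfl

lemma cocycleSub_map {X Y : FiniteOrbit Γ} (f : X ⟶ Y) (u : Flag H Y → V)
    (hu : u ∈ cocycleSub (R := R) H V Y) :
    (fun p => u (Flag.map f p)) ∈ cocycleSub (R := R) H V X := diff_map_eq_zero f hu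

lemma reducedSub_map {X Y : FiniteOrbit Γ} (f : X ⟶ Y) (u : Flag H Y → V)
    (hu : u ∈ reducedSub (R := R) H V Y) :
    (fun p => u (Flag.map f p)) ∈ reducedSub (R := R) H V X :=
  ⟨diff_map_eq_zero f hu.1, fun _ h => hu.2 _ (h.map f)⟩

lemma exactSub_map {X Y : FiniteOrbit Γ} (f : X ⟶ Y) (u : Flag H Y → V)
    (hu : u ∈ exactSub (R := R) H V Y) :
    (fun p => u (Flag.map f p)) ∈ exactSub (R := R) H V X := fun p hp => by
  obtain ⟨h1, h2⟩ := hu (Flag.map f p) hp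
  exact ⟨h1, le_antisymm ((stabilizer_le f _).trans h2.le) p.2.2.1⟩

/-- The cocycles among the functions on flags. -/
def cocycles : BredonContramodule R Γ :=
  sub (flagFun (R := R) H V) (cocycleSub H V) (cocycleSub_map H V)

/-- The cocycles that vanish on flags with empty list. -/
def reducedCocycles : BredonContramodule R Γ :=
  sub (flagFun (R := R) H V) (reducedSub H V) (reducedSub_map H V)

/-- The functions supported on the flags with empty list over points with stabilizer `H`. -/
def exactFun : BredonContramodule R Γ :=
  sub (flagFun (R := R) H V) (exactSub H V) (exactSub_map H V)

variable {H V} in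
-- Over a point with stabilizer `H` the only flag has the empty list, and its boundary is zero.
lemma exactFun_cocycle {X : FiniteOrbit Γ} (u : Flag H X → V)
    (hu : ∀ p, u p ≠ 0 → p.1.1 = [] ∧ MulAction.stabilizer Γ p.1.2 = H.1) :
    diff (R := R) X u = 0 := by
  funext p
  rw [diff_apply]
  refine eq_of_on (g := 0) (fun c hc => ?_) (bdList_mem p.1.1)
  rw [evalOn_single _ (p.2.sublist hc.1)]
  by_contra h
  have h2 := hu _ h
  have h3 := eq_nil_of_stabilizer_eq p.2 h2.2
  have := hc.2
  rw [h3] at this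
  exact absurd this (Nat.not_lt_zero _)

variable {H V} in
-- The stabilizer of `x` alone forms a flag, and the boundary of its list is the empty list.
lemma cocycle_nil {X : FiniteOrbit Γ} {u : Flag H X → V} (hu : diff (R := R) X u = 0) {x : X.Pt}
    (h : IsFlag H [] x) (hx : MulAction.stabilizer Γ x ≠ H.1) : u ⟨([], x), h⟩ = 0 := by
  have h1 := congrFun hu ⟨([above h hx], x), isFlag_cons_above h h hx⟩
  rw [diff_apply] at h1
  simpa [bdList, evalOn_single u h] using h1

/-- The differential from functions to reduced cocycles. -/
def diffHom : flagFun (R := R) H V ⟶ reducedCocycles (R := R) H V :=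
  subLift _ _ (reducedSub_map H V)
    { app := fun X => ModuleCat.ofHom (diff (R := R) (H := H) (V := V) X.unop)
      naturality := fun X Y f => by
        ext u
        exact diff_map (R := R) f.unop u }
    fun _ u => ⟨diff_diff (R := R) u, fun _ h => diff_nil (R := R) u h⟩

/-- The sequence of cocycles, functions and reduced cocycles. -/
def cocycleSequence : ShortComplex (BredonContramodule R Γ) :=
  ShortComplex.mk (subι _ _ (cocycleSub_map H V) : cocycles (R := R) H V ⟶ _) (diffHom H V) (by
    ext X u
    exact Subtype.ext u.2)

variable {H V} in
lemma exists_diff_eq {X : FiniteOrbit Γ} {u : Flag H X → V} (hu : diff (R := R) X u = 0)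
    (hu0 : ∀ x h, u ⟨([], x), h⟩ = 0) : ∃ t : Flag H X → V, diff (R := R) X t = u := by
  classical
  -- A cone whose apex is the stabilizer of the point, the largest subgroup allowed over it. Where
  -- the stabilizer is `H` only the empty list occurs, and `u` vanishes there. Solving at each orbit
  -- separately suffices for exactness.
  let t : Flag H X → V := fun p =>
    if hx : MulAction.stabilizer Γ p.1.2 ≠ H.1 then
      u ⟨(above (isFlag_nil_of p) hx :: p.1.1, p.1.2), isFlag_cons_above p.2 _ hx⟩ else 0
  refine ⟨t, funext fun p => ?_⟩
  by_cases hx : MulAction.stabilizer Γ p.1.2 = H.1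
  · obtain ⟨⟨c, x⟩, hp⟩ := p
    obtain rfl := eq_nil_of_stabilizer_eq hp hx
    rw [diff_nil, hu0]
  · have h1 := congrFun hu ⟨(above (isFlag_nil_of p) hx :: p.1.1, p.1.2),
      isFlag_cons_above p.2 _ hx⟩
    rw [diff_apply] at h1
    simp only [bdList, map_sub] at h1
    rw [evalOn_single u p.2, Pi.zero_apply, sub_eq_zero] at h1
    refine Eq.trans ?_ h1.symm
    rw [diff_apply]
    refine eq_of_on (g := evalOn u p.1.2 ∘ₗ cons (above (isFlag_nil_of p) hx))
      (fun c hc => ?_) (bdList_mem p.1.1)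
    have hc' := p.2.sublist hc.1
    rw [evalOn_single _ hc', LinearMap.comp_apply, cons_single,
      evalOn_single u (isFlag_cons_above hc' _ hx)]
    simp only [t]
    rw [dif_pos hx]

lemma cocycleSequence_shortExact : (cocycleSequence (R := R) H V).ShortExact := by
  refine ModuleFunctor.shortExact_iff.2 fun X => ⟨Subtype.val_injective, ?_, ?_⟩
  · rintro ⟨u, hu, hu0⟩
    obtain ⟨t, ht⟩ := exists_diff_eq (R := R) hu hu0
    exact ⟨t, Subtype.ext ht⟩
  · intro u hu
    exact ⟨⟨u, congrArg Subtype.val hu⟩, rfl⟩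

/-- The inclusion of the functions supported on points with stabilizer `H` into the cocycles. -/
def exactι : exactFun (R := R) H V ⟶ cocycles (R := R) H V :=
  subLift _ _ (cocycleSub_map H V) (subι _ _ (exactSub_map H V)) fun _ u =>
    exactFun_cocycle u.1 u.2

/-- The inclusion of the reduced cocycles into the cocycles. -/
def reducedι : reducedCocycles (R := R) H V ⟶ cocycles (R := R) H V :=
  subLift _ _ (cocycleSub_map H V) (subι _ _ (reducedSub_map H V)) fun _ u => u.2.1

open Classical in
/-- The projection of the cocycles to the functions supported on points with stabilizer `H`. -/
def exactπ : cocycles (R := R) H V ⟶ exactFun (R := R) H V :=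
  subLift _ _ (exactSub_map H V)
    { app := fun X => ModuleCat.ofHom (X := cocycleSub (R := R) H V X.unop)
        { toFun := fun u p => if p.1.1 = [] ∧ MulAction.stabilizer Γ p.1.2 = H.1 then u.1 p else 0
          map_add' := fun u u' => by
            funext p
            simp only [Pi.add_apply]
            split_ifs
            · rfl
            · simp
          map_smul' := fun r u => by
            funext p
            simp only [Pi.smul_apply]
            split_ifs
            · rfl
            · simp }
      naturality := fun X Y f => by
        ext u
        funext p
        change (if p.1.1 = [] ∧ MulAction.stabilizer Γ p.1.2 = H.1 then
            u.1 (Flag.map f.unop p) else 0) =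
          if p.1.1 = [] ∧ MulAction.stabilizer Γ (app f.unop p.1.2) = H.1 then
            u.1 (Flag.map f.unop p) else 0
        by_cases h1 : p.1.1 = [] ∧ MulAction.stabilizer Γ (app f.unop p.1.2) = H.1
        · rw [if_pos h1, if_pos ⟨h1.1,
            le_antisymm ((stabilizer_le f.unop _).trans h1.2.le) p.2.2.1⟩]
        · rw [if_neg h1]
          split_ifs with h2
          · obtain ⟨⟨c, x⟩, hp⟩ := p
            obtain ⟨rfl, h3⟩ := h2
            exact cocycle_nil (R := R) u.2 _ fun h => h1 ⟨rfl, h⟩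
          · rfl }
    fun X u p hp => by
      by_contra h
      exact hp (if_neg h)

/-- On empty lists a cocycle lives over points with stabilizer `H`, by `cocycle_nil`. Cutting off
this part exhibits both `exactFun` and `reducedCocycles` as retracts of `cocycles`. -/
lemma exactι_exactπ : exactι (R := R) H V ≫ exactπ H V = 𝟙 _ := by
  ext X u
  refine Subtype.ext (funext fun p => ?_)
  classical
  refine (ite_eq_left_iff.2 fun h => ?_ : (if p.1.1 = [] ∧ MulAction.stabilizer Γ p.1.2 = H.1 then
    u.1 p else 0) = u.1 p)
  by_contra h'
  exact h (u.2 p (Ne.symm h'))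

/-- The projection of the cocycles to the reduced cocycles. -/
def reducedπ : cocycles (R := R) H V ⟶ reducedCocycles (R := R) H V :=
  subLift _ _ (reducedSub_map H V)
    ((𝟙 _ - exactπ (R := R) H V ≫ exactι H V) ≫ subι _ _ (cocycleSub_map H V)) fun X u => by
    refine ⟨((𝟙 _ - exactπ (R := R) H V ≫ exactι H V).app (op X) u).2, fun x h => ?_⟩
    classical
    change u.1 ⟨([], x), h⟩ - (if ([] : List (Set.Ioi H)) = [] ∧ MulAction.stabilizer Γ x = H.1 then
      u.1 ⟨([], x), h⟩ else 0) = 0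
    by_cases hx : MulAction.stabilizer Γ x = H.1
    · rw [if_pos ⟨rfl, hx⟩, sub_self]
    · rw [if_neg fun h => hx h.2, sub_zero]
      exact cocycle_nil (R := R) u.2 h hx

lemma reducedι_reducedπ : reducedι (R := R) H V ≫ reducedπ H V = 𝟙 _ := by
  ext X u
  refine Subtype.ext (funext fun p => ?_)
  classical
  change u.1 p - (if p.1.1 = [] ∧ MulAction.stabilizer Γ p.1.2 = H.1 then u.1 p else 0) = u.1 p
  split_ifs with h
  · obtain ⟨⟨c, x⟩, hp⟩ := p
    obtain ⟨rfl, -⟩ := h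
    rw [sub_eq_self]
    exact u.2.2 x _
  · rw [sub_zero]

end subfunctors

end FlagModule

/-! ### Vanishing of extensions in the contractible case. -/

namespace FlagModule

open Opposite Limits ExtVanishing Contramodule ListChain FiniteOrbit

universe w

section split

variable {R A B C V : Type*} [Ring R] [AddCommGroup A] [Module R A] [AddCommGroup B] [Module R B]
  [AddCommGroup C] [Module R C] [AddCommGroup V] [Module R V]

lemma exists_retraction [Module.Projective R C] (i : A →ₗ[R] B) (p : B →ₗ[R] C)
    (hi : Function.Injective i) (hp : Function.Surjective p) (h : ∀ x, p x = 0 → ∃ y, i y = x) :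
    ∃ r : B →ₗ[R] A, ∀ a, p (i a) = 0 → r (i a) = a := by
  obtain ⟨s, hs⟩ := Module.projective_lifting_property p LinearMap.id hp
  have hs' : ∀ c, p (s c) = c := fun c => LinearMap.congr_fun hs c
  let q : B →ₗ[R] LinearMap.range i := (LinearMap.id - s ∘ₗ p).codRestrict _ fun b =>
    h _ (by simp [hs'])
  refine ⟨(LinearEquiv.ofInjective i hi).symm ∘ₗ q, fun a ha => ?_⟩
  rw [LinearMap.comp_apply, LinearEquiv.coe_coe, LinearEquiv.symm_apply_eq]
  refine Subtype.ext (?_ : i a - s (p (i a)) = i a)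
  rw [ha, map_zero, sub_zero]

end split

variable {R : Type u} [CommRing R] {Γ : Type v} [Group Γ]

lemma map_hom_top {H : FiniteSubgroup Γ} {X : FiniteOrbit Γ} {c : List (Set.Ioi H)} {x : X.Pt}
    (h : IsFlag H c x) :
    Flag.map h.hom ⟨(c, (ofSubgroup (top c)).pt), isFlag_top h.1⟩ = ⟨(c, x), h⟩ :=
  Subtype.ext (Prod.ext rfl h.app_hom)

section acyclic

variable {S : ShortComplex (BredonContramodule R Γ)} (hS : S.ShortExact)
  (hX : ∀ K, Module.Projective R (S.X₃.obj (op K)))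

include hS hX

lemma exists_retraction_app (K : FiniteOrbit Γ) :
    ∃ r : S.X₂.obj (op K) →ₗ[R] S.X₁.obj (op K), ∀ a, r (S.f.app (op K) a) = a := by
  have := hX K
  obtain ⟨h1, h2, h3⟩ := ModuleFunctor.shortExact_iff.1 hS (op K)
  obtain ⟨r, hr⟩ := exists_retraction (S.f.app (op K)).hom (S.g.app (op K)).hom h1 h2 h3
  exact ⟨r, fun a => hr a (congrArg (fun e : S.X₁ ⟶ S.X₃ => e.app (op K) a) S.zero)⟩

variable (H : FiniteSubgroup Γ) (V : Type max u v) [AddCommGroup V] [Module R V]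

/-- A map into functions on flags amounts to a linear map to `V` from the value at the orbit of `top
c`, one for each decreasing list `c`. Each of them extends, since the sequence splits linearly at
every object. -/
lemma exists_extension (f : S.X₁ ⟶ flagFun H V) : ∃ g : S.X₂ ⟶ flagFun H V, S.f ≫ g = f := by
  choose r hr using exists_retraction_app hS hX
  let b : ∀ c : List (Set.Ioi H), c.Pairwise (· ≥ ·) →
      S.X₂.obj (op (ofSubgroup (top c))) →ₗ[R] V := fun c hc =>
    (LinearMap.proj (R := R) (φ := fun _ : Flag H (ofSubgroup (top c)) => V)
      ⟨(c, (ofSubgroup (top c)).pt), isFlag_top hc⟩) ∘ₗ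
      (f.app (op (ofSubgroup (top c)))).hom ∘ₗ r _
  have hb : ∀ c hc a, b c hc (S.f.app _ a) = (f.app (op (ofSubgroup (top c))) a)
      ⟨(c, (ofSubgroup (top c)).pt), isFlag_top hc⟩ := fun c hc a =>
    congrArg (fun a => (f.app (op (ofSubgroup (top c))) a)
      ⟨(c, (ofSubgroup (top c)).pt), isFlag_top hc⟩) (hr _ a)
  refine ⟨{ app := fun X => ModuleCat.ofHom (LinearMap.pi fun p : Flag H X.unop =>
              b p.1.1 p.2.1 ∘ₗ (S.X₂.map p.2.hom.op).hom)
            naturality := fun X Y j => ?_ }, ?_⟩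
  · ext m
    refine funext fun p : Flag H Y.unop => ?_
    change b p.1.1 p.2.1 (S.X₂.map p.2.hom.op (S.X₂.map j m)) =
      b p.1.1 p.2.1 (S.X₂.map (p.2.map j.unop).hom.op m)
    rw [← IsFlag.hom_comp, map_comp_apply]
    rfl
  · ext X m
    refine funext fun p : Flag H X.unop => ?_
    change b p.1.1 p.2.1 (S.X₂.map p.2.hom.op (S.f.app (op X.unop) m)) = f.app (op X.unop) m p
    rw [← naturality_apply, hb _ p.2.1, naturality_apply]
    exact congrArg (f.app (op X.unop) m) (map_hom_top p.2)

end acyclic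

variable (H : FiniteSubgroup Γ) (V : Type max u v) [AddCommGroup V] [Module R V]

/-- The functions on flags have no higher extensions by pointwise projective functors. -/
lemma extZero_flagFun [HasExt.{w} (BredonContramodule R Γ)] (n : ℕ) (X : BredonContramodule R Γ)
    (hX : ∀ K, Module.Projective R (X.obj (op K))) : ExtZero X (flagFun H V) (n + 1) := by
  have hS := kernelSequence_shortExact (freeπ X)
  have : Projective (kernelSequence (freeπ X)).X₂ := inferInstanceAs (Projective (freeCover X))
  induction n generalizing X with
  | zero => exact (extZero_one_iff hS).2 (exists_extension hS hX H V)
  | succ n ih =>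
    have hS' := kernelSequence_shortExact (freeπ (kernelSequence (freeπ X)).X₁)
    -- The syzygy is again projective at each object, being a linear retract of a free module.
    refine extZero_succ_of_projective hS (ih _ (fun K => ?_) hS'
      (inferInstanceAs (Projective (freeCover _))))
    obtain ⟨r, hr⟩ := exists_retraction_app hS hX K
    have := freeCover_projective X K
    exact Module.Projective.of_split ((kernelSequence (freeπ X)).f.app (op K)).hom r
      (LinearMap.ext hr)

lemma trivial_projective (K : FiniteOrbit Γ) :
    Module.Projective R ((trivialContramodule R Γ).obj (op K)) :=
  Module.Projective.of_equiv (ULift.moduleEquiv (R := R) (M := R)).symm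

variable {H V} in
lemma trivial_hom_apply {M : BredonContramodule R Γ} (f : trivialContramodule R Γ ⟶ M)
    {X Y : FiniteOrbit Γ} (j : X ⟶ Y) (r : ULift.{v} R) :
    f.app (op X) r = M.map j.op (f.app (op Y) r) := naturality_apply f j r

-- A map from the constant contramodule to functions on flags does not see the point of a flag: it
-- is a cochain `Φ` on decreasing lists. If `Φ` is a cocycle, then `Φ ∘ s` is a primitive, since `s
-- ∘ bd` differs from the identity by `bd ∘ s`.
variable {H V} in
lemma exists_lift (s : ListChain (Set.Ioi H) →ₗ[ℤ] ListChain (Set.Ioi H))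
    (hs : ∀ l, l.Pairwise (· ≥ ·) → s (Finsupp.single l 1) ∈ on {l | l.Pairwise (· ≥ ·)})
    (hbd : ∀ z, bd (s z) = z - s (bd z)) (f : trivialContramodule R Γ ⟶ reducedCocycles H V) :
    ∃ g : trivialContramodule R Γ ⟶ flagFun H V, g ≫ diffHom H V = f := by
  classical
  let u : ∀ X : FiniteOrbit Γ, Flag H X → V := fun X => (f.app (op X) (ULift.up (1 : R))).1
  have hu : ∀ X, diff (R := R) X (u X) = 0 := fun X => (f.app (op X) (ULift.up (1 : R))).2.1
  have hmap : ∀ {X Y : FiniteOrbit Γ} (j : X ⟶ Y) (p : Flag H X), u X p = u Y (Flag.map j p) :=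
    fun j p => congrFun (congrArg Subtype.val (trivial_hom_apply f j (ULift.up 1))) p
  let φ : List (Set.Ioi H) → V := fun c =>
    if hc : c.Pairwise (· ≥ ·) then u _ ⟨(c, (ofSubgroup (top c)).pt), isFlag_top hc⟩ else 0
  let Φ : ListChain (Set.Ioi H) →ₗ[ℤ] V := Finsupp.linearCombination ℤ φ
  have hΦ : ∀ {X : FiniteOrbit Γ} {x : X.Pt} {c} (h : IsFlag H c x),
      Φ (Finsupp.single c 1) = u X ⟨(c, x), h⟩ := by
    intro X x c h
    have h1 : Φ (Finsupp.single c 1) = φ c := by simp [Φ]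
    rw [h1]
    simp only [φ]
    rw [dif_pos h.1, hmap h.hom, map_hom_top]
  have hbdΦ : ∀ {X : FiniteOrbit Γ} {x : X.Pt} {c} (_ : IsFlag H c x), Φ (bdList c) = 0 := by
    intro X x c h
    refine Eq.trans ?_ (congrFun (hu X) ⟨(c, x), h⟩)
    rw [diff_apply]
    refine eq_of_on (fun c' hc' => ?_) (bdList_mem c)
    have h' := h.sublist hc'.1
    rw [hΦ h', evalOn_single _ h']
  have hbd0 : ∀ z ∈ on {l : List (Set.Ioi H) | l.Pairwise (· ≥ ·)}, Φ (bd z) = 0 := by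
    intro z hz
    refine eq_of_on (f := Φ ∘ₗ bd) (g := 0) (fun c hc => ?_) hz
    rw [LinearMap.comp_apply, bd_single]
    exact hbdΦ (isFlag_top hc)
  let t : ∀ X : FiniteOrbit Γ, ULift.{v} R →ₗ[R] (Flag H X → V) := fun X =>
    LinearMap.pi fun p => (LinearMap.toSpanSingleton R V (Φ (s (Finsupp.single p.1.1 1)))) ∘ₗ
      (ULift.moduleEquiv (R := R) (M := R)).toLinearMap
  have ht : ∀ (X : FiniteOrbit Γ) r p, t X r p = r.down • Φ (s (Finsupp.single p.1.1 1)) :=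
    fun _ _ _ => rfl
  have hdiff : ∀ (X : FiniteOrbit Γ) r, diff (R := R) X (t X r) = r.down • u X := by
    intro X r
    funext p
    have h1 : evalOn (t X r) p.1.2 (bdList p.1.1) = r.down • Φ (s (bdList p.1.1)) :=
      eq_of_on (f := evalOn (t X r) p.1.2)
        (g := (DistribSMul.toAddMonoidHom V r.down).toIntLinearMap ∘ₗ Φ ∘ₗ s) (fun c hc => by
          rw [evalOn_single _ (p.2.sublist hc.1), ht]
          rfl) (bdList_mem p.1.1)
    have h2 := hbd (Finsupp.single p.1.1 1)
    rw [bd_single] at h2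
    have h3 : Φ (s (bdList p.1.1)) = u X p := by
      rw [← sub_sub_cancel (Finsupp.single p.1.1 1) (s (bdList p.1.1)), ← h2, map_sub,
        hbd0 _ (hs _ p.2.1), sub_zero]
      exact hΦ p.2
    rw [diff_apply, h1, h3]
    rfl
  refine ⟨{ app := fun X => ModuleCat.ofHom (t X.unop), naturality := fun X Y j => rfl }, ?_⟩
  ext X r
  refine Subtype.ext ((hdiff X.unop r).trans ?_)
  have h1 : (f.app X) r = r.down • (f.app X (ULift.up (1 : R))) :=
    (congrArg (f.app X) (ULift.ext _ _ (mul_one r.down).symm)).trans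
      ((f.app X).hom.map_smul r.down (ULift.up (1 : R)))
  exact (congrArg Subtype.val h1).symm

section concentrated

variable {H} {M : BredonContramodule R Γ} (hM : Concentrated M (ofSubgroup H))

include hM in
lemma stabilizer_eq_of_concentrated {X : FiniteOrbit Γ} (hX : Nontrivial (M.obj (op X))) {x : X.Pt}
    (h : H.1 ≤ MulAction.stabilizer Γ x) : MulAction.stabilizer Γ x = H.1 := by
  obtain ⟨e⟩ := hM X hX
  have := finite_stabilizer x
  refine (Subgroup.eq_of_le_of_card_ge h ?_).symm
  rw [card_stabilizer, card_eq_of_iso e]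
  rfl

open Classical in
/-- The value at an orbit of the embedding of a functor concentrated at `H` into functions. -/
def embeddingApp (H : FiniteSubgroup Γ) (M : BredonContramodule R Γ) (X : FiniteOrbit Γ) :
    M.obj (op X) →ₗ[R] (Flag H X → M.obj (op (ofSubgroup H))) :=
  LinearMap.pi fun p => if p.1.1 = [] ∧ MulAction.stabilizer Γ p.1.2 = H.1 then
    (M.map (isFlag_nil_of p).hom.op).hom else 0

lemma embeddingApp_pos {X : FiniteOrbit Γ} (m : M.obj (op X)) {p : Flag H X}
    (h : p.1.1 = [] ∧ MulAction.stabilizer Γ p.1.2 = H.1) :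
    embeddingApp H M X m p = M.map (isFlag_nil_of p).hom.op m :=
  congrArg (fun e : M.obj (op X) →ₗ[R] M.obj (op (ofSubgroup H)) => e m) (if_pos h)

lemma embeddingApp_neg {X : FiniteOrbit Γ} (m : M.obj (op X)) {p : Flag H X}
    (h : ¬ (p.1.1 = [] ∧ MulAction.stabilizer Γ p.1.2 = H.1)) :
    embeddingApp H M X m p = 0 :=
  congrArg (fun e : M.obj (op X) →ₗ[R] M.obj (op (ofSubgroup H)) => e m) (if_neg h)

include hM in
lemma embeddingApp_map {X Y : FiniteOrbit Γ} (f : X ⟶ Y) (m : M.obj (op Y)) :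
    embeddingApp H M X (M.map f.op m) = fun p => embeddingApp H M Y m (Flag.map f p) := by
  funext p
  by_cases h1 : p.1.1 = [] ∧ MulAction.stabilizer Γ (app f p.1.2) = H.1
  · rw [embeddingApp_pos _ ⟨h1.1,
      le_antisymm ((stabilizer_le f _).trans h1.2.le) p.2.2.1⟩]
    refine Eq.trans ?_ (embeddingApp_pos (p := Flag.map f p) m h1).symm
    rw [← map_comp_apply, IsFlag.hom_comp]
    rfl
  · refine Eq.trans ?_ (embeddingApp_neg (p := Flag.map f p) m h1).symm
    by_cases hX : Nontrivial (M.obj (op Y))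
    · by_cases h2 : p.1.1 = [] ∧ MulAction.stabilizer Γ p.1.2 = H.1
      · exact absurd ⟨h2.1, stabilizer_eq_of_concentrated hM hX
          (p.2.2.1.trans (stabilizer_le f _))⟩ h1
      · exact embeddingApp_neg _ h2
    · rw [not_nontrivial_iff_subsingleton] at hX
      rw [show m = 0 from hX.elim m 0, map_zero, map_zero]
      rfl

/-- The embedding of a functor concentrated at `H` into functions. -/
def embedding : M ⟶ exactFun H (M.obj (op (ofSubgroup H))) :=
  subLift _ _ (exactSub_map H _)
    { app := fun X => ModuleCat.ofHom (embeddingApp H M X.unop)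
      naturality := fun X Y f => by
        ext m
        exact embeddingApp_map hM f.unop m }
    fun X m p hp => by
      by_contra h
      exact hp (embeddingApp_neg m h)

instance : Mono (embedding hM) := by
  refine (ModuleFunctor.mono_iff _).2 fun X => ?_
  refine (injective_iff_map_eq_zero (embedding hM |>.app (op X.unop)).hom).2 fun m hm => ?_
  by_cases hX : Nontrivial (M.obj (op X.unop))
  · obtain ⟨e⟩ := hM X.unop hX
    have hx : MulAction.stabilizer Γ (app e.inv (ofSubgroup H).pt) = H.1 := by
      rw [stabilizer_iso, stabilizer_pt, ofSubgroup_stab]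
    let p : Flag H X.unop := ⟨([], app e.inv (ofSubgroup H).pt), List.Pairwise.nil, hx.ge, by simp⟩
    have h1 := congrFun (congrArg Subtype.val hm) p
    have h2 : M.map (isFlag_nil_of p).hom.op m = 0 :=
      (embeddingApp_pos m ⟨rfl, hx⟩).symm.trans h1
    have h3 : (isFlag_nil_of p).hom = e.inv := homOfPt_app e.inv hx.ge
    rw [h3] at h2
    have h4 := map_comp_apply M e.hom e.inv m
    rw [e.hom_inv_id, map_id_apply] at h4
    exact h4.trans ((congrArg _ h2).trans (map_zero _))
  · rw [not_nontrivial_iff_subsingleton] at hX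
    exact hX.elim m 0

lemma concentrated_exactFun : Concentrated (exactFun (R := R) H V) (ofSubgroup H) := by
  intro X hX
  have hX' : Nontrivial (exactSub (R := R) H V X) := hX
  obtain ⟨⟨m, hm⟩, h⟩ := exists_ne (0 : exactSub (R := R) H V X)
  have hm0 : m ≠ 0 := fun h' => h (Subtype.ext h')
  obtain ⟨p, hp⟩ := Function.ne_iff.1 hm0
  obtain ⟨-, h2⟩ := hm p hp
  obtain ⟨e⟩ := nonempty_iso_ofSubgroup p.1.2
  have h3 : stabilizerOf p.1.2 = H := Subtype.ext h2
  rw [h3] at e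
  exact ⟨e.symm⟩

variable [HasExt.{w} (BredonContramodule R Γ)]

/-- The value on empty flags is the same over all points of all orbits. Over the base point of `Γ /
K` with `K > H` it vanishes, because the stabilizer is not `H`. -/
lemma extZero_zero_exactFun [Nonempty (Set.Ioi H)] :
    ExtZero (trivialContramodule R Γ) (exactFun (R := R) H V) 0 := by
  rw [extZero_zero]
  intro f
  obtain ⟨K⟩ := ‹Nonempty (Set.Ioi H)›
  ext X r
  refine Subtype.ext (funext fun p : Flag H X.unop => ?_)
  change (f.app (op X.unop) r).1 p = 0
  by_contra h
  obtain ⟨h1, h2⟩ := (f.app (op X.unop) r).2 p h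
  obtain ⟨⟨c, x⟩, hp⟩ := p
  obtain rfl : c = [] := h1
  refine h ?_
  let q : Flag H (ofSubgroup H) := ⟨([], (ofSubgroup H).pt), isFlag_top List.Pairwise.nil⟩
  have hK : IsFlag H [] (ofSubgroup K.1).pt := by
    refine ⟨List.Pairwise.nil, ?_, by simp⟩
    rw [stabilizer_pt]
    exact (le_of_lt K.2 : H ≤ K.1)
  have e1 : (f.app (op (ofSubgroup H)) r).1 q = (f.app (op X.unop) r).1 (Flag.map hp.hom q) :=
    congrFun (congrArg Subtype.val (trivial_hom_apply f hp.hom r)) q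
  have e2 : (f.app (op (ofSubgroup H)) r).1 q =
      (f.app (op (ofSubgroup K.1)) r).1 (Flag.map hK.hom q) :=
    congrFun (congrArg Subtype.val (trivial_hom_apply f hK.hom r)) q
  have e3 : Flag.map hp.hom q = ⟨([], x), hp⟩ := Subtype.ext (Prod.ext rfl hp.app_hom)
  have e4 : Flag.map hK.hom q = ⟨([], (ofSubgroup K.1).pt), hK⟩ :=
    Subtype.ext (Prod.ext rfl hK.app_hom)
  rw [e3] at e1
  rw [e4] at e2
  refine e1.symm.trans (e2.trans ?_)
  by_contra h3
  have h4 := ((f.app (op (ofSubgroup K.1)) r).2 _ h3).2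
  rw [stabilizer_pt] at h4
  exact (ne_of_gt K.2 : K.1 ≠ H) (Subtype.ext h4)

/-- Functions on flags have no higher extensions, so the cocycle sequence shifts degrees from
`reducedCocycles`, a retract of `cocycles`, back to `cocycles`. The contraction of the poset starts
the induction in degree one. -/
lemma extZero_exactFun [ContractibleSpace (finiteSubgroupsAboveRealization H)] (n : ℕ) :
    ExtZero (trivialContramodule R Γ) (exactFun (R := R) H V) n := by
  have : Nonempty (Set.Ioi H) :=
    ⟨(NerveRealization.exists_coord_pos (Classical.arbitrary _)).choose⟩
  obtain ⟨s, hs, hbd⟩ := NerveRealization.exists_contraction (P := Set.Ioi H)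
  have hE := fun n => extZero_flagFun H V n (trivialContramodule R Γ) trivial_projective
  have hZ : ∀ n, ExtZero (trivialContramodule R Γ) (cocycles (R := R) H V) (n + 1) := by
    intro n
    induction n with
    | zero => exact extZero_left_one (cocycleSequence_shortExact H V) (exists_lift s hs hbd) (hE 0)
    | succ n ih =>
      exact ExtZero.left (cocycleSequence_shortExact H V)
        (ih.of_retract _ _ (reducedι_reducedπ H V)) (hE (n + 1))
  rcases n with _ | n
  · exact extZero_zero_exactFun V
  · exact (hZ n).of_retract _ _ (exactι_exactπ H V)

/-- The extensions of the trivial contramodule by a contramodule concentrated at `H` vanish if the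
poset of the finite subgroups above `H` is contractible. -/
theorem extZero_of_contractible [ContractibleSpace (finiteSubgroupsAboveRealization H)] (n : ℕ)
    {M : BredonContramodule R Γ} (hM : Concentrated M (ofSubgroup H)) :
    ExtZero (trivialContramodule R Γ) M n := by
  have hS := cokernelSequence_shortExact (embedding hM)
  induction n generalizing M with
  | zero =>
    rw [extZero_zero]
    intro f
    rw [← cancel_mono (embedding hM), zero_comp]
    exact extZero_zero.1 (extZero_exactFun _ 0) _
  | succ n ih =>
    -- The cokernel is again concentrated at `H`, so the induction hypothesis one degree lower
    -- applies to it.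
    have hC : Concentrated (cokernelSequence (embedding hM)).X₃ (ofSubgroup H) := by
      intro X hX
      refine concentrated_exactFun (R := R) (M.obj (op (ofSubgroup H))) X ?_
      by_contra h
      rw [not_nontrivial_iff_subsingleton] at h
      exact not_subsingleton _ (subsingleton_X₃_of_subsingleton hS h)
    exact ExtZero.left hS (ih hC (cokernelSequence_shortExact _)) (extZero_exactFun _ (n + 1))

end concentrated

end FlagModule

/-! ### The module of bounded functions -/

namespace BoundedFunctions

open TensorProduct

section free

variable {W : Type v}

/-- The restriction of locally constant functions to the principal ultrafilters. -/
def ofLocallyConstant (W : Type v) :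
    LocallyConstant (Ultrafilter W) ℤ →ₗ[ℤ] boundedFunctions ℤ W where
  toFun f := ⟨fun x => f (pure x), (f.range_finite).subset (by rintro _ ⟨x, rfl⟩; exact ⟨_, rfl⟩)⟩
  map_add' _ _ := rfl
  map_smul' _ _ := rfl

/-- The ultrafilters form the Stone–Čech compactification of the discrete set `W`, to which
functions with finite range extend uniquely. Nöbeling's theorem for this profinite space then gives
freeness over the integers. -/
lemma ofLocallyConstant_bijective : Function.Bijective (ofLocallyConstant W) := by
  constructor
  · intro f g h
    refine LocallyConstant.coe_injective ?_
    refine Continuous.ext_on denseRange_pure f.continuous g.continuous ?_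
    rintro _ ⟨x, rfl⟩
    exact congrFun (congrArg Subtype.val h) x
  · intro f
    have := f.2.to_subtype
    have hd : DiscreteTopology (Set.range f.1) := inferInstance
    let g : W → Set.range f.1 := fun x => ⟨f.1 x, x, rfl⟩
    let G : LocallyConstant (Ultrafilter W) (Set.range f.1) :=
      ⟨Ultrafilter.extend g, (IsLocallyConstant.iff_continuous _).2 (continuous_ultrafilter_extend g)⟩
    refine ⟨G.map Subtype.val, Subtype.ext (funext fun x => ?_)⟩
    exact congrArg Subtype.val (ultrafilter_extend_pure g x)

instance free_int : Module.Free ℤ (boundedFunctions ℤ W) :=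
  have : Module.Free ℤ (LocallyConstant (Ultrafilter W) ℤ) :=
    LocallyConstant.freeOfProfinite (Profinite.of (Ultrafilter W))
  Module.Free.of_equiv (LinearEquiv.ofBijective _ ofLocallyConstant_bijective)

variable (R : Type u) [CommRing R]

/-- The reduction of integer valued bounded functions. -/
def ofInt (W : Type v) : boundedFunctions ℤ W →ₗ[ℤ] boundedFunctions R W where
  toFun f := ⟨fun x => (f.1 x : R), (f.2.image (fun n : ℤ => (n : R))).subset (by
    rintro _ ⟨x, rfl⟩
    exact ⟨_, ⟨x, rfl⟩, rfl⟩)⟩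
  map_add' f g := Subtype.ext (funext fun x => by simp)
  map_smul' n f := Subtype.ext (funext fun x => by simp)

/-- The comparison of bounded functions with the base change of integer valued ones. -/
def compare (W : Type v) : R ⊗[ℤ] boundedFunctions ℤ W →ₗ[R] boundedFunctions R W :=
  (ofInt R W).liftBaseChange R

lemma compare_tmul (r : R) (f : boundedFunctions ℤ W) (x : W) :
    (compare R W (r ⊗ₜ f)).1 x = r * f.1 x := by
  rw [compare, LinearMap.liftBaseChange_tmul]
  rfl

lemma compare_surjective : Function.Surjective (compare R W) := by
  classical
  intro f
  let e : R → boundedFunctions ℤ W := fun r => ⟨fun x => if f.1 x = r then 1 else 0,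
    (Set.toFinite {0, 1}).subset (by
      rintro _ ⟨x, rfl⟩
      dsimp only
      split_ifs <;> simp)⟩
  refine ⟨∑ r ∈ f.2.toFinset, r ⊗ₜ e r, Subtype.ext (funext fun x => ?_)⟩
  rw [map_sum, Submodule.coe_sum, Finset.sum_apply]
  simp only [compare_tmul, e]
  simpa using fun h => absurd (f.2.mem_toFinset.2 ⟨x, rfl⟩) h

/-- The finitely many functions in a tensor factor through the finite set `Q` of their joint values,
where base change of integer functions is `R^Q`. -/
lemma compare_injective : Function.Injective (compare R W) := by
  rw [injective_iff_map_eq_zero]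
  intro t ht
  obtain ⟨S, rfl⟩ := TensorProduct.exists_finset t
  let q : W → ∀ i : S, Set.range i.1.2.1 := fun x i => ⟨i.1.2.1 x, x, rfl⟩
  have hfin : ∀ i : S, Finite (Set.range i.1.2.1) := fun i => i.1.2.2.to_subtype
  let Q := Set.range q
  have : Fintype Q := Fintype.ofFinite Q
  have : DecidableEq Q := Classical.decEq Q
  let π : (Q → ℤ) →ₗ[ℤ] boundedFunctions ℤ W :=
    { toFun := fun f => ⟨fun x => f ⟨q x, x, rfl⟩, (Set.finite_range f).subset (by
        rintro _ ⟨x, rfl⟩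
        exact ⟨_, rfl⟩)⟩
      map_add' := fun _ _ => rfl
      map_smul' := fun _ _ => rfl }
  let e : S → (Q → ℤ) := fun i y => (y.1 i).1
  have he : ∀ i, π (e i) = i.1.2 := fun i => rfl
  have h1 : ∑ i ∈ S, i.1 ⊗ₜ[ℤ] i.2 = π.lTensor R (∑ i : S, i.1.1 ⊗ₜ e i) := by
    rw [map_sum, ← Finset.sum_coe_sort]
    refine Finset.sum_congr rfl fun i _ => ?_
    rw [LinearMap.lTensor_tmul, he]
  rw [h1] at ht ⊢
  generalize ∑ i : S, i.1.1 ⊗ₜ[ℤ] e i = z at ht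
  have h2 : ∀ (z : R ⊗[ℤ] (Q → ℤ)) (x : W), (compare R W (π.lTensor R z)).1 x =
      TensorProduct.piScalarRight ℤ ℤ R Q z ⟨q x, x, rfl⟩ := by
    intro z x
    induction z using TensorProduct.induction_on with
    | zero => simp
    | tmul r f =>
      rw [LinearMap.lTensor_tmul, compare_tmul]
      simp [π, mul_comm]
    | add a b ha hb =>
      rw [map_add, map_add, map_add, Pi.add_apply, ← ha, ← hb]
      rfl
  have h3 : z = 0 := by
    refine (TensorProduct.piScalarRight ℤ ℤ R Q).injective ?_
    rw [map_zero]
    funext y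
    obtain ⟨_, x, rfl⟩ := y
    rw [← h2 z x, ht]
    rfl
  rw [h3, map_zero]

/-- The module of bounded functions is free. -/
instance free : Module.Free R (boundedFunctions R W) :=
  Module.Free.of_equiv (LinearEquiv.ofBijective (compare R W)
    ⟨compare_injective R, compare_surjective R⟩)

end free

section action

variable (R : Type u) [CommRing R] (W : Type v) [Group W]

/-- The constant function `1`. -/
def one : boundedFunctions R W := ⟨fun _ => 1, (Set.finite_singleton (1 : R)).subset (by
  rintro _ ⟨x, rfl⟩
  rfl)⟩

lemma rep_one (g : W) : boundedFunctionsRep R W g (one R W) = one R W := rfl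

/-- The evaluation at the neutral element. -/
def eval : boundedFunctions R W →ₗ[R] R := (LinearMap.proj 1) ∘ₗ (boundedFunctions R W).subtype

lemma eval_one : eval R W (one R W) = 1 := rfl

/-- The identity of the bounded functions is an average over any finite subgroup. -/
lemma exists_average (F : Subgroup W) [Fintype F] :
    ∃ τ : boundedFunctions R W →ₗ[R] boundedFunctions R W, ∀ b,
      ∑ g : F, boundedFunctionsRep R W g (τ (boundedFunctionsRep R W (g : W)⁻¹ b)) = b := by
  classical
  let rep : W → W := fun x => (Quotient.mk (QuotientGroup.rightRel F) x).out
  have hrep : ∀ x, ∃ g ∈ F, rep x = g * x := fun x => by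
    have h := QuotientGroup.rightRel_apply.1
      (Quotient.exact (Quotient.out_eq (Quotient.mk (QuotientGroup.rightRel F) x)))
    exact ⟨_, F.inv_mem h, by simp [rep]⟩
  have hrep' : ∀ (g : F) x, rep (g * x) = rep x := fun g x => by
    have : Quotient.mk (QuotientGroup.rightRel F) (g * x) =
        Quotient.mk (QuotientGroup.rightRel F) x :=
      Quotient.sound (QuotientGroup.rightRel_apply.2 (by simp))
    simp only [rep, this]
  -- Multiplication by the indicator function of a transversal of the cosets `F x`; the translates
  -- of the transversal under `F` partition `W`.
  let τ : boundedFunctions R W →ₗ[R] boundedFunctions R W :=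
    { toFun := fun b => ⟨fun x => if rep x = x then b.1 x else 0,
        ((b.2).insert 0).subset (by
          rintro _ ⟨x, rfl⟩
          dsimp only
          split_ifs
          · exact Or.inr ⟨x, rfl⟩
          · exact Or.inl rfl)⟩
      map_add' := fun b c => Subtype.ext (funext fun x => by
        change (if rep x = x then b.1 x + c.1 x else 0) = _ + _
        dsimp only
        split_ifs <;> simp)
      map_smul' := fun r b => Subtype.ext (funext fun x => by
        change (if rep x = x then r * b.1 x else 0) = r * _
        dsimp only
        split_ifs <;> simp) }
  refine ⟨τ, fun b => Subtype.ext (funext fun x => ?_)⟩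
  rw [Submodule.coe_sum, Finset.sum_apply]
  obtain ⟨k, hk, hkx⟩ := hrep x
  have h1 : ∀ g : F, (boundedFunctionsRep R W g (τ (boundedFunctionsRep R W (g : W)⁻¹ b))).1 x =
      if (⟨k, hk⟩ : F)⁻¹ = g then b.1 x else 0 := by
    intro g
    change (if rep ((g : W)⁻¹ * x) = (g : W)⁻¹ * x then b.1 ((g : W)⁻¹⁻¹ * ((g : W)⁻¹ * x)) else 0) = _
    have h2 : rep ((g : W)⁻¹ * x) = k * x := (hrep' g⁻¹ x).trans hkx
    have h3 : rep ((g : W)⁻¹ * x) = (g : W)⁻¹ * x ↔ (⟨k, hk⟩ : F)⁻¹ = g := by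
      rw [h2, mul_left_inj, Subtype.ext_iff, Subgroup.coe_inv, inv_eq_iff_eq_inv]
    rw [inv_inv, mul_inv_cancel_left]
    exact if_congr h3 rfl rfl
  rw [Finset.sum_congr rfl fun g _ => h1 g]
  simp

end action

end BoundedFunctions

/-! ### Coinduced contravariant functors -/

namespace Coinduction

open Opposite Limits ExtVanishing Contramodule TensorProduct Representation

universe w w'

section averages

variable {R W B N N' : Type*} [CommRing R] [Group W] [AddCommGroup B] [Module R B]
  [AddCommGroup N] [Module R N] [AddCommGroup N'] [Module R N']
  (β : Representation R W B) (σ : Representation R W N) (σ' : Representation R W N')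

/-- The identity of the representation is an average over any finite subgroup. -/
def HasAverages : Prop := ∀ (F : Subgroup W) [Fintype F],
  ∃ τ : B →ₗ[R] B, ∀ b, ∑ g : F, β g (τ (β (g : W)⁻¹ b)) = b

variable {β σ σ'} {I : Type*} [MulAction W I] {p : N →ₗ[R] N'}

lemma comp_linHom (hp : ∀ w n, p (σ w n) = σ' w (p n)) (w : W) (f : B →ₗ[R] N) :
    p ∘ₗ linHom β σ w f = linHom β σ' w (p ∘ₗ f) := by
  ext b
  exact hp w _

variable (hβ : HasAverages β) [Module.Projective R B] (hI : ∀ i : I, Finite (MulAction.stabilizer W i))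
  (hsurj : Function.Surjective p) (hp : ∀ w n, p (σ w n) = σ' w (p n)) {ψ : I → B →ₗ[R] N'}
  (hψ : ∀ w i, ψ (w • i) = linHom β σ' w (ψ i))
include hβ hI hsurj hp hψ

/-- The twisted average of a linear lift `f` is the sum of the translates of `f ∘ τ`. It lifts `ψ i`
because the conjugates of `τ` sum to the identity; no division by the order of the stabilizer is
needed. -/
lemma exists_invariant_lift (i : I) : ∃ f : B →ₗ[R] N, p ∘ₗ f = ψ i ∧
    ∀ h ∈ MulAction.stabilizer W i, linHom β σ h f = f := by
  have := hI i
  have : Fintype (MulAction.stabilizer W i) := Fintype.ofFinite _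
  obtain ⟨f, hf⟩ := Module.projective_lifting_property p (ψ i) hsurj
  obtain ⟨τ, hτ⟩ := hβ (MulAction.stabilizer W i)
  refine ⟨∑ g : MulAction.stabilizer W i, linHom β σ (g : W) (f ∘ₗ τ), ?_, fun h hh => ?_⟩
  · ext b
    have h1 : ∀ g : MulAction.stabilizer W i, p (linHom β σ (g : W) (f ∘ₗ τ) b) =
        ψ i (β g (τ (β (g : W)⁻¹ b))) := by
      intro g
      have h2 := LinearMap.congr_fun (hψ g i) (β g (τ (β (g : W)⁻¹ b)))
      rw [MulAction.mem_stabilizer_iff.1 g.2] at h2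
      refine (hp _ _).trans (Eq.trans ?_ h2.symm)
      change _ = σ' g (ψ i (β (g : W)⁻¹ (β g (τ (β (g : W)⁻¹ b)))))
      rw [inv_self_apply, ← hf]
      rfl
    rw [LinearMap.comp_apply, LinearMap.sum_apply, map_sum, Finset.sum_congr rfl fun g _ => h1 g,
      ← map_sum, hτ]
  · rw [map_sum]
    refine Fintype.sum_equiv (Equiv.mulLeft (⟨h, hh⟩ : MulAction.stabilizer W i)) _ _ fun g => ?_
    rw [← Module.End.mul_apply, ← map_mul]
    rfl

lemma exists_equivariant_lift : ∃ φ : I → B →ₗ[R] N,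
    (∀ w i, φ (w • i) = linHom β σ w (φ i)) ∧ ∀ i, p ∘ₗ φ i = ψ i := by
  choose f hf hfi using exists_invariant_lift hβ hI hsurj hp hψ
  -- A lift is chosen at one representative of each orbit and transported along it; invariance under
  -- the stabilizer makes the transport equivariant.
  let rep : I → I := fun i => (Quotient.mk (MulAction.orbitRel W I) i).out
  have hrep : ∀ i, ∃ w : W, w • rep i = i := fun i =>
    MulAction.orbitRel_apply.1 ((MulAction.orbitRel W I).symm (Quotient.exact
      (Quotient.out_eq (Quotient.mk (MulAction.orbitRel W I) i))))
  choose a ha using hrep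
  refine ⟨fun i => linHom β σ (a i) (f (rep i)), fun w i => ?_, fun i => ?_⟩
  · have h1 : rep (w • i) = rep i := by
      have : Quotient.mk (MulAction.orbitRel W I) (w • i) = Quotient.mk (MulAction.orbitRel W I) i :=
        Quotient.sound ⟨w, rfl⟩
      simp only [rep, this]
    have h2 : (w * a i)⁻¹ * a (w • i) ∈ MulAction.stabilizer W (rep i) := by
      rw [MulAction.mem_stabilizer_iff, mul_smul, inv_smul_eq_iff, mul_smul, ha]
      have := ha (w • i)
      rwa [h1] at this
    have h3 := hfi _ _ h2
    rw [map_mul, Module.End.mul_apply, inv_apply_eq_iff, map_mul, Module.End.mul_apply] at h3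
    change linHom β σ (a (w • i)) (f (rep (w • i))) = _
    rw [h1]
    exact h3
  · rw [comp_linHom hp, hf, ← hψ, ha]

end averages

section homs

variable {R W V N : Type*} [CommRing R] [Group W] [AddCommGroup V] [Module R V]
  {ρ : Representation R W V} [AddCommGroup N] [Module R N] [Module (MonoidAlgebra R W) N]
  [IsScalarTower R (MonoidAlgebra R W) N]

lemma ofModule'_apply (g : W) (n : N) :
    ofModule' (k := R) (G := W) N g n = MonoidAlgebra.single g (1 : R) • n := rfl

lemma single_one_smul (g : W) (v : ρ.asModule) :
    MonoidAlgebra.single g (1 : R) • v = ρ.asModuleEquiv.symm (ρ g (ρ.asModuleEquiv v)) := by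
  rw [single_smul, one_smul]
  rfl

/-- The linear map underlying a map of modules over the group ring. -/
def toLin (f : ρ.asModule →ₗ[MonoidAlgebra R W] N) : V →ₗ[R] N :=
  (f.restrictScalars R) ∘ₗ ρ.asModuleEquiv.symm.toLinearMap

lemma toLin_rho (f : ρ.asModule →ₗ[MonoidAlgebra R W] N) (g : W) (v : V) :
    toLin f (ρ g v) = ofModule' (k := R) (G := W) N g (toLin f v) := by
  rw [ofModule'_apply]
  exact (congrArg f (single_one_smul g _).symm).trans (f.map_smul _ _)

/-- The map of modules over the group ring given by an equivariant linear map. -/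
def ofLin (f : V →ₗ[R] N) (hf : ∀ g v, f (ρ g v) = ofModule' (k := R) (G := W) N g (f v)) :
    ρ.asModule →ₗ[MonoidAlgebra R W] N :=
  MonoidAlgebra.equivariantOfLinearOfComm (f ∘ₗ ρ.asModuleEquiv.toLinearMap) fun g v => by
    rw [single_smul, one_smul]
    exact hf g v

variable {V' : Type*} [AddCommGroup V'] [Module R V'] {ρ' : Representation R W V'}

/-- The map of modules over the group ring given by an intertwining map. -/
def mapAsModule (f : V →ₗ[R] V') (hf : ∀ g v, f (ρ g v) = ρ' g (f v)) :
    ρ.asModule →ₗ[MonoidAlgebra R W] ρ'.asModule :=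
  MonoidAlgebra.equivariantOfLinearOfComm
    (ρ'.asModuleEquiv.symm.toLinearMap ∘ₗ f ∘ₗ ρ.asModuleEquiv.toLinearMap) fun g v => by
    rw [single_one_smul, single_one_smul]
    exact hf g v

instance isScalarTower_asModule : IsScalarTower R (MonoidAlgebra R W) ρ.asModule :=
  Representation.instIsScalarTowerMonoidAlgebraAsModule ρ

lemma ofModule'_asModule (g : W) (v : V) :
    ofModule' (k := R) (G := W) ρ.asModule g (ρ.asModuleEquiv.symm v) =
      ρ.asModuleEquiv.symm (ρ g v) := single_one_smul g (ρ.asModuleEquiv.symm v)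

end homs

section tensor

variable (R : Type*) [CommRing R] {W : Type*} [Group W] (V B : Type*) [AddCommGroup V] [Module R V]
  [AddCommGroup B] [Module R B]

/-- The module underlying the tensor product of two representations. -/
def Tensor : Type _ := V ⊗[R] B

instance : AddCommGroup (Tensor R V B) := inferInstanceAs (AddCommGroup (V ⊗[R] B))

instance : Module R (Tensor R V B) := inferInstanceAs (Module R (V ⊗[R] B))

variable {R V B}

/-- The tensor product of two representations. -/
def tensorRep (ρ : Representation R W V) (β : Representation R W B) :
    Representation R W (Tensor R V B) := (ρ.tprod β : Representation R W (V ⊗[R] B))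

lemma tensorRep_equivariant {N : Type*} [AddCommGroup N] [Module R N] {σ : Representation R W N}
    {ρ : Representation R W V} {β : Representation R W B} {f : V ⊗[R] B →ₗ[R] N}
    (h : ∀ g m b, f (ρ g m ⊗ₜ β g b) = σ g (f (m ⊗ₜ b))) (g : W) (t : Tensor R V B) :
    f (tensorRep ρ β g t) = σ g (f t) :=
  LinearMap.congr_fun (f := f ∘ₗ TensorProduct.map (ρ g) (β g)) (g := σ g ∘ₗ f)
    (TensorProduct.ext' (h g)) t

end tensor

/-- A group acting on an object from the right. -/
structure RightAction {C : Type v} [Category.{v} C] (W : Type*) [Group W] (X₀ : C) where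
  /-- the morphism of an element -/
  hom : W → (X₀ ⟶ X₀)
  hom_one : hom 1 = 𝟙 X₀
  hom_mul : ∀ a b, hom (a * b) = hom a ≫ hom b

variable {R : Type u} [CommRing R] {C : Type v} [Category.{v} C] {W : Type v} [Group W] {X₀ : C}

namespace RightAction

variable (r : RightAction W X₀)

/-- The action on the morphisms to an object. -/
@[reducible]
def mulAction (K : C) : MulAction W (X₀ ⟶ K) where
  smul w f := r.hom w ≫ f
  one_smul f := by
    change r.hom 1 ≫ f = f
    rw [r.hom_one, Category.id_comp]
  mul_smul a b f := by
    change r.hom (a * b) ≫ f = r.hom a ≫ r.hom b ≫ f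
    rw [r.hom_mul, Category.assoc]

/-- The action on the values of a contravariant functor. -/
def rep (M : Cᵒᵖ ⥤ ModuleCat.{max u v} R) : Representation R W (M.obj (op X₀)) where
  toFun w := (M.map (r.hom w).op).hom
  map_one' := by
    ext m
    rw [r.hom_one]
    exact map_id_apply M m
  map_mul' a b := by
    ext m
    rw [r.hom_mul]
    exact map_comp_apply M _ _ m

end RightAction

variable (r : RightAction W X₀) {B : Type max u v} [AddCommGroup B] [Module R B]
  (β : Representation R W B)

section coind

variable {N N' : Type max u v} [AddCommGroup N] [Module R N] [AddCommGroup N'] [Module R N']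
  (σ : Representation R W N) (σ' : Representation R W N')

/-- The functions on morphisms from an object. -/
def homFun (X₀ : C) (V : Type max u v) [AddCommGroup V] [Module R V] :
    Cᵒᵖ ⥤ ModuleCat.{max u v} R where
  obj K := ModuleCat.of R ((X₀ ⟶ K.unop) → V)
  map f := ModuleCat.ofHom (LinearMap.funLeft R V fun g => g ≫ f.unop)
  map_id K := by
    refine ModuleCat.hom_ext (LinearMap.ext fun φ => ?_)
    exact funext fun g => congrArg φ (Category.comp_id g)
  map_comp f g := by
    refine ModuleCat.hom_ext (LinearMap.ext fun φ => ?_)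
    exact funext fun h => congrArg φ (Category.assoc h g.unop f.unop).symm

/-- The equivariant functions on morphisms. -/
def coindSub (K : C) : Submodule R ((X₀ ⟶ K) → B →ₗ[R] N) where
  carrier := {φ | ∀ w f, φ (r.hom w ≫ f) = linHom β σ w (φ f)}
  zero_mem' w f := (map_zero _).symm
  add_mem' {a b} ha hb w f := by rw [Pi.add_apply, ha, hb, Pi.add_apply, map_add]
  smul_mem' c a ha w f := by rw [Pi.smul_apply, ha, Pi.smul_apply, map_smul]

lemma coindSub_map {K L : C} (f : K ⟶ L) (φ : (X₀ ⟶ L) → B →ₗ[R] N) (hφ : φ ∈ coindSub r β σ L) :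
    (fun g => φ (g ≫ f)) ∈ coindSub r β σ K := fun w g => by
  refine Eq.trans ?_ (hφ w (g ≫ f))
  exact congrArg φ (Category.assoc _ _ _)

/-- The coinduced contravariant functor. -/
def coind : Cᵒᵖ ⥤ ModuleCat.{max u v} R :=
  sub (homFun X₀ (B →ₗ[R] N)) (coindSub r β σ) (coindSub_map r β σ)

variable {σ σ'} in
/-- The functoriality of coinduction. -/
def coindMap (p : N →ₗ[R] N') (hp : ∀ w n, p (σ w n) = σ' w (p n)) :
    coind r β σ ⟶ coind r β σ' :=
  subLift _ _ (coindSub_map r β σ')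
    { app := fun K => ModuleCat.ofHom (X := coindSub r β σ K.unop)
        ((LinearMap.pi fun f => (LinearMap.compRight R p) ∘ₗ LinearMap.proj f) ∘ₗ
          (coindSub r β σ K.unop).subtype)
      naturality := fun _ _ _ => rfl }
    fun _ φ w f => (congrArg (fun e => p ∘ₗ e) (φ.2 w f)).trans (comp_linHom hp w _)

variable {σ σ'} in
lemma coindMap_epi [Module.Projective R B] (hβ : HasAverages β)
    (hfin : ∀ K (f : X₀ ⟶ K), Set.Finite {w | r.hom w ≫ f = f})
    (p : N →ₗ[R] N') (hp : ∀ w n, p (σ w n) = σ' w (p n)) (hsurj : Function.Surjective p) :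
    Epi (coindMap r β p hp) := by
  refine (ModuleFunctor.epi_iff _).2 fun K ψ => ?_
  let := r.mulAction K.unop
  -- Elements of a coinduced functor at an object are equivariant families on the `W`-set of
  -- morphisms to it, whose stabilizers are finite.
  obtain ⟨φ, h1, h2⟩ := exists_equivariant_lift (I := X₀ ⟶ K.unop) hβ
    (fun f => (hfin K.unop f).to_subtype) hsurj hp ψ.2
  exact ⟨⟨φ, h1⟩, Subtype.ext (funext h2)⟩

end coind

section adjunction

variable (M : Cᵒᵖ ⥤ ModuleCat.{max u v} R)

/-- The tensor product of the value of a functor with a representation. -/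
def tensorFunctor : (Cᵒᵖ ⥤ ModuleCat.{max u v} R) ⥤ ModuleCat.{max u v} (MonoidAlgebra R W) where
  obj M := ModuleCat.of _ (tensorRep (r.rep M) β).asModule
  map {M M'} f := ModuleCat.ofHom (mapAsModule (ρ := tensorRep (r.rep M) β) (ρ' := tensorRep (r.rep M') β)
    ((f.app (op X₀)).hom.rTensor B) (tensorRep_equivariant (N := Tensor R (M'.obj (op X₀)) B)
      fun g m b => congrArg (fun m' => m' ⊗ₜ[R] β g b) (naturality_apply f (r.hom g) m)))
  map_id M := by
    ext t
    exact LinearMap.congr_fun (LinearMap.rTensor_id B (M.obj (op X₀))) t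
  map_comp f g := by
    ext t
    exact LinearMap.congr_fun (LinearMap.rTensor_comp B (g.app (op X₀)).hom (f.app (op X₀)).hom) t

lemma tensorFunctor_shortExact [Module.Flat R B] (S : ShortComplex (Cᵒᵖ ⥤ ModuleCat.{max u v} R))
    (hS : S.ShortExact) : ∃ h : (tensorFunctor r β).map S.f ≫ (tensorFunctor r β).map S.g = 0,
      (ShortComplex.mk _ _ h).ShortExact := by
  obtain ⟨h1, h2, h3⟩ := ModuleFunctor.shortExact_iff.1 hS (op X₀)
  have h0 : ∀ m, S.g.app (op X₀) (S.f.app (op X₀) m) = 0 := fun m =>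
    congrArg (fun e : S.X₁ ⟶ S.X₃ => e.app (op X₀) m) S.zero
  have hex : Function.Exact (S.f.app (op X₀)).hom (S.g.app (op X₀)).hom := fun x =>
    ⟨h3 x, by rintro ⟨y, rfl⟩; exact h0 y⟩
  have hex' := rTensor_exact B hex h2
  refine ⟨?_, ?_⟩
  · refine ModuleCat.hom_ext (LinearMap.ext fun t => ?_)
    exact (hex' _).2 ⟨t, rfl⟩
  · have : Mono ((tensorFunctor r β).map S.f) := (ModuleCat.mono_iff_injective _).2
      (Module.Flat.rTensor_preserves_injective_linearMap (M := B) (S.f.app (op X₀)).hom h1 :)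
    have : Epi ((tensorFunctor r β).map S.g) := (ModuleCat.epi_iff_surjective _).2
      (LinearMap.rTensor_surjective B h2 :)
    exact ⟨(ShortComplex.moduleCat_exact_iff _).2 fun t ht => (hex' t).1 ht⟩

section equiv

variable (N : Type max u v) [AddCommGroup N] [Module R N] [Module (MonoidAlgebra R W) N]
  [IsScalarTower R (MonoidAlgebra R W) N]

/-- The adjunction between the tensor product and coinduction. -/
def coindEquiv : ((tensorFunctor r β).obj M ⟶ ModuleCat.of (MonoidAlgebra R W) N) ≃
    (M ⟶ coind r β (ofModule' (k := R) (G := W) N)) where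
  toFun g := subLift _ _ (coindSub_map r β _)
    { app := fun K => ModuleCat.ofHom (LinearMap.pi fun f : X₀ ⟶ K.unop =>
        (TensorProduct.curry (toLin (ρ := tensorRep (r.rep M) β) g.hom)) ∘ₗ (M.map f.op).hom)
      naturality := fun K L f => by
        ext m
        exact funext fun h => congrArg (TensorProduct.curry (toLin (ρ := tensorRep (r.rep M) β) g.hom))
          (map_comp_apply M h f.unop m).symm }
    fun K m w f => by
      ext b
      refine Eq.trans ?_ (toLin_rho (ρ := tensorRep (r.rep M) β) g.hom w
        (M.map f.op m ⊗ₜ[R] β w⁻¹ b))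
      have h1 : M.map (r.hom w ≫ f).op m ⊗ₜ[R] b =
          r.rep M w (M.map f.op m) ⊗ₜ[R] β w (β w⁻¹ b) := by
        rw [self_inv_apply, map_comp_apply]
        rfl
      exact congrArg (toLin (ρ := tensorRep (r.rep M) β) g.hom) h1
  invFun φ := ModuleCat.ofHom (ofLin (TensorProduct.lift
      ((LinearMap.proj (𝟙 X₀)) ∘ₗ (coindSub r β _ X₀).subtype ∘ₗ (φ.app (op X₀)).hom))
      (tensorRep_equivariant fun g m b => by
          have h1 : (φ.app (op X₀) (M.map (r.hom g).op m)).1 (𝟙 X₀) =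
              (φ.app (op X₀) m).1 (𝟙 X₀ ≫ r.hom g) :=
            congrFun (congrArg Subtype.val (naturality_apply φ (r.hom g) m)) (𝟙 X₀)
          have h2 := (φ.app (op X₀) m).2 g (𝟙 X₀)
          rw [Category.comp_id] at h2
          rw [Category.id_comp] at h1
          refine (LinearMap.congr_fun (h1.trans h2) (β g b)).trans ?_
          rw [linHom_apply, LinearMap.comp_apply, LinearMap.comp_apply, inv_self_apply]
          rfl))
  left_inv g := by
    refine ModuleCat.hom_ext (LinearMap.ext fun t => ?_)
    refine LinearMap.congr_fun (f := _) (g := toLin (ρ := tensorRep (r.rep M) β) g.hom) (TensorProduct.ext' fun m b => ?_) t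
    exact congrArg (fun m' => toLin (ρ := tensorRep (r.rep M) β) g.hom (m' ⊗ₜ[R] b)) (map_id_apply M m)
  right_inv φ := by
    ext K m
    refine Subtype.ext (funext fun f => LinearMap.ext fun b => ?_)
    have h1 : (φ.app (op X₀) (M.map f.op m)).1 (𝟙 X₀) = (φ.app (op K.unop) m).1 (𝟙 X₀ ≫ f) :=
      congrFun (congrArg Subtype.val (naturality_apply φ f m)) (𝟙 X₀)
    rw [Category.id_comp] at h1
    exact LinearMap.congr_fun h1 b

variable {M N}

lemma coindEquiv_map {M' : Cᵒᵖ ⥤ ModuleCat.{max u v} R} (f : M ⟶ M')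
    (g : (tensorFunctor r β).obj M' ⟶ ModuleCat.of (MonoidAlgebra R W) N) :
    coindEquiv r β M N ((tensorFunctor r β).map f ≫ g) = f ≫ coindEquiv r β M' N g := by
  ext K m
  refine Subtype.ext (funext fun h => LinearMap.ext fun b => ?_)
  exact congrArg (fun m' => toLin (ρ := tensorRep (r.rep M') β) g.hom (m' ⊗ₜ[R] b))
    (naturality_apply f h m)

lemma coindEquiv_zero : coindEquiv r β M N 0 = 0 := rfl

variable {N' : Type max u v} [AddCommGroup N'] [Module R N'] [Module (MonoidAlgebra R W) N']
  [IsScalarTower R (MonoidAlgebra R W) N']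

lemma coindEquiv_comp (p : N →ₗ[MonoidAlgebra R W] N')
    (g : (tensorFunctor r β).obj M ⟶ ModuleCat.of (MonoidAlgebra R W) N) :
    coindEquiv r β M N' (g ≫ ModuleCat.ofHom p) = coindEquiv r β M N g ≫
      coindMap r β (p.restrictScalars R) fun _ _ => p.map_smul _ _ := rfl

end equiv

section extensions

variable [Module.Projective R B] (hβ : HasAverages β)
  (hfin : ∀ K (f : X₀ ⟶ K), Set.Finite {w | r.hom w ≫ f = f})
include hβ hfin

/-- A left adjoint preserves projectives when its right adjoint preserves epimorphisms, as
coinduction does by `coindMap_epi`. -/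
lemma tensorFunctor_projective (P : Cᵒᵖ ⥤ ModuleCat.{max u v} R) (hP : Projective P) :
    Projective ((tensorFunctor r β).obj P) where
  factors {E X} f e he := by
    let _ : Module R E := Module.compHom E (algebraMap R (MonoidAlgebra R W))
    let _ : Module R X := Module.compHom X (algebraMap R (MonoidAlgebra R W))
    have : IsScalarTower R (MonoidAlgebra R W) E := IsScalarTower.of_algebraMap_smul fun _ _ => rfl
    have : IsScalarTower R (MonoidAlgebra R W) X := IsScalarTower.of_algebraMap_smul fun _ _ => rfl
    have := coindMap_epi r β (σ := ofModule' (k := R) (G := W) E)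
      (σ' := ofModule' (k := R) (G := W) X) hβ hfin (e.hom.restrictScalars R)
      (fun _ _ => e.hom.map_smul _ _) ((ModuleCat.epi_iff_surjective e).1 he)
    refine ⟨(coindEquiv r β P E).symm (Projective.factorThru (coindEquiv r β P X f)
      (coindMap r β (e.hom.restrictScalars R) fun _ _ => e.hom.map_smul _ _)),
      (coindEquiv r β P X).injective ?_⟩
    refine (coindEquiv_comp r β e.hom _).trans ?_
    rw [Equiv.apply_symm_apply, Projective.factorThru_comp]

variable [HasExt.{w} (Cᵒᵖ ⥤ ModuleCat.{max u v} R)]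
  [HasExt.{w'} (ModuleCat.{max u v} (MonoidAlgebra R W))]

lemma extZero_coind {N : Type max u v} [AddCommGroup N] [Module R N] (σ : Representation R W N)
    {n : ℕ} (h : ExtZero ((tensorFunctor r β).obj M) (ModuleCat.of _ σ.asModule) n) :
    ExtZero M (coind r β σ) n := by
  have h1 := extZero_of_adjoint (tensorFunctor r β) (tensorFunctor_projective r β hβ hfin)
    (tensorFunctor_shortExact r β) (fun X => coindEquiv r β X σ.asModule) (coindEquiv_map r β)
    (fun X => coindEquiv_zero r β) n M h
  refine h1.of_retract (coindMap r β σ.asModuleEquiv.symm.toLinearMap fun w n => ?_)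
    (coindMap r β σ.asModuleEquiv.toLinearMap fun w n => ?_) rfl
  · exact (ofModule'_asModule w n).symm
  · exact ofModule'_asModule w (σ.asModuleEquiv n)

end extensions

/-- The tensor product of the constant functor with a representation. -/
def tensorConstIso : (tensorFunctor r β).obj ((Functor.const _).obj (ModuleCat.of R (ULift.{v} R))) ≅
    ModuleCat.of (MonoidAlgebra R W) β.asModule :=
  LinearEquiv.toModuleIso (LinearEquiv.ofBijective (mapAsModule
    (ρ := tensorRep (r.rep ((Functor.const _).obj (ModuleCat.of R (ULift.{v} R)))) β) (ρ' := β)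
    (TensorProduct.congr (ULift.moduleEquiv (R := R) (M := R)) (LinearEquiv.refl R B) ≪≫ₗ
      TensorProduct.lid R B).toLinearMap (tensorRep_equivariant fun g m b =>
        ((β g).map_smul m.down b).symm))
    (TensorProduct.congr (ULift.moduleEquiv (R := R) (M := R)) (LinearEquiv.refl R B) ≪≫ₗ
      TensorProduct.lid R B).bijective)

end adjunction

end Coinduction

/-! ### Resolving a concentrated functor by coinduced ones. -/

namespace Coinduction

open Opposite Limits ExtVanishing Contramodule TensorProduct Representation

universe w

section concentrated

variable {R : Type u} [CommRing R] {C : Type v} [Category.{v} C] {W : Type v} [Group W] {X₀ : C}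
  (r : RightAction W X₀) {B : Type max u v} [AddCommGroup B] [Module R B]
  (β : Representation R W B) (hbij : Function.Bijective r.hom)
  (hiso : ∀ {X : C} (f : X₀ ⟶ X), (X ⟶ X₀) → IsIso f)

section restriction

variable {N : Type max u v} [AddCommGroup N] [Module R N] (σ : Representation R W N)

/-- The equivariant functions on morphisms to an object isomorphic to the given one. -/
def isoSub (X : C) : Submodule R (coindSub r β σ X) :=
  restrictTo R (Nonempty (X ≅ X₀)) (coindSub r β σ X)

-- If `Y` is isomorphic to `X₀` and `X` maps to `Y`, then any morphism from `X₀` to `X` is an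
-- isomorphism. If there is none, the functions on morphisms to `X` are zero.
include hiso in
lemma isoSub_map {X Y : C} (f : X ⟶ Y) (φ : coindSub r β σ Y)
    (hφ : φ ∈ isoSub r β σ Y) :
    (⟨fun g => φ.1 (g ≫ f), coindSub_map r β σ f φ.1 φ.2⟩ : coindSub r β σ X) ∈
      isoSub r β σ X := by
  rcases hφ with ⟨⟨e⟩⟩ | rfl
  · by_cases h : Nonempty (X₀ ⟶ X)
    · obtain ⟨g⟩ := h
      have := hiso g (f ≫ e.hom)
      exact Or.inl ⟨(asIso g).symm⟩
    · exact Or.inr (Subtype.ext (funext fun g => absurd ⟨g⟩ h))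
  · exact Or.inr rfl

/-- The part of the coinduced functor concentrated at the object. -/
def isoCoind : Cᵒᵖ ⥤ ModuleCat.{max u v} R :=
  sub (coind r β σ) (isoSub r β σ) (isoSub_map r β hiso σ)

lemma concentrated_isoCoind : Concentrated (isoCoind r β hiso σ) X₀ :=
  fun X hX => (of_nontrivial_restrictTo (p := Nonempty (X ≅ X₀)) (V := coindSub r β σ X) hX).1

variable [HasExt.{w} (Cᵒᵖ ⥤ ModuleCat.{max u v} R)] {T : Cᵒᵖ ⥤ ModuleCat.{max u v} R}

/-- The quotient of `coind` by its part at `X₀` lives strictly above `X₀`, and contributes to the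
sequence one degree lower. -/
lemma extZero_isoCoind {n : ℕ} (h : ExtZero T (coind r β σ) n)
    (hJ : ∀ k, n = k + 1 → ∀ J : Cᵒᵖ ⥤ ModuleCat.{max u v} R, (∀ X, Nontrivial (J.obj (op X)) →
      Nonempty (X₀ ⟶ X) ∧ ¬ Nonempty (X ≅ X₀)) → ExtZero T J k) :
    ExtZero T (isoCoind r β hiso σ) n := by
  let ι : isoCoind r β hiso σ ⟶ coind r β σ := subι _ _ (isoSub_map r β hiso σ)
  have hι : Mono ι := (ModuleFunctor.mono_iff _).2 fun _ => Subtype.val_injective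
  rcases n with _ | k
  · rw [extZero_zero]
    intro f
    rw [← cancel_mono ι, zero_comp]
    exact extZero_zero.1 h _
  · have hS := cokernelSequence_shortExact ι
    refine ExtZero.left hS (hJ k rfl _ fun X hX => ⟨?_, fun hX' => ?_⟩) h
    · by_contra h'
      have : Subsingleton (coindSub r β σ X) :=
        ⟨fun a b => Subtype.ext (funext fun g => absurd ⟨g⟩ h')⟩
      have := subsingleton_X₃_of_subsingleton hS this
      exact not_subsingleton _ this
    · have := subsingleton_X₃_of_surjective hS (X := X) fun φ => ⟨⟨φ, Or.inl hX'⟩, rfl⟩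
      exact not_subsingleton _ this

end restriction

variable {M : Cᵒᵖ ⥤ ModuleCat.{max u v} R} {one : B}

lemma eq_of_map_iso {X Y : C} (f : X ⟶ Y) [IsIso f] {m m' : M.obj (op Y)}
    (h : M.map f.op m = M.map f.op m') : m = m' := by
  have h1 : ∀ m, M.map (inv f).op (M.map f.op m) = m := fun m => by
    rw [← map_comp_apply, IsIso.inv_hom_id, map_id_apply]
  rw [← h1 m, h, h1]

variable (M one) in
open Classical in
/-- The value of an equivariant function on isomorphisms at an invariant vector. -/
def evalApp (X : C) : coindSub r β (r.rep M) X →ₗ[R] M.obj (op X) :=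
  if h : Nonempty (X ≅ X₀) then
    (M.map h.some.hom.op).hom ∘ₗ (LinearMap.applyₗ one) ∘ₗ (LinearMap.proj h.some.inv) ∘ₗ
      (coindSub r β (r.rep M) X).subtype
  else 0

variable (hone : ∀ w, β w one = one)

-- Two choices of isomorphism differ by an element of `W`, and the vector `one` does not notice it.
-- This makes the evaluation natural.
include hbij hone in
lemma map_evalApp {X : C} (φ : coindSub r β (r.rep M) X) (hX : Nonempty (X ≅ X₀)) (f : X₀ ⟶ X) :
    M.map f.op (evalApp r β M one X φ) = φ.1 f one := by
  obtain ⟨w, hw⟩ := hbij.2 (f ≫ hX.some.hom)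
  have h1 : f = r.hom w ≫ hX.some.inv := by rw [hw, Category.assoc, Iso.hom_inv_id, Category.comp_id]
  have h2 : evalApp r β M one X φ = M.map hX.some.hom.op (φ.1 hX.some.inv one) := by
    rw [evalApp, dif_pos hX]
    rfl
  have h3 : φ.1 f one = r.rep M w (φ.1 hX.some.inv (β w⁻¹ one)) := by
    conv_lhs => rw [h1, φ.2 w]
    rfl
  rw [h2, h3, hone, ← map_comp_apply, ← hw]
  rfl

/-- The evaluation of the coinduced functor in the functor it is coinduced from. -/
def evalHom (hM : Concentrated M X₀) : isoCoind r β hiso (r.rep M) ⟶ M where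
  app X := ModuleCat.ofHom (X := isoSub r β (r.rep M) X.unop) (evalApp r β M one X.unop ∘ₗ
    (isoSub r β (r.rep M) X.unop).subtype)
  naturality X Y f := by
    refine ModuleCat.hom_ext (LinearMap.ext fun φ => ?_)
    change evalApp r β M one Y.unop ⟨fun g => φ.1.1 (g ≫ f.unop), coindSub_map r β _ f.unop _ φ.1.2⟩ =
      M.map f.unop.op (evalApp r β M one X.unop φ.1)
    by_cases hY : Nontrivial (M.obj (op Y.unop))
    · obtain ⟨e⟩ := hM Y.unop hY
      rcases φ.2 with hX | h0
      · refine eq_of_map_iso e.inv ?_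
        rw [← map_comp_apply, map_evalApp r β hbij hone _ ⟨e⟩]
        exact (map_evalApp r β hbij hone φ.1 hX _).symm
      · rw [h0, map_zero, map_zero]
        exact map_zero (evalApp r β M one Y.unop)
    · rw [not_nontrivial_iff_subsingleton] at hY
      exact Subsingleton.elim _ _

lemma evalHom_epi (hM : Concentrated M X₀) (ε : B →ₗ[R] R) (hε : ε one = 1) :
    Epi (evalHom r β hbij hiso hone hM) := by
  refine (ModuleFunctor.epi_iff _).2 fun X m => ?_
  by_cases hX : Nontrivial (M.obj (op X.unop))
  · obtain ⟨e⟩ := hM X.unop hX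
    choose k hk using hbij.2
    -- The morphisms from `X₀` to `X` form a free transitive `W`-set, so any value at `e.inv`
    -- extends equivariantly. Since `ε one = 1`, evaluating this one at `one` gives back `m`.
    let f₀ : B →ₗ[R] M.obj (op X₀) := LinearMap.toSpanSingleton R _ (M.map e.inv.op m) ∘ₗ ε
    have hφ : (fun f => linHom β (r.rep M) (k (f ≫ e.hom)) f₀) ∈ coindSub r β (r.rep M) X.unop := by
      intro w f
      have : k ((r.hom w ≫ f) ≫ e.hom) = w * k (f ≫ e.hom) :=
        hbij.1 (by rw [hk, r.hom_mul, hk, Category.assoc])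
      change linHom β (r.rep M) (k ((r.hom w ≫ f) ≫ e.hom)) f₀ = _
      rw [this, map_mul]
      rfl
    refine ⟨⟨⟨_, hφ⟩, Or.inl ⟨e⟩⟩, eq_of_map_iso e.inv ?_⟩
    refine (map_evalApp r β hbij hone _ ⟨e⟩ e.inv).trans ?_
    have h1 : k (e.inv ≫ e.hom) = 1 := hbij.1 (by rw [hk, r.hom_one, Iso.inv_hom_id])
    change linHom β (r.rep M) (k (e.inv ≫ e.hom)) f₀ one = _
    rw [h1, map_one]
    change ε one • M.map e.inv.op m = _
    rw [hε, one_smul]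
  · rw [not_nontrivial_iff_subsingleton] at hX
    exact ⟨0, Subsingleton.elim _ _⟩

variable [HasExt.{w} (Cᵒᵖ ⥤ ModuleCat.{max u v} R)] {T : Cᵒᵖ ⥤ ModuleCat.{max u v} R}

include hbij hiso hone in
/-- The extensions by functors concentrated at an object vanish in high degrees, if this is so for
coinduced functors and for functors supported strictly above the object. -/
theorem extZero_of_coind (ε : B →ₗ[R] R) (hε : ε one = 1) {n₀ n₁ : ℕ}
    (hG : ∀ n ≥ n₀, ∀ M : Cᵒᵖ ⥤ ModuleCat.{max u v} R, ExtZero T (coind r β (r.rep M)) n)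
    (hJ : ∀ k, n₀ ≤ k + 1 → ∀ J : Cᵒᵖ ⥤ ModuleCat.{max u v} R, (∀ X, Nontrivial (J.obj (op X)) →
      Nonempty (X₀ ⟶ X) ∧ ¬ Nonempty (X ≅ X₀)) → ExtZero T J k)
    (hT : ∀ n ≥ n₁, ∀ M : Cᵒᵖ ⥤ ModuleCat.{max u v} R, ExtZero T M n)
    {n : ℕ} (hn : n₀ ≤ n) (hM : Concentrated M X₀) : ExtZero T M n := by
  -- Descending induction on the degree: passing to the kernel raises it by one, until `n₁` is
  -- reached, from where on everything vanishes.
  obtain ⟨k, hk⟩ : ∃ k, n₁ ≤ n + k := ⟨n₁, Nat.le_add_left _ _⟩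
  induction k generalizing n M with
  | zero => exact hT n hk M
  | succ k ih =>
    have := evalHom_epi r β hbij hiso hone hM ε hε
    have hS := kernelSequence_shortExact (evalHom r β hbij hiso hone hM)
    refine ExtZero.right hS (extZero_isoCoind r β hiso _ (hG n hn M)
      fun j hj => hJ j (hj ▸ hn)) (ih (hn.trans n.le_succ) (fun X hX => ?_) (by omega))
    refine concentrated_isoCoind r β hiso (r.rep M) X ?_
    by_contra h
    rw [not_nontrivial_iff_subsingleton] at h
    exact not_subsingleton _ (subsingleton_X₁_of_subsingleton hS h)

end concentrated

end Coinduction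

/-! ### The action of the Weyl group on an orbit -/

namespace WeylAction

open FiniteOrbit Coinduction

variable {Γ : Type v} [Group Γ] (H : FiniteSubgroup Γ)

lemma mem_stabilizer_mk {K : Subgroup Γ} {g a : Γ} :
    a ∈ MulAction.stabilizer Γ (g : Γ ⧸ K) ↔ g⁻¹ * a * g ∈ K := by
  rw [MulAction.mem_stabilizer_iff, mul_assoc, eq_comm]
  exact QuotientGroup.eq

/-- The point of `Γ / H` given by an element of the Weyl group. -/
def point (w : WeylGroup H.1) : (ofSubgroup H).Pt :=
  Quotient.liftOn' w (fun n => ((n : Γ) : Γ ⧸ H.1)) fun a b hab => by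
    exact QuotientGroup.eq.2 (Subgroup.mem_subgroupOf.1 (QuotientGroup.leftRel_apply.1 hab))

lemma point_injective : Function.Injective (point H) := by
  intro a b hab
  induction a using QuotientGroup.induction_on with
  | H a =>
    induction b using QuotientGroup.induction_on with
    | H b => exact QuotientGroup.eq.2 (Subgroup.mem_subgroupOf.2 (QuotientGroup.eq.1 hab))

lemma le_stabilizer_point (w : WeylGroup H.1) :
    (ofSubgroup H).stab ≤ MulAction.stabilizer Γ (point H w) := by
  induction w using QuotientGroup.induction_on with
  | H n =>
    intro a ha
    refine mem_stabilizer_mk.2 ?_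
    have := (Subgroup.mem_normalizer_iff.1 n⁻¹.2 a).1 ha
    simpa using this

/-- The right action of the Weyl group on the orbit. -/
def rightAction : RightAction (WeylGroup H.1) (ofSubgroup H) where
  hom w := homOfPt (point H w) (le_stabilizer_point H w)
  hom_one := hom_ext (ofSubgroup H).pt (by rw [app_homOfPt]; rfl)
  hom_mul a b := by
    refine hom_ext (ofSubgroup H).pt ?_
    rw [app_comp, app_homOfPt, app_homOfPt]
    induction a using QuotientGroup.induction_on with
    | H m =>
      induction b using QuotientGroup.induction_on with
      | H n =>
        have h1 : point H (QuotientGroup.mk m) = (m : Γ) • (ofSubgroup H).pt := by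
          exact congrArg (fun g : Γ => (g : Γ ⧸ H.1)) (mul_one (m : Γ)).symm
        rw [h1, app_smul, app_homOfPt]
        rfl

lemma app_hom_pt (w : WeylGroup H.1) :
    app ((rightAction H).hom w) (ofSubgroup H).pt = point H w :=
  app_homOfPt _ (le_stabilizer_point H w)

/-- An endomorphism sends the base point to some `gH`; equality of the two stabilizers says that `g`
normalizes `H`. -/
lemma hom_bijective : Function.Bijective (rightAction H).hom := by
  constructor
  · intro a b hab
    refine point_injective H ?_
    rw [← app_hom_pt, ← app_hom_pt, hab]
  · intro f
    obtain ⟨g, hg⟩ := QuotientGroup.mk_surjective (s := H.1) (app f (ofSubgroup H).pt)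
    have h1 := stabilizer_eq_of_card_le f le_rfl (ofSubgroup H).pt
    rw [stabilizer_pt, ← hg] at h1
    have hn : g⁻¹ ∈ Subgroup.normalizer (H.1 : Set Γ) := by
      rw [Subgroup.mem_normalizer_iff]
      intro a
      have h2 : a ∈ H.1 ↔ a ∈ MulAction.stabilizer Γ (g : Γ ⧸ H.1) :=
        iff_of_eq (congrArg (a ∈ ·) h1)
      rw [inv_inv, h2, mem_stabilizer_mk]
    refine ⟨QuotientGroup.mk ⟨g, by simpa using inv_mem hn⟩, hom_ext (ofSubgroup H).pt ?_⟩
    rw [app_hom_pt, ← hg]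
    rfl

/-- If `w` fixes `f`, then its point is a translate of the base point by an element of the finite
stabilizer of the image of the base point. -/
lemma finite_stabilizer_hom (K : FiniteOrbit Γ) (f : ofSubgroup H ⟶ K) :
    Set.Finite {w | (rightAction H).hom w ≫ f = f} := by
  have := finite_stabilizer (app f (ofSubgroup H).pt)
  have h1 : Set.Finite (Set.range fun g : MulAction.stabilizer Γ (app f (ofSubgroup H).pt) =>
    (g : Γ) • (ofSubgroup H).pt) := Set.finite_range _
  refine Set.Finite.of_finite_image (f := point H) (h1.subset ?_) (point_injective H).injOn
  rintro _ ⟨w, hw, rfl⟩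
  obtain ⟨g, hg⟩ := exists_smul_eq (ofSubgroup H).pt (point H w)
  refine ⟨⟨g, ?_⟩, hg⟩
  rw [MulAction.mem_stabilizer_iff, ← app_smul, hg, ← app_hom_pt, ← app_comp]
  exact congrArg (fun f => app f (ofSubgroup H).pt) hw

end WeylAction

/-! ### The bound for the cohomological dimension -/

namespace BredonDimension

open Opposite Limits ExtVanishing Contramodule FiniteOrbit

lemma lt_of_toExtendedInt_le {d : WithBot ℕ∞} {z : ℤ}
    (h : toExtendedInt d ≤ ((z : WithTop ℤ) : WithBot (WithTop ℤ))) {n : ℕ} (hn : z < n) :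
    d < n := by
  induction d with
  | bot => exact WithBot.bot_lt_coe _
  | coe d =>
    have h1 : WithTop.map (fun n : ℕ => (n : ℤ)) d ≤ (z : WithTop ℤ) := WithBot.coe_le_coe.1 h
    refine WithBot.coe_lt_coe.2 ?_
    induction d with
    | top => exact absurd (top_le_iff.1 h1) (WithTop.coe_ne_top)
    | coe d =>
      have h2 : (d : ℤ) ≤ z := WithTop.coe_le_coe.1 h1
      exact ENat.natCast_lt_natCast.2 (by omega)

lemma toExtendedInt_le {d : WithBot ℕ∞} {z : ℤ} (h : ∀ n : ℕ, z < n → d < n) :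
    toExtendedInt d ≤ ((z : WithTop ℤ) : WithBot (WithTop ℤ)) := by
  induction d with
  | bot => exact bot_le
  | coe d =>
    refine WithBot.coe_le_coe.2 ?_
    have h' : ∀ n : ℕ, z < n → d < n := fun n hn => WithBot.coe_lt_coe.1 (h n hn)
    induction d with
    | top => exact absurd (h' (z + 1).toNat (by omega)) (not_lt.2 le_top)
    | coe d =>
      refine WithTop.coe_le_coe.2 ?_
      by_contra hd
      exact lt_irrefl _ (h' d (not_le.1 hd))

variable {R : Type u} [CommRing R] {Γ : Type v} [Group Γ]

lemma concentrated_of_iso {M : BredonContramodule R Γ} {X Y : FiniteOrbit Γ} (e : X ≅ Y)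
    (hM : Concentrated M X) : Concentrated M Y := fun Z hZ => (hM Z hZ).map fun i => i ≪≫ e

variable [HasExt (BredonContramodule R Γ)]

lemma extZero_of_coinduction (H : FiniteSubgroup Γ) {n₀ n₁ : ℕ}
    (hpd : HasProjectiveDimensionLT (boundedModule R (WeylGroup H.1)) n₀)
    (hJ : ∀ k, n₀ ≤ k + 1 → ∀ J : BredonContramodule R Γ, (∀ X, Nontrivial (J.obj (op X)) →
      Nonempty (ofSubgroup H ⟶ X) ∧ ¬ Nonempty (X ≅ ofSubgroup H)) →
        ExtZero (trivialContramodule R Γ) J k)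
    (hT : HasProjectiveDimensionLT (trivialContramodule R Γ) n₁)
    {n : ℕ} (hn : n₀ ≤ n) {M : BredonContramodule R Γ} (hM : Concentrated M (ofSubgroup H)) :
    ExtZero (trivialContramodule R Γ) M n := by
  let _ := HasExt.standard (ModuleCat.{max u v} (MonoidAlgebra R (WeylGroup H.1)))
  let β := boundedFunctionsRep R (WeylGroup H.1)
  let r := WeylAction.rightAction H
  have hF : HasProjectiveDimensionLT ((Coinduction.tensorFunctor r β).obj
      (trivialContramodule R Γ)) n₀ :=
    have : HasProjectiveDimensionLT (ModuleCat.of _ β.asModule) n₀ := hpd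
    hasProjectiveDimensionLT_of_iso (Coinduction.tensorConstIso r β).symm n₀
  refine Coinduction.extZero_of_coind r β (WeylAction.hom_bijective H)
    (fun f g => isIso_of_card_le f (card_le_of_hom g)) (BoundedFunctions.rep_one R _)
    (BoundedFunctions.eval R _) (BoundedFunctions.eval_one R _)
    (fun k hk M => Coinduction.extZero_coind r β (trivialContramodule R Γ)
      (fun F _ => BoundedFunctions.exists_average R _ F) (WeylAction.finite_stabilizer_hom H) _
      fun e => e.eq_zero_of_hasProjectiveDimensionLT n₀ hk) hJ
    (fun k hk M e => e.eq_zero_of_hasProjectiveDimensionLT n₁ hk) hn hM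

variable (b : ℕ) (hb : ∀ H : Subgroup Γ, Finite H → Nat.card H ≤ b)

include hb in
lemma extZero_of_support {n : ℕ} {M : BredonContramodule R Γ}
    (h : ∀ X, Nontrivial (M.obj (op X)) → ∃ K : FiniteSubgroup Γ, Nonempty (X ≅ ofSubgroup K) ∧
      ∀ M' : BredonContramodule R Γ, Concentrated M' (ofSubgroup K) →
        ExtZero (trivialContramodule R Γ) M' n) :
    ExtZero (trivialContramodule R Γ) M n := by
  refine extZero_of_concentrated (fun X : FiniteOrbit Γ => Nat.card X.stab)
    (fun f => card_le_of_hom f) (fun f h => isIso_of_card_le f h.ge) (k := b + 1)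
    (fun X _ => Nat.lt_succ_of_le (hb _ X.finite)) fun X hX M' hM' => ?_
  obtain ⟨K, ⟨e⟩, hK⟩ := h X hX
  exact hK M' (concentrated_of_iso e hM')

include hb in
lemma extZero_concentrated (l : FiniteSubgroup Γ → ℤ) {n₁ : ℕ}
    (hT : HasProjectiveDimensionLT (trivialContramodule R Γ) n₁)
    (hpd : ∀ H : FiniteSubgroup Γ,
      HasProjectiveDimensionLT (boundedModule R (WeylGroup H.1)) (l H + 1).toNat)
    (h : ∀ H : FiniteSubgroup Γ, (∀ K : FiniteSubgroup Γ, H < K → l K < l H) ∨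
      ContractibleSpace (finiteSubgroupsAboveRealization H)) (H : FiniteSubgroup Γ) {n : ℕ}
    (hn : l H < n) {M : BredonContramodule R Γ} (hM : Concentrated M (ofSubgroup H)) :
    ExtZero (trivialContramodule R Γ) M n := by
  induction hm : b - Nat.card H.1 using Nat.strong_induction_on generalizing H n M with
  | h m ih =>
    rcases h H with h1 | h1
    · refine extZero_of_coinduction H (hpd H) (fun k hk J hJ => ?_) hT (by omega) hM
      refine extZero_of_support b hb fun X hX => ?_
      obtain ⟨⟨f⟩, hX'⟩ := hJ X hX
      obtain ⟨e⟩ := nonempty_iso_ofSubgroup (app f (ofSubgroup H).pt)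
      have hle := stabilizer_le f (ofSubgroup H).pt
      rw [stabilizer_pt, ofSubgroup_stab] at hle
      have hlt : H < stabilizerOf (app f (ofSubgroup H).pt) := by
        refine lt_of_le_of_ne hle fun heq => hX' ?_
        rw [← heq] at e
        exact ⟨e.symm⟩
      have hfin := (stabilizerOf (app f (ofSubgroup H).pt)).2
      have hcard : Nat.card H.1 < Nat.card (stabilizerOf (app f (ofSubgroup H).pt)).1 := by
        by_contra hc
        exact hlt.ne (Subtype.ext (Subgroup.eq_of_le_of_card_ge hle (not_lt.1 hc)))
      have := hb _ hfin
      have := h1 _ hlt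
      exact ⟨_, ⟨e.symm⟩, fun M' hM' => ih _ (by omega) _ (by omega) hM' rfl⟩
    · exact FlagModule.extZero_of_contractible n hM

end BredonDimension

theorem mainTheorem3 (R : Type u) [CommRing R] (Γ : Type v) [Group Γ]
    (hΓ : HasBoundedFiniteSubgroups Γ)
    (hcd : bredonCd R Γ < ⊤)
    (l : FiniteSubgroup Γ → ℤ) (hl : Antitone l)
    (hpd : ∀ H : FiniteSubgroup Γ,
      toExtendedInt (projectiveDimension (boundedModule R (WeylGroup H.1))) ≤
        ((l H : WithTop ℤ) : WithBot (WithTop ℤ)))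
    (h : ∀ H : FiniteSubgroup Γ,
      (∀ K : FiniteSubgroup Γ, H < K → l K < l H) ∨
        ContractibleSpace (finiteSubgroupsAboveRealization H)) :
    toExtendedInt (bredonCd R Γ) ≤
      ((l (FiniteSubgroup.one Γ) : WithTop ℤ) : WithBot (WithTop ℤ)) := by
  let _ := HasExt.standard (BredonContramodule R Γ)
  obtain ⟨b, hb⟩ := hΓ
  obtain ⟨n₁, hn₁⟩ := (projectiveDimension_ne_top_iff _).1 hcd.ne
  have hpd' : ∀ H : FiniteSubgroup Γ,
      HasProjectiveDimensionLT (boundedModule R (WeylGroup H.1)) (l H + 1).toNat := fun H =>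
    projectiveDimension_lt_iff.1 (BredonDimension.lt_of_toExtendedInt_le (hpd H) (by omega))
  refine BredonDimension.toExtendedInt_le fun n hn => projectiveDimension_lt_iff.2 ?_
  refine HasProjectiveDimensionLT.mk fun i hi M => ?_
  -- Every orbit can occur in the support of an arbitrary `M`; as `l` reverses order, its maximum
  -- `l(1)` bounds the degrees needed at each of them.
  refine BredonDimension.extZero_of_support b hb fun X _ => ⟨FiniteOrbit.stabilizerOf X.pt,
    (FiniteOrbit.nonempty_iso_ofSubgroup X.pt).map Iso.symm, fun M' hM' => ?_⟩
  refine BredonDimension.extZero_concentrated b hb l hn₁ hpd' h _ ?_ hM'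
  have : l (FiniteOrbit.stabilizerOf X.pt) ≤ l (FiniteSubgroup.one Γ) :=
    hl (bot_le : (⊥ : Subgroup Γ) ≤ (FiniteOrbit.stabilizerOf X.pt).1)
  omega

end
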